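/- **Theorem (near-optimal ground-state energy estimation).** Setting: $H$ is an unknown Hermitian operator on $n$ qubits whose spectrum is contained in $[\eta,\pi-\eta]$ for some $\eta>0$; $\lambda_0$ is its least eigenvalue. $H$ is accessible only through the black-box unitary $U=e^{-iH}$, and a black-box $n$-qubit unitary $U_I$ prepares a state $|\phi_0\rangle=U_I|0^n\rangle$ with $|\langle\phi_0|\psi_0\rangle|\ge\gamma$ for a normalized ground state $|\psi_0\rangle$ of $H$, where $0<\gamma\le 1$ is known. An algorithm is a classically controlled adaptive sequence of coherent runs; in each run all qubits are initialized to $|0\rangle$, a circuit consisting of one- and two-qubit unitary gates, queries to $U$ or $U^\dagger$ (possibly controlled by one ancilla qubit) and queries to $U_I$ or $U_I^\dagger$ is applied, and the qubits are measured in the computational basis. The query depth of $U$ is the largest number of queries to $U$ and $U^\dagger$ in one coherent run. All costs are worst case over the measurement outcomes, and classical processing is free. Claim: there are absolute constants $C>0$ and $k\in\mathbb N$ such that for all $n$, $\eta>0$, $0<\gamma\le1$, $0<\varepsilon<1$, $0<\vartheta\le 1/2$ there is an algorithm which, for all $H$ and $U_I$ as above, outputs a number within $\varepsilon$ of $\lambda_0$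 with probability at least $1-\vartheta$, at the following cost, where $\widetilde O(g)$ means $C\,g\,(1+\log(1+g))^k$: 1. $\widetilde O(\varepsilon^{-1}\gamma^{-1}\log(\vartheta^{-1}))$ queries to (controlled) $U$ and its inverse, and at most $C\gamma^{-1}\big(\log(\varepsilon^{-1}\vartheta^{-1})\big)^k$ queries to $U_I$ and its inverse; 2. three ancilla qubits ($n+3$ qubits in total); 3. $\widetilde O\big(n\gamma^{-1}\log(\varepsilon^{-1}\vartheta^{-1})+\varepsilon^{-1}\gamma^{-1}\log(\vartheta^{-1})\big)$ additional one- and two-qubit gates; 4. query depth of $U$ at most $\widetilde O(\varepsilon^{-1}\gamma^{-1})$ (in particular $\widetilde O(\varepsilon^{-1}\gamma^{-1}\log(\vartheta^{-1}))$). -/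

import Mathlib

/-! ### Hybrid quantum algorithms on `n` system qubits and `a` ancilla qubits -/

/-- Labels of the computational basis states of the `n` system qubits. -/
abbrev SysBasis (n : ℕ) : Type := Fin n → Fin 2

/-- Operators on the `n` system qubits, as matrices in the computational basis. -/
abbrev SysMatrix (n : ℕ) : Type := Matrix (SysBasis n) (SysBasis n) ℂ

/-- The qubits of the whole device: `n` system qubits and `a` ancilla qubits, nothing else. -/
abbrev Wire (n a : ℕ) : Type := Fin n ⊕ Fin a

/-- Labels of the computational basis states of the whole device. -/
abbrev DevBasis (n a : ℕ) : Type := Wire n a → Fin 2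

/-- State vectors of the whole device, given by their amplitudes. -/
abbrev DevState (n a : ℕ) : Type := DevBasis n a → ℂ

/-- The elementary operations of a circuit: arbitrary one-qubit and two-qubit unitary gates on any
qubits, and queries to two black-box unitaries (and to their inverses) acting on the system
register. The oracle `U` may be controlled by one ancilla qubit. The Boolean `inv` tells whether
the inverse is applied. -/
inductive QOp (n a : ℕ) : Type
  | oneQubit (q : Wire n a) (G : Matrix.unitaryGroup (Fin 2) ℂ)
  | twoQubit (q r : Wire n a) (hqr : q ≠ r) (G : Matrix.unitaryGroup (Fin 2 × Fin 2) ℂ)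
  | queryU (control : Option (Fin a)) (inv : Bool)
  | queryUI (inv : Bool)

namespace QOp

variable {n a : ℕ}

/-- Is the operation a query to (controlled) `U` or its inverse? -/
def isQueryU : QOp n a → Bool
  | queryU _ _ => true
  | _ => false

/-- Is the operation a query to `U_I` or its inverse? -/
def isQueryUI : QOp n a → Bool
  | queryUI _ => true
  | _ => false

/-- Is the operation an (additional) one- or two-qubit gate? -/
def isGate : QOp n a → Bool
  | oneQubit _ _ => true
  | twoQubit _ _ _ _ => true
  | _ => false

/-- The operator `V ⊗ I`, with `V` acting on the system register. -/
noncomputable def applySys (V : SysMatrix n) (ψ : DevState n a) : DevState n a :=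
  fun z => ∑ x : SysBasis n, V (fun i => z (Sum.inl i)) x * ψ (Sum.elim x fun j => z (Sum.inr j))

/-- The action of an operation on a state vector, when the oracles are `U` and `UI`. -/
noncomputable def apply (U UI : SysMatrix n) : QOp n a → DevState n a → DevState n a
  | oneQubit q G, ψ => fun z => ∑ b : Fin 2, G.1 (z q) b * ψ (Function.update z q b)
  | twoQubit q r _ G, ψ => fun z =>
      ∑ b : Fin 2 × Fin 2,
        G.1 (z q, z r) b * ψ (Function.update (Function.update z q b.1) r b.2)
  | queryU none inv, ψ => applySys (if inv then U.conjTranspose else U) ψ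
  | queryU (some j) inv, ψ => fun z =>
      if z (Sum.inr j) = 1 then applySys (if inv then U.conjTranspose else U) ψ z else ψ z
  | queryUI inv, ψ => applySys (if inv then UI.conjTranspose else UI) ψ

end QOp

/-- A circuit: a list of operations, the first one being applied first. -/
abbrev QCircuit (n a : ℕ) : Type := List (QOp n a)

/-- The state obtained by running the circuit on the all-zero state of the whole device. -/
noncomputable def QCircuit.run {n a : ℕ} (U UI : SysMatrix n) (c : QCircuit n a) : DevState n a :=
  c.foldl (fun ψ g => g.apply U UI ψ) (Pi.single (fun _ => 0) 1)

/-- A hybrid quantum-classical algorithm with a real output. It either stops with an output, or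
makes one coherent run: all qubits are initialized to zero, a circuit is executed, all qubits are
measured in the computational basis, and the algorithm goes on depending on the outcome. The
algorithm has no access to the oracles other than through the queries in its circuits. -/
inductive QAlg (n a : ℕ) : Type
  | output (e : ℝ) : QAlg n a
  | coherentRun (c : QCircuit n a) (next : DevBasis n a → QAlg n a) : QAlg n a

namespace QAlg

variable {n a : ℕ}

/-- The probability that the output of the algorithm lies in `S` (Born rule in each run). -/
noncomputable def prob (U UI : SysMatrix n) (S : Set ℝ) : QAlg n a → ℝ
  | output e => S.indicator (fun _ => 1) e
  | coherentRun c next => ∑ z : DevBasis n a, ‖c.run U UI z‖ ^ 2 * prob U UI S (next z)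

/-- The total number of operations of kind `p`, over all coherent runs, in the worst case over the
measurement outcomes. -/
def totalCount (p : QOp n a → Bool) : QAlg n a → ℕ
  | output _ => 0
  | coherentRun c next => List.countP p c + Finset.univ.sup fun z => totalCount p (next z)

/-- The largest number of operations of kind `p` in a single coherent run. -/
def maxCountPerRun (p : QOp n a → Bool) : QAlg n a → ℕ
  | output _ => 0
  | coherentRun c next => max (List.countP p c) (Finset.univ.sup fun z => maxCountPerRun p (next z))

/-- Total number of queries to (controlled) `U` and its inverse. -/
def queriesU (A : QAlg n a) : ℕ := A.totalCount QOp.isQueryU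

/-- Total number of queries to `U_I` and its inverse. -/
def queriesUI (A : QAlg n a) : ℕ := A.totalCount QOp.isQueryUI

/-- Total number of additional one- and two-qubit gates. -/
def gates (A : QAlg n a) : ℕ := A.totalCount QOp.isGate

/-- Query depth of `U`: the number of queries to `U` in one coherent run. -/
def queryDepthU (A : QAlg n a) : ℕ := A.maxCountPerRun QOp.isQueryU

end QAlg

/-! ### The ground-state energy problem -/

/-- The time-evolution operator `U = e^{-iH}`. -/
noncomputable def timeEvolution {n : ℕ} (H : SysMatrix n) : SysMatrix n :=
  NormedSpace.exp ((-Complex.I) • H)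

/-- The state `|φ₀⟩ = U_I |0ⁿ⟩` prepared by `U_I`. -/
noncomputable def preparedState {n : ℕ} (UI : SysMatrix n) : EuclideanSpace ℂ (SysBasis n) :=
  WithLp.toLp 2 (UI.mulVec (Pi.single (fun _ => 0) 1))

/-- `H` is a Hamiltonian with spectrum in `[η, π - η]` and ground-state energy `lam₀`, and the
initial guess prepared by the unitary `UI` has overlap at least `γ` with a (normalized) ground
state. -/
structure IsGroundStateInstance {n : ℕ} (η γ : ℝ) (H UI : SysMatrix n) (lam₀ : ℝ) : Prop where
  isHermitian : H.IsHermitian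
  spectrum_subset : spectrum ℝ H ⊆ Set.Icc η (Real.pi - η)
  isLeast : IsLeast (spectrum ℝ H) lam₀
  unitary : UI ∈ Matrix.unitaryGroup (SysBasis n) ℂ
  overlap : ∃ ψ₀ : EuclideanSpace ℂ (SysBasis n), ‖ψ₀‖ = 1 ∧
    H.mulVec ψ₀.ofLp = (lam₀ : ℂ) • ψ₀.ofLp ∧ γ ≤ ‖inner ℂ (preparedState UI) ψ₀‖

/-- The explicit form `C · g · (1 + log (1 + g)) ^ k` of a bound `g · polylog(g)`, for `g ≥ 0`. -/
noncomputable def softBound (C : ℝ) (k : ℕ) (g : ℝ) : ℝ :=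
  C * g * (1 + Real.log (1 + g)) ^ k

/-! It suffices to decide whether `λ₀ ≤ μ - δ` or `λ₀ ≥ μ + δ`, with `δ = ε / 2`. Bisection asks
this `O(log ε⁻¹)` times and keeps two overlapping halves, so that inside the gap either answer is
harmless (`prob_bisect`).

One decision uses a polynomial `P` of degree `O(ε⁻¹ log (ε⁻¹ γ⁻¹))` whose modulus at `e^{-iλ}` is at
least `1 / 4` for `λ ≤ μ - δ` and at most `γ / 200` for `λ ≥ μ + δ` (`exists_energy_filter`). It is
a smoothed indicator of an arc: powers of a normalized Dirichlet kernel, translated along half of a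
uniform grid. The sum over the whole grid is constant, so where one half is tiny the other carries
nearly everything. Fejér–Riesz gives `Q` with `|P|² + |Q|² = 1` on the circle, and stripping one
degree at a time writes `(P, Q)` as a product of one-qubit rotations and phases `diag (1, z)`
(`exists_rotations`). Replacing the phases by controlled queries to `U` applies `P(U)` to the
prepared state, flagged by one signal qubit. The flag amplitude is at least `γ / 4` or at most `γ /
200` (`le_norm_filteredState`, `norm_filteredState_le`).

Amplitude amplification tells these apart. A round triples the angle (`amplify_apply`), and `j`
nested rounds multiply it by `3 ^ j`. The overlap is only bounded below, so every level up to `3 ^ J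
~ γ⁻¹` is tried; the costs form a geometric series of size `O(γ⁻¹)`. Some level succeeds with
probability at least `1 / 4` in the first case (`exists_amplified`), while in the second all levels
together rarely do. Repetition and a majority vote reduce the error.

The reflection about the zero state needs a sign controlled by all `n + 1` logical qubits. Each half
of the system register lends its qubits as dirty workspace to the other (`multiToggle_act`), so
linearly many gates and two work qubits besides the signal qubit suffice.

A coherent run holds a single amplified circuit, hence the query depth is independent of `ϑ`. The
numbers of bisection steps and of votes do not depend on `γ`, hence no `log γ⁻¹` enters the count of
queries to `U_I`. -/

/-! ### Polynomials on the unit circle: spectral factorization and signal processing -/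

section UnitCircle

open Polynomial ComplexConjugate

/-- The conjugate reciprocal `z ^ N * conj (p (1 / conj z))` of a polynomial of degree at most `N`. -/
noncomputable def conjReflect (N : ℕ) (p : ℂ[X]) : ℂ[X] := reflect N (p.map (starRingEnd ℂ))

theorem conjReflect_eval {N : ℕ} {p : ℂ[X]} (hp : p.natDegree ≤ N) {z : ℂ} (hz : z ≠ 0) :
    (conjReflect N p).eval z = z ^ N * conj (p.eval (conj z)⁻¹) := by
  let : Invertible z⁻¹ := invertibleOfNonzero (inv_ne_zero hz)
  have h := eval₂_reflect_mul_pow (RingHom.id ℂ) z⁻¹ N (p.map (starRingEnd ℂ))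
    ((natDegree_map_le).trans hp)
  rw [invOf_eq_inv, inv_inv] at h
  have h2 : eval₂ (RingHom.id ℂ) z⁻¹ (p.map (starRingEnd ℂ)) = conj (p.eval (conj z)⁻¹) := by
    rw [eval₂_id, eval_map, ← eval₂_hom]
    simp
  rw [h2] at h
  rw [← h, conjReflect, eval₂_id, mul_comm, mul_assoc, inv_pow, inv_mul_cancel₀ (pow_ne_zero _ hz),
    mul_one]

theorem inv_conj_of_norm_eq_one {z : ℂ} (hz : ‖z‖ = 1) : (conj z)⁻¹ = z := by
  have h0 : z ≠ 0 := by rintro rfl; simp at hz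
  rw [inv_eq_iff_eq_inv, Complex.inv_def, Complex.normSq_eq_norm_sq, hz]
  simp

theorem conjReflect_eval_circle {N : ℕ} {p : ℂ[X]} (hp : p.natDegree ≤ N) {z : ℂ} (hz : ‖z‖ = 1) :
    (conjReflect N p).eval z = z ^ N * conj (p.eval z) := by
  have h0 : z ≠ 0 := by rintro rfl; simp at hz
  rw [conjReflect_eval hp h0, inv_conj_of_norm_eq_one hz]

theorem conjReflect_coeff {N k : ℕ} (p : ℂ[X]) (hk : k ≤ N) :
    (conjReflect N p).coeff k = conj (p.coeff (N - k)) := by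
  rw [conjReflect, coeff_reflect, revAt_le hk, coeff_map]

theorem natDegree_conjReflect_le {N : ℕ} {p : ℂ[X]} (hp : p.natDegree ≤ N) :
    (conjReflect N p).natDegree ≤ N := by
  refine natDegree_reflect_le.trans (max_le le_rfl ((natDegree_map_le).trans hp))

theorem infinite_unit_circle : {z : ℂ | ‖z‖ = 1}.Infinite := by
  have h : (Set.range fun t : Set.Ioo (0:ℝ) 1 => Complex.exp (t.1 * Complex.I)).Infinite := by
    have : Infinite (Set.Ioo (0:ℝ) 1) := (Set.Ioo_infinite one_pos).to_subtype
    apply Set.infinite_range_of_injective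
    · intro s t hst
      simp only at hst
      rw [Complex.exp_eq_exp_iff_exists_int] at hst
      obtain ⟨k, hk⟩ := hst
      have h2 : (s.1 : ℝ) = t.1 + k * (2 * Real.pi) := by
        have := congrArg Complex.im hk
        simpa using this
      have hs := s.2
      have ht := t.2
      have hpi := Real.pi_gt_three
      have hk0 : k = 0 := by
        by_contra hne
        rcases lt_or_gt_of_ne hne with h | h
        · have : (k : ℝ) ≤ -1 := by exact_mod_cast Int.le_sub_one_of_lt h
          nlinarith [hs.1, hs.2, ht.1, ht.2]
        · have : (1 : ℝ) ≤ k := by exact_mod_cast h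
          nlinarith [hs.1, hs.2, ht.1, ht.2]
      subst hk0
      exact Subtype.ext (by simpa using h2)
  refine h.mono ?_
  rintro _ ⟨t, rfl⟩
  simp [Complex.norm_exp_ofReal_mul_I]

/-- Lets identities on the circle, where conjugation is inversion, be read off as identities between
coefficients. -/
theorem eq_of_eval_circle {p q : ℂ[X]} (h : ∀ z : ℂ, ‖z‖ = 1 → p.eval z = q.eval z) : p = q :=
  eq_of_infinite_eval_eq p q (infinite_unit_circle.mono fun z hz => h z hz)

theorem mul_conj_eq_norm_sq (z : ℂ) : z * conj z = ((‖z‖ ^ 2 : ℝ) : ℂ) := by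
  rw [Complex.mul_conj, Complex.normSq_eq_norm_sq]

/-- **Fejér–Riesz**: a trigonometric polynomial that is positive on the unit circle is the squared
modulus of a polynomial. -/
theorem exists_spectral_factor (d : ℕ) : ∀ S : ℂ[X], S.natDegree ≤ 2 * d →
    (∀ z : ℂ, ‖z‖ = 1 → ∃ t : ℝ, 0 < t ∧ S.eval z = t * z ^ d) →
    ∃ Q : ℂ[X], Q.natDegree ≤ d ∧ ∀ z : ℂ, ‖z‖ = 1 → S.eval z = (‖Q.eval z‖ ^ 2 : ℝ) * z ^ d := by
  induction d with
  | zero =>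
    intro S hS hpos
    obtain ⟨t, ht, h1⟩ := hpos 1 (by simp)
    have hC : S = C (t : ℂ) := by
      rw [eq_C_of_natDegree_le_zero hS]
      congr 1
      rw [eq_C_of_natDegree_le_zero hS] at h1
      simpa using h1
    refine ⟨C (Real.sqrt t : ℂ), by simp, fun z _ => ?_⟩
    rw [hC]
    simp only [eval_C, pow_zero, mul_one, Complex.norm_real, Real.norm_eq_abs, sq_abs]
    rw [Real.sq_sqrt ht.le]
  | succ d ih =>
    intro S hS hpos
    -- `S / z ^ (d + 1)` is real on the circle, so `S` is its own conjugate reciprocal: the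
    -- coefficients are symmetric and the roots come in pairs `ρ`, `1 / conj ρ`.
    have hsymm : conjReflect (2 * (d + 1)) S = S := by
      apply eq_of_eval_circle
      intro z hz
      rw [conjReflect_eval_circle hS hz]
      obtain ⟨t, ht, h1⟩ := hpos z hz
      rw [h1, map_mul, Complex.conj_ofReal, map_pow]
      have : z ^ (2 * (d + 1)) = z ^ (d + 1) * z ^ (d + 1) := by ring
      have h3 : z ^ (d + 1) * conj z ^ (d + 1) = 1 := by
        rw [← mul_pow, mul_conj_eq_norm_sq, hz]; simp
      rw [this]
      linear_combination (t * z ^ (d + 1)) * h3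
    -- By symmetry the top coefficient then vanishes too, and division by `X` lowers the degree
    -- bound by two.
    by_cases h0 : S.coeff 0 = 0
    · obtain ⟨S', hS'⟩ := X_dvd_iff.mpr h0
      have htop : S.coeff (2 * (d + 1)) = 0 := by
        rw [← hsymm, conjReflect_coeff _ le_rfl]
        simp [h0]
      have hdeg : S'.natDegree ≤ 2 * d := by
        rw [natDegree_le_iff_coeff_eq_zero]
        intro k hk
        have : S'.coeff k = S.coeff (k + 1) := by rw [hS', coeff_X_mul]
        rw [this]
        rcases Nat.lt_or_ge (2 * (d + 1)) (k + 1) with h | h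
        · exact coeff_eq_zero_of_natDegree_lt (hS.trans_lt h)
        · rwa [show k + 1 = 2 * (d + 1) by omega]
      obtain ⟨Q, hQ, hQe⟩ := ih S' hdeg (by
        intro z hz
        have hz0 : z ≠ 0 := by rintro rfl; simp at hz
        obtain ⟨t, ht, h1⟩ := hpos z hz
        refine ⟨t, ht, ?_⟩
        rw [hS', eval_mul, eval_X] at h1
        apply mul_left_cancel₀ hz0
        rw [h1]; ring)
      refine ⟨Q, hQ.trans (Nat.le_succ d), fun z hz => ?_⟩
      rw [hS', eval_mul, eval_X, hQe z hz]
      ring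
    · have hdeg : S.natDegree = 2 * (d + 1) := by
        apply le_antisymm hS
        apply le_natDegree_of_ne_zero
        rw [← hsymm, conjReflect_coeff _ le_rfl]
        simpa using h0
      obtain ⟨ρ, hρ⟩ := Complex.exists_root (f := S) (by
        rw [← natDegree_pos_iff_degree_pos, hdeg]; omega)
      have hρ0 : ρ ≠ 0 := by
        rintro rfl
        apply h0
        rw [coeff_zero_eq_eval_zero]; exact hρ
      -- Strict positivity keeps the roots off the circle, so `ρ` differs from its mirror image `σ`
      -- and both linear factors split off.
      have hρ1 : ‖ρ‖ ≠ 1 := by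
        intro h1
        obtain ⟨t, ht, h2⟩ := hpos ρ h1
        rw [hρ] at h2
        have : (t : ℂ) * ρ ^ (d + 1) ≠ 0 :=
          mul_ne_zero (by exact_mod_cast ht.ne') (pow_ne_zero _ hρ0)
        exact this h2.symm
      have hcρ0 : conj ρ ≠ 0 := by simpa using hρ0
      set σ := (conj ρ)⁻¹ with hσ
      have hσ0 : σ ≠ 0 := inv_ne_zero hcρ0
      have hσroot : S.IsRoot σ := by
        rw [IsRoot, ← hsymm, conjReflect_eval hS hσ0, hσ, map_inv₀, Complex.conj_conj, inv_inv,
          hρ, map_zero, mul_zero]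
      have hne : ρ ≠ σ := by
        intro h
        apply hρ1
        have h2 : ρ * conj ρ = 1 := by rw [hσ] at h; nth_rewrite 1 [h]; exact inv_mul_cancel₀ hcρ0
        rw [mul_conj_eq_norm_sq] at h2
        have h3 : ‖ρ‖ ^ 2 = 1 := by exact_mod_cast h2
        exact by nlinarith [norm_nonneg ρ]
      obtain ⟨S₁, hS₁⟩ := dvd_iff_isRoot.mpr hρ
      have hS₁root : S₁.IsRoot σ := by
        rw [IsRoot, hS₁, eval_mul] at hσroot
        rcases mul_eq_zero.mp hσroot with h | h
        · exfalso
          apply hne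
          simp only [eval_sub, eval_X, eval_C] at h
          exact (sub_eq_zero.mp h).symm
        · exact h
      obtain ⟨S₂, hS₂⟩ := dvd_iff_isRoot.mpr hS₁root
      have hSne : S ≠ 0 := by rintro rfl; simp at h0
      have hS₂ne : S₂ ≠ 0 := by rintro rfl; apply hSne; rw [hS₁, hS₂]; simp
      have hd2 : S₂.natDegree ≤ 2 * d := by
        have : S.natDegree = 1 + (1 + S₂.natDegree) := by
          rw [hS₁, hS₂, natDegree_mul (X_sub_C_ne_zero _) (mul_ne_zero (X_sub_C_ne_zero _) hS₂ne),
            natDegree_mul (X_sub_C_ne_zero _) hS₂ne, natDegree_X_sub_C, natDegree_X_sub_C]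
        omega
      -- On the circle `(z - ρ) (z - σ) = -σ z |z - ρ|²`. The constant `-σ` goes to the cofactor, to
      -- which induction applies, and `X - C ρ` becomes a factor of `Q`.
      have key : ∀ z : ℂ, ‖z‖ = 1 →
          S.eval z = z * ((‖z - ρ‖ ^ 2 : ℝ) : ℂ) * ((C (-σ) * S₂).eval z) := by
        intro z hz
        have hzz : z * conj z = 1 := by rw [mul_conj_eq_norm_sq, hz]; simp
        rw [← mul_conj_eq_norm_sq, hS₁, hS₂]
        simp only [eval_mul, eval_sub, eval_X, eval_C, map_sub]
        have h1 : z - σ = -σ * z * (conj z - conj ρ) := by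
          have : σ * conj ρ = 1 := inv_mul_cancel₀ hcρ0
          linear_combination (-σ) * hzz * (-1) + (-z) * this
        rw [h1]; ring
      obtain ⟨Q, hQ, hQe⟩ := ih (C (-σ) * S₂) ((natDegree_C_mul_le _ _).trans hd2) (by
        intro z hz
        have hz0 : z ≠ 0 := by rintro rfl; simp at hz
        have hzρ : 0 < ‖z - ρ‖ := by
          rw [norm_pos_iff, sub_ne_zero]; rintro rfl; exact hρ1 hz
        obtain ⟨t, ht, h1⟩ := hpos z hz
        refine ⟨t / ‖z - ρ‖ ^ 2, by positivity, ?_⟩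
        rw [key z hz] at h1
        have hne' : ((‖z - ρ‖ ^ 2 : ℝ) : ℂ) ≠ 0 := by
          have : ‖z - ρ‖ ^ 2 ≠ 0 := by positivity
          exact_mod_cast this
        rw [Complex.ofReal_div]
        field_simp
        apply mul_left_cancel₀ hz0
        linear_combination h1)
      refine ⟨(X - C ρ) * Q, ?_, fun z hz => ?_⟩
      · refine natDegree_mul_le.trans ?_
        rw [natDegree_X_sub_C]; omega
      · rw [key z hz, hQe z hz, eval_mul, norm_mul, mul_pow]
        simp only [eval_sub, eval_X, eval_C]
        push_cast
        ring

/-- A polynomial of modulus less than one on the unit circle has a complementary polynomial. -/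
theorem exists_complementary {d : ℕ} {P : ℂ[X]} (hP : P.natDegree ≤ d)
    (hlt : ∀ z : ℂ, ‖z‖ = 1 → ‖P.eval z‖ < 1) :
    ∃ Q : ℂ[X], Q.natDegree ≤ d ∧ ∀ z : ℂ, ‖z‖ = 1 → ‖P.eval z‖ ^ 2 + ‖Q.eval z‖ ^ 2 = 1 := by
  have hev : ∀ z : ℂ, ‖z‖ = 1 →
      (X ^ d - P * conjReflect d P).eval z = ((1 - ‖P.eval z‖ ^ 2 : ℝ) : ℂ) * z ^ d := by
    intro z hz
    rw [eval_sub, eval_mul, eval_pow, eval_X, conjReflect_eval_circle hP hz, Complex.ofReal_sub,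
      ← mul_conj_eq_norm_sq]
    push_cast
    ring
  -- On the circle this polynomial is `(1 - |P|²) z ^ d`; the strict bound on `P` makes the weight
  -- positive.
  obtain ⟨Q, hQ, hQe⟩ := exists_spectral_factor d (X ^ d - P * conjReflect d P) (by
      refine (natDegree_sub_le _ _).trans (max_le ?_ ?_)
      · rw [natDegree_X_pow]; omega
      · refine natDegree_mul_le.trans ?_
        have := natDegree_conjReflect_le hP
        omega) (by
      intro z hz
      refine ⟨1 - ‖P.eval z‖ ^ 2, ?_, hev z hz⟩
      have := hlt z hz
      nlinarith [norm_nonneg (P.eval z)])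
  refine ⟨Q, hQ, fun z hz => ?_⟩
  have hz0 : z ≠ 0 := by rintro rfl; simp at hz
  have := mul_right_cancel₀ (pow_ne_zero d hz0) ((hev z hz).symm.trans (hQe z hz))
  have h2 : 1 - ‖P.eval z‖ ^ 2 = ‖Q.eval z‖ ^ 2 := by exact_mod_cast this
  linarith

/-! ### Signal processing with one qubit -/

/-- The state of the signal qubit after a sequence of rotations interleaved with the phase gate
`diag (1, z)`: first `R₀`, then those in the list, whose head is applied last. -/
noncomputable def signalState (z : ℂ) (R₀ : Matrix.unitaryGroup (Fin 2) ℂ) :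
    List (Matrix.unitaryGroup (Fin 2) ℂ) → Fin 2 → ℂ
  | [] => R₀.1.mulVec (Pi.single 0 1)
  | R :: l => R.1.mulVec ![signalState z R₀ l 0, z * signalState z R₀ l 1]

/-- The last condition makes `(α, β)` parallel to `u`; orthogonality of `u` and `v` then yields the
other one. If `u = 0` the last condition is void and a unit vector orthogonal to `v` serves. -/
theorem orthogonal_pair_unit {u₀ u₁ v₀ v₁ : ℂ} (h : u₀ * conj v₀ + u₁ * conj v₁ = 0) :
    ∃ α β : ℂ, ‖α‖ ^ 2 + ‖β‖ ^ 2 = 1 ∧ conj α * v₀ + conj β * v₁ = 0 ∧ -β * u₀ + α * u₁ = 0 := by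
  have hpos : ∀ a b : ℂ, ¬ (a = 0 ∧ b = 0) → 0 < ‖a‖ ^ 2 + ‖b‖ ^ 2 := by
    intro a b hab
    by_cases ha : a = 0
    · have : b ≠ 0 := fun hb => hab ⟨ha, hb⟩
      have := norm_pos_iff.mpr this
      positivity
    · have := norm_pos_iff.mpr ha
      positivity
  have hnorm : ∀ a b : ℂ, ¬ (a = 0 ∧ b = 0) →
      ‖a / (Real.sqrt (‖a‖ ^ 2 + ‖b‖ ^ 2) : ℂ)‖ ^ 2 +
        ‖b / (Real.sqrt (‖a‖ ^ 2 + ‖b‖ ^ 2) : ℂ)‖ ^ 2 = 1 := by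
    intro a b hab
    have := hpos a b hab
    rw [norm_div, norm_div, Complex.norm_real, Real.norm_eq_abs, div_pow, div_pow, sq_abs,
      Real.sq_sqrt this.le, ← add_div, div_self this.ne']
  by_cases hu : u₀ = 0 ∧ u₁ = 0
  · by_cases hv : v₀ = 0 ∧ v₁ = 0
    · refine ⟨1, 0, by simp, by simp [hv.1], by simp [hu.2]⟩
    · have hv' : ¬ (-conj v₁ = 0 ∧ conj v₀ = 0) := by
        rintro ⟨h1, h2⟩; exact hv ⟨by simpa using h2, by simpa using h1⟩
      refine ⟨_, _, hnorm _ _ hv', ?_, by simp [hu.1, hu.2]⟩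
      simp only [map_div₀, map_neg, Complex.conj_conj, Complex.conj_ofReal]
      ring
  · refine ⟨_, _, hnorm _ _ hu, ?_, by ring⟩
    simp only [map_div₀, Complex.conj_ofReal]
    have h' : conj u₀ * v₀ + conj u₁ * v₁ = 0 := by
      have := congrArg conj h
      simpa using this
    rw [div_mul_eq_mul_div, div_mul_eq_mul_div, ← add_div, h', zero_div]

theorem rotation_mem_unitaryGroup {α β : ℂ} (h : ‖α‖ ^ 2 + ‖β‖ ^ 2 = 1) :
    !![α, -conj β; β, conj α] ∈ Matrix.unitaryGroup (Fin 2) ℂ := by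
  have h1 : α * conj α + β * conj β = 1 := by
    rw [mul_conj_eq_norm_sq, mul_conj_eq_norm_sq]; exact_mod_cast h
  rw [Matrix.mem_unitaryGroup_iff]
  ext i j
  fin_cases i <;> fin_cases j <;>
    simp only [Matrix.mul_apply, Fin.sum_univ_two, Matrix.star_apply] <;> simp <;>
    first | linear_combination h1 | ring

/-- Layer stripping: a suitable rotation makes one entry of `(P, Q)` divisible by `X` and lowers the
degree of the other. Undoing one phase `diag (1, z)` leaves a normalized pair of smaller degree. -/
theorem exists_rotations (d : ℕ) : ∀ P Q : ℂ[X], P.natDegree ≤ d → Q.natDegree ≤ d →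
    (∀ z : ℂ, ‖z‖ = 1 → ‖P.eval z‖ ^ 2 + ‖Q.eval z‖ ^ 2 = 1) →
    ∃ (R₀ : Matrix.unitaryGroup (Fin 2) ℂ) (l : List (Matrix.unitaryGroup (Fin 2) ℂ)),
      l.length = d ∧ ∀ z : ℂ, ‖z‖ = 1 → signalState z R₀ l = ![P.eval z, Q.eval z] := by
  induction d with
  | zero =>
    intro P Q hP hQ h
    rw [eq_C_of_natDegree_le_zero hP, eq_C_of_natDegree_le_zero hQ] at *
    have h1 := h 1 (by simp)
    simp only [eval_C] at h1
    refine ⟨⟨_, rotation_mem_unitaryGroup h1⟩, [], rfl, fun z _ => ?_⟩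
    ext i
    fin_cases i <;> simp [signalState]
  | succ d ih =>
    intro P Q hP hQ h
    have hident : P * conjReflect (d + 1) P + Q * conjReflect (d + 1) Q = X ^ (d + 1) := by
      apply eq_of_eval_circle
      intro z hz
      rw [eval_add, eval_mul, eval_mul, conjReflect_eval_circle hP hz,
        conjReflect_eval_circle hQ hz, eval_pow, eval_X]
      have h1 : P.eval z * conj (P.eval z) + Q.eval z * conj (Q.eval z) = 1 := by
        rw [mul_conj_eq_norm_sq, mul_conj_eq_norm_sq]; exact_mod_cast h z hz
      linear_combination z ^ (d + 1) * h1
    -- In degree `2 (d + 1)` the right-hand side vanishes and the left-hand side has only products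
    -- of top coefficients: the vectors of leading and of constant coefficients of `(P, Q)` are
    -- orthogonal.
    have hlead := congrArg (fun p : ℂ[X] => p.coeff ((d + 1) + (d + 1))) hident
    simp only [coeff_add] at hlead
    rw [coeff_mul_add_eq_of_natDegree_le hP (natDegree_conjReflect_le hP),
      coeff_mul_add_eq_of_natDegree_le hQ (natDegree_conjReflect_le hQ),
      conjReflect_coeff _ le_rfl, conjReflect_coeff _ le_rfl, coeff_X_pow, if_neg (by omega),
      Nat.sub_self] at hlead
    obtain ⟨α, β, hαβ, hv, hu⟩ := orthogonal_pair_unit hlead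
    -- This entry has lost its constant term, while `g` below loses its term of degree `d + 1`.
    obtain ⟨f, hf⟩ : X ∣ C (conj α) * P + C (conj β) * Q := by
      rw [X_dvd_iff]; simpa using hv
    set g := C (-β) * P + C α * Q with hg
    have hgdeg : g.natDegree ≤ d := by
      rw [natDegree_le_iff_coeff_eq_zero]
      intro k hk
      rw [hg, coeff_add, coeff_C_mul, coeff_C_mul]
      rcases Nat.lt_or_ge (d + 1) k with h' | h'
      · rw [coeff_eq_zero_of_natDegree_lt (hP.trans_lt h'),
          coeff_eq_zero_of_natDegree_lt (hQ.trans_lt h')]; simp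
      · rw [show k = d + 1 by omega]; exact hu
    have hfdeg : f.natDegree ≤ d := by
      rw [natDegree_le_iff_coeff_eq_zero]
      intro k hk
      rw [← coeff_X_mul, ← hf, coeff_add, coeff_C_mul, coeff_C_mul,
        coeff_eq_zero_of_natDegree_lt (hP.trans_lt (by omega)),
        coeff_eq_zero_of_natDegree_lt (hQ.trans_lt (by omega))]
      simp
    have h1 : α * conj α + β * conj β = 1 := by
      rw [mul_conj_eq_norm_sq, mul_conj_eq_norm_sq]; exact_mod_cast hαβ
    have hfe : ∀ z, z * f.eval z = conj α * P.eval z + conj β * Q.eval z := by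
      intro z
      have := congrArg (eval z) hf
      simpa using this.symm
    have hge : ∀ z, g.eval z = -β * P.eval z + α * Q.eval z := by
      intro z; rw [hg]; simp
    obtain ⟨R₀, l, hl, hseq⟩ := ih g f hgdeg hfdeg (by
      intro z hz
      have h2 : ‖f.eval z‖ = ‖z * f.eval z‖ := by rw [norm_mul, hz, one_mul]
      have h3 := h z hz
      rw [h2, hfe, hge]
      have h4 : P.eval z * conj (P.eval z) + Q.eval z * conj (Q.eval z) = 1 := by
        rw [mul_conj_eq_norm_sq, mul_conj_eq_norm_sq]; exact_mod_cast h3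
      have : ((‖-β * P.eval z + α * Q.eval z‖ ^ 2 +
          ‖conj α * P.eval z + conj β * Q.eval z‖ ^ 2 : ℝ) : ℂ) = 1 := by
        rw [Complex.ofReal_add, ← mul_conj_eq_norm_sq, ← mul_conj_eq_norm_sq]
        simp only [map_add, map_mul, map_neg, Complex.conj_conj]
        linear_combination (P.eval z * conj (P.eval z) + Q.eval z * conj (Q.eval z)) * h1 + h4
      exact_mod_cast this)
    -- The inverse rotation, which takes `(g, z f)` back to `(P, Q)`.
    have hmem : !![-conj β, α; conj α, β] ∈ Matrix.unitaryGroup (Fin 2) ℂ := by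
      rw [Matrix.mem_unitaryGroup_iff]
      ext i j
      fin_cases i <;> fin_cases j <;>
        simp only [Matrix.mul_apply, Fin.sum_univ_two, Matrix.star_apply] <;> simp <;>
        first | linear_combination h1 | ring
    refine ⟨R₀, ⟨_, hmem⟩ :: l, by simp [hl], fun z hz => ?_⟩
    rw [signalState, hseq z hz]
    ext i
    fin_cases i
    · simp [hfe, hge, Matrix.mulVec, dotProduct, Fin.sum_univ_two]
      linear_combination (P.eval z) * h1
    · simp [hfe, hge, Matrix.mulVec, dotProduct, Fin.sum_univ_two]
      linear_combination (Q.eval z) * h1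

end UnitCircle

/-! ### A polynomial filter separating low from high energies -/

section Filter

open Polynomial ComplexConjugate

/-- The normalized geometric sum `(1 + X + ⋯ + X ^ (m - 1)) / m`. -/
noncomputable def geomMean (m : ℕ) : ℂ[X] := C (m : ℂ)⁻¹ * ∑ k ∈ Finset.range m, X ^ k

theorem geomMean_eval (m : ℕ) (z : ℂ) :
    (geomMean m).eval z = (m : ℂ)⁻¹ * ∑ k ∈ Finset.range m, z ^ k := by
  simp [geomMean, eval_finsetSum]

theorem natDegree_geomMean_le (m : ℕ) : (geomMean m).natDegree ≤ m - 1 := by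
  refine (natDegree_C_mul_le _ _).trans (natDegree_sum_le_of_forall_le _ _ fun k hk => ?_)
  rw [natDegree_X_pow]
  have := Finset.mem_range.mp hk
  omega

theorem geomMean_eval_one {m : ℕ} (hm : m ≠ 0) : (geomMean m).eval 1 = 1 := by
  simp [geomMean_eval, hm]

/-- Reversing the sum shows that the mean is `z ^ (m - 1)` times its conjugate, thus a real multiple
of `z ^ ((m - 1) / 2)`. Squaring avoids the half-integral power. -/
theorem geomMean_eval_sq (m : ℕ) {z : ℂ} (hz : ‖z‖ = 1) :
    (geomMean m).eval z ^ 2 = z ^ (m - 1) * ((‖(geomMean m).eval z‖ ^ 2 : ℝ) : ℂ) := by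
  have hzz : z * conj z = 1 := by rw [mul_conj_eq_norm_sq, hz]; simp
  rw [← mul_conj_eq_norm_sq]
  have h : (geomMean m).eval z = z ^ (m - 1) * conj ((geomMean m).eval z) := by
    rw [geomMean_eval, map_mul, map_inv₀, map_natCast, map_sum, mul_left_comm]
    congr 1
    rw [Finset.mul_sum, ← Finset.sum_range_reflect]
    apply Finset.sum_congr rfl
    intro k hk
    have := Finset.mem_range.mp hk
    rw [map_pow]
    have h1 : z ^ (m - 1) = z ^ (m - 1 - k) * z ^ k := by rw [← pow_add]; congr 1; omega
    rw [h1, mul_assoc, ← mul_pow, hzz, one_pow, mul_one]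
  calc (geomMean m).eval z ^ 2
      = (geomMean m).eval z * (geomMean m).eval z := sq _
    _ = (geomMean m).eval z * (z ^ (m - 1) * conj ((geomMean m).eval z)) := by rw [← h]
    _ = _ := by ring

theorem geomMean_eval_pow (m r : ℕ) {z : ℂ} (hz : ‖z‖ = 1) :
    (geomMean m).eval z ^ (2 * r) =
      z ^ (r * (m - 1)) * ((‖(geomMean m).eval z‖ ^ (2 * r) : ℝ) : ℂ) := by
  rw [pow_mul, geomMean_eval_sq m hz, mul_pow, ← pow_mul, mul_comm (m - 1) r, pow_mul ‖_‖ 2 r]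
  push_cast
  rfl

/-- The geometric sum is at most `2 / |z - 1| = 1 / sin (t / 2)`, and Jordan's inequality bounds
this by `π / δ`. The constant `7` exceeds `2 π`. -/
theorem norm_geomMean_le_half {m : ℕ} {δ t : ℝ} (hδ : 0 < δ) (hm : 7 / δ ≤ m) (h1 : δ ≤ t)
    (h2 : t ≤ 2 * Real.pi - δ) : ‖(geomMean m).eval (Complex.exp (Complex.I * t))‖ ≤ 1 / 2 := by
  have hpi := Real.pi_pos
  have hm0 : (0 : ℝ) < m := lt_of_lt_of_le (by positivity) hm
  have hsin : δ / Real.pi ≤ Real.sin (t / 2) := by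
    have key : ∀ x : ℝ, δ / 2 ≤ x → x ≤ Real.pi / 2 → δ / Real.pi ≤ Real.sin x := by
      intro x hx1 hx2
      have := Real.mul_le_sin (x := x) (by linarith) hx2
      refine le_trans ?_ this
      rw [div_le_iff₀ hpi]
      have : 2 / Real.pi * x * Real.pi = 2 * x := by field_simp
      linarith
    rcases le_total (t / 2) (Real.pi / 2) with h | h
    · exact key _ (by linarith) h
    · rw [← Real.sin_pi_sub]
      exact key _ (by linarith) (by linarith)
  have hsin0 : 0 < Real.sin (t / 2) := lt_of_lt_of_le (by positivity) hsin
  set z := Complex.exp (Complex.I * t) with hz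
  have hz1 : ‖z‖ = 1 := by rw [hz, mul_comm]; exact Complex.norm_exp_ofReal_mul_I t
  have hzs : ‖z - 1‖ = 2 * Real.sin (t / 2) := by
    rw [hz, Complex.norm_exp_I_mul_ofReal_sub_one, Real.norm_eq_abs, abs_of_pos (by linarith)]
  have hgeom : ‖∑ k ∈ Finset.range m, z ^ k‖ * ‖z - 1‖ ≤ 2 := by
    rw [← norm_mul, geom_sum_mul]
    refine (norm_sub_le _ _).trans ?_
    rw [norm_pow, hz1]; norm_num
  rw [geomMean_eval, norm_mul, norm_inv, Complex.norm_natCast]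
  rw [hzs] at hgeom
  set A := ‖∑ k ∈ Finset.range m, z ^ k‖ with hA
  have hA0 : 0 ≤ A := norm_nonneg _
  have h3 : A * (2 * (δ / Real.pi)) ≤ 2 :=
    le_trans (by gcongr) hgeom
  have h4 : A * δ ≤ Real.pi := by
    have : A * (2 * (δ / Real.pi)) = 2 * (A * δ) / Real.pi := by ring
    rw [this, div_le_iff₀ hpi] at h3
    linarith
  have h5 : 7 ≤ m * δ := by rwa [div_le_iff₀ hδ] at hm
  rw [inv_mul_le_iff₀ hm0]
  have h6 : A * δ ≤ m * (1 / 2) * δ := by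
    have := Real.pi_lt_d2
    linarith
  exact le_of_mul_le_mul_right h6 hδ

theorem sum_zpow_primitiveRoot {N : ℕ} {ω : ℂ} (hω : IsPrimitiveRoot ω N) {k : ℤ}
    (hk : ¬ (N : ℤ) ∣ k) : ∑ j ∈ Finset.range N, (ω ^ j) ^ k = 0 := by
  have hne : ω ^ k - 1 ≠ 0 := by
    rw [sub_ne_zero]
    intro h
    exact hk ((hω.zpow_eq_one_iff_dvd k).mp h)
  have h1 : ∀ j ∈ Finset.range N, (ω ^ j) ^ k = (ω ^ k) ^ j := by
    intro j _
    rw [← zpow_natCast, ← zpow_natCast, ← zpow_mul, ← zpow_mul, mul_comm]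
  rw [Finset.sum_congr rfl h1]
  apply mul_right_cancel₀ hne
  rw [geom_sum_mul, zero_mul, ← zpow_natCast, ← zpow_mul, mul_comm, zpow_mul, zpow_natCast,
    hω.pow_eq_one, one_zpow, sub_self]

/-- Sampling the kernel `‖geomMean m‖ ^ (2 r)` on a sufficiently fine periodic grid and summing
gives a constant. -/
theorem exists_sum_kernel_eq (m r : ℕ) {N : ℕ} (hN : r * (m - 1) < N) {ω w : ℂ}
    (hω : IsPrimitiveRoot ω N) (hw : ‖w‖ = 1) :
    ∃ c : ℂ, ∀ z : ℂ, ‖z‖ = 1 →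
      ((∑ j ∈ Finset.range N, ‖(geomMean m).eval (z / (w * ω ^ j))‖ ^ (2 * r) : ℝ) : ℂ) = c := by
  set R := r * (m - 1) with hR
  set G := geomMean m ^ (2 * r) with hG
  have hN0 : N ≠ 0 := by omega
  have hω1 : ‖ω‖ = 1 := hω.norm'_eq_one hN0
  have hω0 : ω ≠ 0 := by rintro rfl; simp at hω1
  have hw0 : w ≠ 0 := by rintro rfl; simp at hw
  have hGdeg : G.natDegree ≤ 2 * R := by
    refine natDegree_pow_le.trans ?_
    calc 2 * r * (geomMean m).natDegree ≤ 2 * r * (m - 1) :=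
          Nat.mul_le_mul_left _ (natDegree_geomMean_le m)
      _ = 2 * R := by rw [hR]; ring
  refine ⟨N * G.coeff R, fun z hz => ?_⟩
  have hz0 : z ≠ 0 := by rintro rfl; simp at hz
  -- As a function of the grid point the kernel has only the frequencies `R - k`, of modulus at most
  -- `R < N`. Summation over the `N`-th roots of unity kills all of them except zero.
  have hterm : ∀ j, z ^ R * ((‖(geomMean m).eval (z / (w * ω ^ j))‖ ^ (2 * r) : ℝ) : ℂ) =
      ∑ k ∈ Finset.range (2 * R + 1),
        G.coeff k * z ^ k * w ^ ((R : ℤ) - k) * (ω ^ j) ^ ((R : ℤ) - k) := by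
    intro j
    have hv0 : w * ω ^ j ≠ 0 := mul_ne_zero hw0 (pow_ne_zero _ hω0)
    have hy : ‖z / (w * ω ^ j)‖ = 1 := by rw [norm_div, norm_mul, norm_pow, hz, hw, hω1]; simp
    have h1 : G.eval (z / (w * ω ^ j)) = (z / (w * ω ^ j)) ^ R *
        ((‖(geomMean m).eval (z / (w * ω ^ j))‖ ^ (2 * r) : ℝ) : ℂ) := by
      rw [hG, eval_pow, geomMean_eval_pow m r hy]
    have h2 : z ^ R * ((‖(geomMean m).eval (z / (w * ω ^ j))‖ ^ (2 * r) : ℝ) : ℂ) =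
        (w * ω ^ j) ^ R * G.eval (z / (w * ω ^ j)) := by
      rw [h1, div_pow, ← mul_assoc, mul_div_cancel₀]
      exact pow_ne_zero _ hv0
    rw [h2, eval_eq_sum_range' (Nat.lt_succ_of_le hGdeg), Finset.mul_sum]
    apply Finset.sum_congr rfl
    intro k _
    rw [zpow_sub₀ hw0, zpow_sub₀ (pow_ne_zero j hω0), zpow_natCast, zpow_natCast, zpow_natCast,
      zpow_natCast, div_pow, mul_pow, mul_pow]
    field_simp
  apply mul_left_cancel₀ (pow_ne_zero R hz0)
  rw [Complex.ofReal_sum, Finset.mul_sum, Finset.sum_congr rfl fun j _ => hterm j,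
    Finset.sum_comm, Finset.sum_eq_single R]
  · simp
    ring
  · intro k hk hkR
    rw [← Finset.mul_sum, sum_zpow_primitiveRoot hω, mul_zero]
    have hk' := Finset.mem_range.mp hk
    intro hdvd
    have hne : (R : ℤ) - k ≠ 0 := by omega
    have := Int.le_of_dvd (abs_pos.mpr hne) ((dvd_abs _ _).mpr hdvd)
    have h4 : |(R : ℤ) - k| ≤ R := by rw [abs_le]; omega
    omega
  · intro h
    exact absurd (Finset.mem_range.mpr (by omega)) h

/-- A polynomial of degree `O(m r)` that is large at energies below `μ - δ` and tiny at energies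
above `μ + δ`. -/
theorem exists_energy_filter {μ δ τ : ℝ} (hδ : 0 < δ) (hμ₁ : δ ≤ μ) (hμ₂ : μ ≤ Real.pi - δ)
    (hτ : τ ≤ 1) {m r : ℕ} (hm : 7 / δ ≤ m) (hr : 2 * m ≤ τ * 2 ^ r) :
    ∃ P : ℂ[X], P.natDegree ≤ 2 * (r * m) ∧ (∀ z : ℂ, ‖z‖ = 1 → ‖P.eval z‖ < 1) ∧
      ∀ lam : ℝ, 0 < lam → lam < Real.pi →
        (lam ≤ μ - δ → 1 / 4 ≤ ‖P.eval (Complex.exp (-(Complex.I * lam)))‖) ∧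
        (μ + δ ≤ lam → ‖P.eval (Complex.exp (-(Complex.I * lam)))‖ ≤ τ / 2) := by
  have hpi := Real.pi_pos
  have hm0 : m ≠ 0 := by
    rintro rfl
    have : 0 < 7 / δ := by positivity
    simp at hm
    linarith
  set R := r * (m - 1) with hR
  set N' := R + 1 with hN'
  have hN0 : (0 : ℝ) < N' := by positivity
  set ω := Complex.exp (-(Complex.I * (Real.pi / N' : ℝ))) with hω
  set w := Complex.exp (-(Complex.I * μ)) with hw
  have hω1 : ‖ω‖ = 1 := by
    rw [hω, ← mul_neg, ← Complex.ofReal_neg, mul_comm]; exact Complex.norm_exp_ofReal_mul_I _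
  have hw1 : ‖w‖ = 1 := by
    rw [hw, ← mul_neg, ← Complex.ofReal_neg, mul_comm]; exact Complex.norm_exp_ofReal_mul_I _
  have hω0 : ω ≠ 0 := Complex.exp_ne_zero _
  have hw0 : w ≠ 0 := Complex.exp_ne_zero _
  have hprim : IsPrimitiveRoot ω (2 * N') := by
    have h := (Complex.isPrimitiveRoot_exp (2 * N') (by omega)).inv
    rw [← Complex.exp_neg] at h
    have harg : -(Complex.I * ((Real.pi / N' : ℝ) : ℂ)) =
        -(2 * Real.pi * Complex.I / ((2 * N' : ℕ) : ℂ)) := by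
      push_cast
      have : (N' : ℂ) ≠ 0 := by exact_mod_cast hN0.ne'
      field_simp
    rw [hω, harg]
    exact h
  set K : ℂ → ℝ := fun y => ‖(geomMean m).eval y‖ ^ (2 * r) with hK
  have hK0 : ∀ y, 0 ≤ K y := fun y => by positivity
  obtain ⟨c, hc⟩ := exists_sum_kernel_eq m r (N := 2 * N') (by omega) hprim hw1
  set M : ℝ := ∑ j ∈ Finset.range (2 * N'), K (w / (w * ω ^ j)) with hM
  have hMc : ∀ z : ℂ, ‖z‖ = 1 → ∑ j ∈ Finset.range (2 * N'), K (z / (w * ω ^ j)) = M := by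
    intro z hz
    have := (hc z hz).trans (hc w hw1).symm
    exact_mod_cast this
  have hM1 : 1 ≤ M := by
    have h0 : K (w / (w * ω ^ 0)) = 1 := by
      simp only [hK, pow_zero, mul_one, div_self hw0, geomMean_eval_one hm0, norm_one, one_pow]
    rw [← h0, hM]
    exact Finset.single_le_sum (f := fun j => K (w / (w * ω ^ j))) (fun j _ => hK0 _)
      (Finset.mem_range.mpr (by omega))
  have hM0 : 0 < M := by linarith
  -- Only the kernels centred below `μ` are kept. The powers of order `R` give all terms the common
  -- phase `z ^ R`, so moduli add up. Dividing by `2 * M` instead of `M` secures the strict bound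
  -- `‖P‖ < 1`.
  set P : ℂ[X] := ∑ j ∈ Finset.Ico N' (2 * N'),
    C ((w * ω ^ j) ^ R / (2 * M)) * (geomMean m ^ (2 * r)).comp (C (w * ω ^ j)⁻¹ * X) with hP
  have hPe : ∀ z : ℂ, ‖z‖ = 1 →
      ‖P.eval z‖ = (∑ j ∈ Finset.Ico N' (2 * N'), K (z / (w * ω ^ j))) / (2 * M) := by
    intro z hz
    have h1 : P.eval z = z ^ R *
        (((∑ j ∈ Finset.Ico N' (2 * N'), K (z / (w * ω ^ j))) / (2 * M) : ℝ) : ℂ) := by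
      rw [hP, eval_finsetSum]
      push_cast
      rw [Finset.sum_div, Finset.mul_sum]
      apply Finset.sum_congr rfl
      intro j _
      have hv0 : w * ω ^ j ≠ 0 := mul_ne_zero hw0 (pow_ne_zero _ hω0)
      have hy : ‖z / (w * ω ^ j)‖ = 1 := by
        rw [norm_div, norm_mul, norm_pow, hz, hw1, hω1]; simp
      rw [eval_mul, eval_C, eval_comp, eval_mul, eval_C, eval_X, eval_pow, inv_mul_eq_div,
        geomMean_eval_pow m r hy, ← hR, hK, div_pow]
      have := pow_ne_zero R hv0
      field_simp
    rw [h1, norm_mul, norm_pow, hz, one_pow, one_mul, Complex.norm_real, Real.norm_eq_abs,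
      abs_of_nonneg (div_nonneg (Finset.sum_nonneg fun j _ => hK0 _) (by linarith))]
  have hsplit : ∀ z : ℂ, ‖z‖ = 1 → (∑ j ∈ Finset.range N', K (z / (w * ω ^ j))) +
      ∑ j ∈ Finset.Ico N' (2 * N'), K (z / (w * ω ^ j)) = M := by
    intro z hz
    rw [Finset.sum_range_add_sum_Ico _ (by omega)]
    exact hMc z hz
  -- Each distant kernel is at most `4 ^ (-r)`. One factor `2 ^ (-r)` pays for the `r` in the number
  -- of kernels, the other meets `hr`.
  have htail : (N' : ℝ) * (1 / 2) ^ (2 * r) ≤ τ / 2 := by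
    have h1 : N' ≤ 2 ^ r * m := by
      have h2 : r + 1 ≤ 2 ^ r := Nat.lt_two_pow_self
      have h3 : r * (m - 1) ≤ r * m := Nat.mul_le_mul_left _ (Nat.sub_le _ _)
      have h4 : (r + 1) * m ≤ 2 ^ r * m := Nat.mul_le_mul_right _ h2
      have h5 : 1 ≤ m := Nat.one_le_iff_ne_zero.mpr hm0
      nlinarith
    have h2 : (N' : ℝ) ≤ 2 ^ r * m := by exact_mod_cast h1
    have h3 : (1 / 2 : ℝ) ^ (2 * r) * (2 ^ r * 2 ^ r) = 1 := by
      rw [← pow_add, ← two_mul, ← mul_pow]; norm_num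
    have hp : (0 : ℝ) < 2 ^ r := by positivity
    have h4 : (0 : ℝ) < (1 / 2) ^ (2 * r) := by positivity
    calc (N' : ℝ) * (1 / 2) ^ (2 * r) ≤ 2 ^ r * m * (1 / 2) ^ (2 * r) := by gcongr
      _ = (2 * m) * 2 ^ r * (1 / 2) ^ (2 * r) / 2 := by ring
      _ ≤ (τ * 2 ^ r) * 2 ^ r * (1 / 2) ^ (2 * r) / 2 := by gcongr
      _ = τ * ((1 / 2 : ℝ) ^ (2 * r) * (2 ^ r * 2 ^ r)) / 2 := by ring
      _ = τ / 2 := by rw [h3, mul_one]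
  have harg : ∀ (lam : ℝ) (j : ℕ), Complex.exp (-(Complex.I * lam)) / (w * ω ^ j) =
      Complex.exp (Complex.I * ((Real.pi * j / N' + μ - lam : ℝ) : ℂ)) := by
    intro lam j
    rw [hw, hω, ← Complex.exp_nat_mul, ← Complex.exp_add, ← Complex.exp_sub]
    congr 1
    push_cast
    ring
  have hKsmall : ∀ (lam : ℝ) (j : ℕ), δ ≤ Real.pi * j / N' + μ - lam →
      Real.pi * j / N' + μ - lam ≤ 2 * Real.pi - δ →
      K (Complex.exp (-(Complex.I * lam)) / (w * ω ^ j)) ≤ (1 / 2) ^ (2 * r) := by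
    intro lam j h1 h2
    rw [harg, hK]
    exact pow_le_pow_left₀ (norm_nonneg _) (norm_geomMean_le_half hδ hm h1 h2) _
  have hz1 : ∀ lam : ℝ, ‖Complex.exp (-(Complex.I * lam))‖ = 1 := by
    intro lam
    rw [← mul_neg, ← Complex.ofReal_neg, mul_comm]; exact Complex.norm_exp_ofReal_mul_I _
  refine ⟨P, ?_, ?_, fun lam hl0 hlpi => ⟨fun hlow => ?_, fun hhigh => ?_⟩⟩
  · refine natDegree_sum_le_of_forall_le _ _ fun j _ => (natDegree_C_mul_le _ _).trans ?_
    refine natDegree_comp_le.trans ?_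
    have h1 : (C (w * ω ^ j)⁻¹ * X : ℂ[X]).natDegree ≤ 1 :=
      (natDegree_C_mul_le _ _).trans natDegree_X_le
    have h2 : (geomMean m ^ (2 * r)).natDegree ≤ 2 * r * (m - 1) :=
      natDegree_pow_le.trans (Nat.mul_le_mul_left _ (natDegree_geomMean_le m))
    calc _ ≤ (2 * r * (m - 1)) * 1 := Nat.mul_le_mul h2 h1
      _ ≤ 2 * r * m := by rw [mul_one]; exact Nat.mul_le_mul_left _ (Nat.sub_le _ _)
      _ = _ := by ring
  · intro z hz
    rw [hPe z hz, div_lt_one (by linarith)]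
    have := hsplit z hz
    have h2 : 0 ≤ ∑ j ∈ Finset.range N', K (z / (w * ω ^ j)) := Finset.sum_nonneg fun j _ => hK0 _
    linarith
  -- Here the omitted half is tiny, so `P` retains at least `M - τ / 2 ≥ M / 2`. The range of `μ`
  -- keeps the centres `δ` away also around the far side of the circle.
  · rw [hPe _ (hz1 lam), le_div_iff₀ (by linarith)]
    have h1 := hsplit _ (hz1 lam)
    have h2 : ∑ j ∈ Finset.range N', K (Complex.exp (-(Complex.I * lam)) / (w * ω ^ j)) ≤
        N' * (1 / 2) ^ (2 * r) := by
      have := Finset.sum_le_card_nsmul (Finset.range N')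
        (fun j => K (Complex.exp (-(Complex.I * lam)) / (w * ω ^ j))) ((1 / 2) ^ (2 * r)) (by
          intro j hj
          have hj' : (j : ℝ) ≤ N' := by exact_mod_cast (Finset.mem_range.mp hj).le
          have h3 : Real.pi * j / N' ≤ Real.pi := by
            rw [div_le_iff₀ hN0]; gcongr
          have h4 : 0 ≤ Real.pi * j / N' := by positivity
          exact hKsmall lam j (by linarith) (by linarith))
      simpa using this
    linarith
  · rw [hPe _ (hz1 lam), div_le_iff₀ (by linarith)]
    have h2 : ∑ j ∈ Finset.Ico N' (2 * N'), K (Complex.exp (-(Complex.I * lam)) / (w * ω ^ j)) ≤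
        N' * (1 / 2) ^ (2 * r) := by
      have := Finset.sum_le_card_nsmul (Finset.Ico N' (2 * N'))
        (fun j => K (Complex.exp (-(Complex.I * lam)) / (w * ω ^ j))) ((1 / 2) ^ (2 * r)) (by
          intro j hj
          obtain ⟨hj1, hj2⟩ := Finset.mem_Ico.mp hj
          have hj1' : (N' : ℝ) ≤ j := by exact_mod_cast hj1
          have hj2' : (j : ℝ) ≤ 2 * N' := by exact_mod_cast hj2.le
          have h3 : Real.pi * j / N' ≤ 2 * Real.pi := by
            rw [div_le_iff₀ hN0]
            calc Real.pi * j ≤ Real.pi * (2 * N') := by gcongr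
              _ = _ := by ring
          have h4 : Real.pi ≤ Real.pi * j / N' := by
            rw [le_div_iff₀ hN0]; gcongr
          exact hKsmall lam j (by linarith) (by linarith))
      have hcard : (Finset.Ico N' (2 * N')).card = N' := by rw [Nat.card_Ico]; omega
      rw [hcard] at this
      simpa using this
    have hτ0 : 0 ≤ τ / 2 := le_trans (by positivity) htail
    nlinarith

end Filter

/-! ### Multi-controlled gates with borrowed qubits -/

section Device

variable {n a : ℕ}

/-- The action of a circuit on an arbitrary state. -/
noncomputable def QCircuit.act (U UI : SysMatrix n) (c : QCircuit n a) (ψ : DevState n a) :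
    DevState n a :=
  c.foldl (fun ψ g => g.apply U UI ψ) ψ

theorem QCircuit.act_append (U UI : SysMatrix n) (c d : QCircuit n a) (ψ : DevState n a) :
    QCircuit.act U UI (c ++ d) ψ = QCircuit.act U UI d (QCircuit.act U UI c ψ) :=
  List.foldl_append

/-- The matrix `a ↦ φ a · δ (σ a)` of a phased permutation. -/
def phasedPerm {ι : Type} [DecidableEq ι] (σ : Equiv.Perm ι) (φ : ι → ℂ) : Matrix ι ι ℂ :=
  fun x y => if y = σ x then φ x else 0

theorem phasedPerm_mem {ι : Type} [DecidableEq ι] [Fintype ι] (σ : Equiv.Perm ι) {φ : ι → ℂ}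
    (hφ : ∀ x, φ x * star (φ x) = 1) : phasedPerm σ φ ∈ Matrix.unitaryGroup ι ℂ := by
  rw [Matrix.mem_unitaryGroup_iff]
  ext x y
  rw [Matrix.mul_apply]
  simp only [phasedPerm, Matrix.star_apply, ite_mul, zero_mul, Finset.sum_ite_eq',
    Finset.mem_univ, if_true]
  by_cases h : x = y
  · subst h; simpa using hφ x
  · have : σ x ≠ σ y := fun h' => h (σ.injective h')
    simp [this, h]

theorem phasedPerm_sum {ι : Type} [DecidableEq ι] [Fintype ι] (σ : Equiv.Perm ι) (φ : ι → ℂ)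
    (x : ι) (f : ι → ℂ) : ∑ y, phasedPerm σ φ x y * f y = φ x * f (σ x) := by
  simp only [phasedPerm, ite_mul, zero_mul, Finset.sum_ite_eq', Finset.mem_univ, if_true]

/-- The Hadamard gate. -/
noncomputable def hadamardMatrix : Matrix (Fin 2) (Fin 2) ℂ :=
  fun x y => (if x = 1 ∧ y = 1 then -1 else 1) * ((Real.sqrt 2)⁻¹ : ℝ)

theorem inv_sqrt_two_mul_self : (((Real.sqrt 2)⁻¹ : ℝ) : ℂ) * (((Real.sqrt 2)⁻¹ : ℝ) : ℂ) = 1 / 2 := by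
  rw [← Complex.ofReal_mul, ← mul_inv, Real.mul_self_sqrt (by norm_num)]
  norm_num

theorem hadamard_mem : hadamardMatrix ∈ Matrix.unitaryGroup (Fin 2) ℂ := by
  have h := inv_sqrt_two_mul_self
  rw [Matrix.mem_unitaryGroup_iff]
  ext x y
  rw [Matrix.mul_apply, Fin.sum_univ_two]
  simp only [hadamardMatrix, Matrix.star_apply, star_mul', Complex.star_def, Complex.conj_ofReal]
  fin_cases x <;> fin_cases y <;> simp [-Complex.ofReal_inv] <;>
    linear_combination 2 * h

/-- Flip a qubit. -/
def flipGate (q : Wire n a) : QOp n a :=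
  .oneQubit q ⟨phasedPerm (Equiv.addRight 1) (fun _ => 1), phasedPerm_mem _ (by simp)⟩

/-- Flip the qubit `r` if the qubit `q` is zero. -/
def zeroCNOT (q r : Wire n a) (h : q ≠ r) : QOp n a :=
  .twoQubit q r h ⟨phasedPerm (Equiv.prodShear (Equiv.refl _)
    fun x => Equiv.addRight (if x = 0 then 1 else 0)) (fun _ => 1), phasedPerm_mem _ (by simp)⟩

/-- The phase `ζ` on two qubits if they have the given values. -/
noncomputable def phaseGate (q r : Wire n a) (h : q ≠ r) (v : Fin 2 × Fin 2) (ζ : ℂ)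
    (hζ : ζ * star ζ = 1) : QOp n a :=
  .twoQubit q r h ⟨phasedPerm (Equiv.refl _) (fun x => if x = v then ζ else 1),
    phasedPerm_mem _ (by intro x; split_ifs; exacts [hζ, by simp])⟩

variable (U UI : SysMatrix n)

theorem flipGate_apply (q : Wire n a) (ψ : DevState n a) (z : DevBasis n a) :
    (flipGate q).apply U UI ψ z = ψ (Function.update z q (z q + 1)) := by
  simp only [flipGate, QOp.apply, phasedPerm_sum, Equiv.coe_addRight, one_mul]

theorem zeroCNOT_apply {q r : Wire n a} (h : q ≠ r) (ψ : DevState n a) (z : DevBasis n a) :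
    (zeroCNOT q r h).apply U UI ψ z =
      ψ (Function.update z r (z r + if z q = 0 then 1 else 0)) := by
  simp [zeroCNOT, QOp.apply, phasedPerm_sum, Equiv.prodShear]

theorem phaseGate_apply {q r : Wire n a} (h : q ≠ r) (v : Fin 2 × Fin 2) (ζ : ℂ)
    (hζ : ζ * star ζ = 1) (ψ : DevState n a) (z : DevBasis n a) :
    (phaseGate q r h v ζ hζ).apply U UI ψ z = (if (z q, z r) = v then ζ else 1) * ψ z := by
  simp only [phaseGate, QOp.apply, phasedPerm_sum, Equiv.refl_apply, Function.update_eq_self]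

theorem I_mul_star_I : Complex.I * star Complex.I = 1 := by simp

theorem neg_I_mul_star_neg_I : -Complex.I * star (-Complex.I) = 1 := by simp

/-- The sign `-1` if `c` is zero and `d`, `e` are one. -/
noncomputable def doublyControlledSign (c d e : Wire n a) (hcd : c ≠ d) (hce : c ≠ e)
    (hde : d ≠ e) : QCircuit n a :=
  [phaseGate d e hde (1, 1) Complex.I I_mul_star_I, zeroCNOT c d hcd,
    phaseGate d e hde (1, 1) (-Complex.I) neg_I_mul_star_neg_I, zeroCNOT c d hcd,
    phaseGate c e hce (0, 1) Complex.I I_mul_star_I]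

/-- If `c` is one, the phases `i` and `-i` cancel. If `c` is zero, the toggles move `-i` to `d = 0`;
with `e = 1` the last `i` turns the phases for `d = 1` and `d = 0` into `-1` and `1`. -/
theorem doublyControlledSign_act {c d e : Wire n a} (hcd : c ≠ d) (hce : c ≠ e) (hde : d ≠ e)
    (ψ : DevState n a) (z : DevBasis n a) :
    QCircuit.act U UI (doublyControlledSign c d e hcd hce hde) ψ z =
      (if z c = 0 ∧ z d = 1 ∧ z e = 1 then -1 else 1) * ψ z := by
  have h2 : ∀ x y : Fin 2, x + y + y = x := by decide
  have h3 : ∀ x : Fin 2, x = 0 ∨ x = 1 := by decide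
  simp only [QCircuit.act, doublyControlledSign, List.foldl_cons, List.foldl_nil, phaseGate_apply,
    zeroCNOT_apply, Prod.mk.injEq, Function.update_self, Function.update_of_ne hcd,
    Function.update_of_ne hde.symm, Function.update_idem, h2, Function.update_eq_self]
  rcases h3 (z c) with hc | hc <;> rcases h3 (z d) with hd | hd <;> rcases h3 (z e) with he | he <;>
    simp [hc, hd, he, ← mul_assoc]

theorem doublyControlledSign_countP {c d e : Wire n a} (hcd : c ≠ d) (hce : c ≠ e) (hde : d ≠ e) :
    (doublyControlledSign c d e hcd hce hde).countP QOp.isGate = 5 ∧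
    (doublyControlledSign c d e hcd hce hde).countP QOp.isQueryU = 0 ∧
    (doublyControlledSign c d e hcd hce hde).countP QOp.isQueryUI = 0 := by
  refine ⟨rfl, rfl, rfl⟩

/-- Flip `e` if `c` is zero and `d` is one. -/
noncomputable def toffoli (c d e : Wire n a) (hcd : c ≠ d) (hce : c ≠ e) (hde : d ≠ e) :
    QCircuit n a :=
  [.oneQubit e ⟨_, hadamard_mem⟩] ++ doublyControlledSign c d e hcd hce hde ++
    [.oneQubit e ⟨_, hadamard_mem⟩]

/-- Conjugation by a Hadamard gate on `e` turns the controlled sign into a controlled flip. -/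
theorem toffoli_act {c d e : Wire n a} (hcd : c ≠ d) (hce : c ≠ e) (hde : d ≠ e)
    (ψ : DevState n a) (z : DevBasis n a) :
    QCircuit.act U UI (toffoli c d e hcd hce hde) ψ z =
      ψ (Function.update z e (z e + if z c = 0 ∧ z d = 1 then 1 else 0)) := by
  have h := inv_sqrt_two_mul_self
  have h3 : ∀ x : Fin 2, x = 0 ∨ x = 1 := by decide
  have hh : ∀ (ψ : DevState n a), QCircuit.act U UI [.oneQubit e ⟨_, hadamard_mem⟩] ψ =
      fun z => ∑ b : Fin 2, hadamardMatrix (z e) b * ψ (Function.update z e b) := fun _ => rfl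
  rw [toffoli, QCircuit.act_append, QCircuit.act_append, hh]
  simp only [doublyControlledSign_act, hh, Fin.sum_univ_two, Function.update_self,
    Function.update_of_ne hce, Function.update_of_ne hde, Function.update_idem]
  have h01 : ((0 : Fin 2) = 1) = False := by simp
  simp only [h01, and_false, and_true, if_false]
  split_ifs <;> rcases h3 (z e) with he | he <;> simp [he, hadamardMatrix, -Complex.ofReal_inv]
  · linear_combination (2 * ψ (Function.update z e 1)) * h
  · linear_combination (2 * ψ (Function.update z e 0)) * h
  · linear_combination (2 * ψ (Function.update z e 0)) * h
  · linear_combination (2 * ψ (Function.update z e 1)) * h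

theorem toffoli_countP {c d e : Wire n a} (hcd : c ≠ d) (hce : c ≠ e) (hde : d ≠ e) :
    (toffoli c d e hcd hce hde).countP QOp.isGate = 7 ∧
    (toffoli c d e hcd hce hde).countP QOp.isQueryU = 0 ∧
    (toffoli c d e hcd hce hde).countP QOp.isQueryUI = 0 := by
  refine ⟨rfl, rfl, rfl⟩

/-- One if all the given wires are zero, and zero otherwise. -/
def allZero (cs : List (Wire n a)) (z : DevBasis n a) : Fin 2 := if ∀ c ∈ cs, z c = 0 then 1 else 0

theorem allZero_cons (c : Wire n a) (cs : List (Wire n a)) (z : DevBasis n a) :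
    allZero (c :: cs) z = if z c = 0 then allZero cs z else 0 := by
  by_cases h : z c = 0
  · rw [allZero, allZero, if_pos h]
    exact if_congr (by simp [h]) rfl rfl
  · simp [allZero, h]

theorem allZero_congr {cs : List (Wire n a)} {z y : DevBasis n a} (h : ∀ c ∈ cs, z c = y c) :
    allZero cs z = allZero cs y := by
  have : (∀ c ∈ cs, z c = 0) ↔ ∀ c ∈ cs, y c = 0 := by
    constructor <;> intro h' c hc
    · rw [← h c hc]; exact h' c hc
    · rw [h c hc]; exact h' c hc
  simp only [allZero, this]

/-- The bit `allZero` of each tail of the list of controls, on the corresponding wire. -/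
def suffixBits : List (Wire n a) → List (Wire n a) → DevBasis n a → DevBasis n a
  | c :: cs, d :: ds, z => Function.update (suffixBits cs ds z) d (allZero (c :: cs) z)
  | [], d :: _, _ => Function.update 0 d 1
  | _, [], _ => 0

theorem suffixBits_congr : ∀ (cs ds : List (Wire n a)) {z y : DevBasis n a},
    (∀ c ∈ cs, z c = y c) → suffixBits cs ds z = suffixBits cs ds y
  | c :: cs, d :: ds, z, y, h => by
    rw [suffixBits, suffixBits, allZero_congr h,
      suffixBits_congr cs ds fun c hc => h c (List.mem_cons_of_mem _ hc)]
  | [], d :: _, _, _, _ => rfl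
  | [], [], _, _, _ => rfl
  | _ :: _, [], _, _, _ => rfl

theorem suffixBits_of_notMem : ∀ (cs ds : List (Wire n a)) (z : DevBasis n a) (w : Wire n a),
    w ∉ ds → suffixBits cs ds z w = 0
  | c :: cs, d :: ds, z, w, h => by
    rw [List.mem_cons, not_or] at h
    rw [suffixBits, Function.update_of_ne h.1]
    exact suffixBits_of_notMem cs ds z w h.2
  | [], d :: _, _, w, h => by
    rw [List.mem_cons, not_or] at h
    rw [suffixBits, Function.update_of_ne h.1]; rfl
  | [], [], _, _, _ => rfl
  | _ :: _, [], _, _, _ => rfl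

theorem suffixBits_head : ∀ (cs : List (Wire n a)) (d : Wire n a) (ds : List (Wire n a))
    (z : DevBasis n a), suffixBits cs (d :: ds) z d = allZero cs z
  | c :: cs, d, ds, z => by rw [suffixBits, Function.update_self]
  | [], d, _, z => by simp [suffixBits, allZero]

open Classical in
/-- Adds to each wire of the second list the bit `allZero` of the corresponding tail of the first
list. The wires of the second list are borrowed. -/
noncomputable def ladder : List (Wire n a) → List (Wire n a) → QCircuit n a
  | c :: cs, d :: d' :: ds =>
    if h : c ≠ d' ∧ c ≠ d ∧ d' ≠ d then
      toffoli c d' d h.1 h.2.1 h.2.2 ++ ladder cs (d' :: ds) ++ toffoli c d' d h.1 h.2.1 h.2.2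
    else []
  | [], d :: _ => [flipGate d]
  | _, _ => []

/-- The content of `d'` is unknown. The two Toffoli gates add it to `d` once before and once after
the inner ladder has changed it, so over `Fin 2` only the change survives, namely the bit of the
shorter tail. -/
theorem ladder_act : ∀ (cs ds : List (Wire n a)), ds.length = cs.length + 1 → (cs ++ ds).Nodup →
    ∀ (ψ : DevState n a) (z : DevBasis n a),
      QCircuit.act U UI (ladder cs ds) ψ z = ψ (z + suffixBits cs ds z)
  | c :: cs, d :: d' :: ds, hl, hnd, ψ, z => by
    simp only [List.cons_append, List.nodup_cons, List.nodup_append, List.mem_append,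
      List.mem_cons, not_or] at hnd
    obtain ⟨⟨hcc, hcd, hcd', hcds⟩, hcs, ⟨⟨hdd', hdds⟩, ⟨hd'ds, hds⟩⟩, hdisj⟩ := hnd
    have h : c ≠ d' ∧ c ≠ d ∧ d' ≠ d := ⟨hcd', hcd, Ne.symm hdd'⟩
    have hdcs : d ∉ cs := fun h' => hdisj d h' d (Or.inl rfl) rfl
    have ih := ladder_act cs (d' :: ds) (by simpa using hl) (by
      rw [List.nodup_append]
      refine ⟨hcs, List.nodup_cons.mpr ⟨hd'ds, hds⟩, fun x hx y hy => ?_⟩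
      exact hdisj x hx y (Or.inr (List.mem_cons.mp hy)))
    rw [ladder, dif_pos h, QCircuit.act_append, QCircuit.act_append, toffoli_act, ih, toffoli_act]
    congr 1
    have hcongr : ∀ v, suffixBits cs (d' :: ds) (Function.update z d v) =
        suffixBits cs (d' :: ds) z := fun v => suffixBits_congr _ _ fun x hx => by
      rw [Function.update_of_ne]; rintro rfl; exact hdcs hx
    have hd0 : suffixBits cs (d' :: ds) z d = 0 := suffixBits_of_notMem _ _ _ _ (by
      rw [List.mem_cons, not_or]; exact ⟨hdd', hdds⟩)
    have hc0 : suffixBits cs (d' :: ds) z c = 0 := suffixBits_of_notMem _ _ _ _ (by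
      rw [List.mem_cons, not_or]; exact ⟨hcd', hcds⟩)
    rw [hcongr, suffixBits, allZero_cons]
    ext1 w
    by_cases hw : w = d
    · subst hw
      simp only [Function.update_self, Pi.add_apply, hd0, Function.update_of_ne h.2.1,
        Function.update_of_ne h.2.2, suffixBits_head, hc0]
      generalize z w = x
      generalize z d' = y
      generalize z c = u
      generalize allZero cs z = v
      revert x y u v
      decide
    · simp [hw]
  | [], [d], hl, hnd, ψ, z => by
    have : QCircuit.act U UI (ladder [] [d]) ψ z = (flipGate d).apply U UI ψ z := rfl
    rw [this, flipGate_apply]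
    congr 1
    ext1 w
    by_cases hw : w = d
    · subst hw; simp [suffixBits]
    · simp [suffixBits, hw]
  | [], [], hl, _, _, _ => by simp at hl
  | [], _ :: _ :: _, hl, _, _, _ => by simp at hl
  | _ :: _, [], hl, _, _, _ => by simp at hl
  | _ :: _, [_], hl, _, _, _ => by simp at hl

/-- Adds `allZero cs` to the head of `ds`; the other wires of `ds` are borrowed. -/
noncomputable def multiToggle : List (Wire n a) → List (Wire n a) → QCircuit n a
  | c :: cs, d :: ds => ladder (c :: cs) (d :: ds) ++ ladder cs ds
  | cs, ds => ladder cs ds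

/-- The long ladder also disturbs the borrowed wires, by exactly what the ladder on the tails adds;
running the latter as well restores them. -/
theorem multiToggle_act (cs : List (Wire n a)) (d : Wire n a) (ds : List (Wire n a))
    (hl : ds.length = cs.length) (hnd : (cs ++ d :: ds).Nodup) (ψ : DevState n a)
    (z : DevBasis n a) : QCircuit.act U UI (multiToggle cs (d :: ds)) ψ z =
      ψ (Function.update z d (z d + allZero cs z)) := by
  match cs, ds with
  | [], ds =>
    have : ds = [] := by simpa using hl
    subst this
    rw [multiToggle, ladder_act U UI _ _ (by simp) hnd]
    · congr 1
      ext1 w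
      by_cases hw : w = d
      · subst hw; simp [suffixBits, allZero]
      · simp [suffixBits, hw]
    · simp
  | c :: cs, [] => simp at hl
  | c :: cs, d' :: ds =>
    have hnd' := hnd
    simp only [List.cons_append, List.nodup_cons, List.nodup_append, List.mem_append,
      List.mem_cons, not_or] at hnd
    obtain ⟨⟨hcc, hcd, hcd', hcds⟩, hcs, ⟨⟨hdd', hdds⟩, ⟨hd'ds, hds⟩⟩, hdisj⟩ := hnd
    rw [multiToggle, QCircuit.act_append, ladder_act U UI cs (d' :: ds) (by simpa using hl) (by
      rw [List.nodup_append]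
      refine ⟨hcs, List.nodup_cons.mpr ⟨hd'ds, hds⟩, fun x hx y hy => ?_⟩
      exact hdisj x hx y (Or.inr (List.mem_cons.mp hy))),
      ladder_act U UI (c :: cs) (d :: d' :: ds) (by simpa using hl) hnd']
    congr 1
    have hcongr : suffixBits (c :: cs) (d :: d' :: ds) (z + suffixBits cs (d' :: ds) z) =
        suffixBits (c :: cs) (d :: d' :: ds) z := suffixBits_congr _ _ fun x hx => by
      rw [Pi.add_apply, suffixBits_of_notMem, add_zero]
      rw [List.mem_cons, not_or]
      rcases List.mem_cons.mp hx with rfl | hx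
      · exact ⟨hcd', hcds⟩
      · exact ⟨fun h => hdisj x hx d' (Or.inr (Or.inl rfl)) h,
          fun h => hdisj x hx x (Or.inr (Or.inr h)) rfl⟩
    have hd0 : suffixBits cs (d' :: ds) z d = 0 := suffixBits_of_notMem _ _ _ _ (by
      rw [List.mem_cons, not_or]; exact ⟨hdd', hdds⟩)
    rw [hcongr]
    ext1 w
    by_cases hw : w = d
    · subst hw
      simp [hd0, suffixBits_head]
    · have h2 : ∀ x y : Fin 2, x + y + y = x := by decide
      simp [suffixBits, Function.update_of_ne hw, h2]

theorem ladder_countP : ∀ (cs ds : List (Wire n a)),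
    (ladder cs ds).countP QOp.isGate ≤ 14 * cs.length + 1 ∧
    (ladder cs ds).countP QOp.isQueryU = 0 ∧ (ladder cs ds).countP QOp.isQueryUI = 0
  | c :: cs, d :: d' :: ds => by
    rw [ladder]
    split_ifs with h
    · obtain ⟨h1, h2, h3⟩ := ladder_countP cs (d' :: ds)
      obtain ⟨t1, t2, t3⟩ := toffoli_countP h.1 h.2.1 h.2.2
      simp only [List.countP_append, t1, t2, t3, h2, h3, List.length_cons]
      refine ⟨by omega, trivial, trivial⟩
    · simp
  | [], d :: ds => by
    have : ladder [] (d :: ds) = [flipGate d] := by cases ds <;> rfl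
    rw [this]
    refine ⟨by simp [List.countP_cons, flipGate, QOp.isGate], rfl, rfl⟩
  | [], [] => ⟨by simp [ladder], rfl, rfl⟩
  | _ :: _, [] => ⟨by simp [ladder], rfl, rfl⟩
  | _ :: _, [_] => ⟨by simp [ladder], rfl, rfl⟩

theorem multiToggle_countP (cs ds : List (Wire n a)) :
    (multiToggle cs ds).countP QOp.isGate ≤ 28 * cs.length + 2 ∧
    (multiToggle cs ds).countP QOp.isQueryU = 0 ∧ (multiToggle cs ds).countP QOp.isQueryUI = 0 := by
  match cs, ds with
  | c :: cs, d :: ds =>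
    obtain ⟨h1, h2, h3⟩ := ladder_countP cs ds
    obtain ⟨k1, k2, k3⟩ := ladder_countP (c :: cs) (d :: ds)
    rw [multiToggle]
    simp only [List.countP_append, h2, h3, k2, k3]
    simp only [List.length_cons] at *
    refine ⟨by omega, trivial, trivial⟩
  | [], ds =>
    obtain ⟨h1, h2, h3⟩ := ladder_countP [] ds
    rw [multiToggle]
    · exact ⟨by omega, h2, h3⟩
    · simp
  | c :: cs, [] =>
    obtain ⟨h1, h2, h3⟩ := ladder_countP (c :: cs) []
    rw [multiToggle]
    · exact ⟨by omega, h2, h3⟩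
    · simp

end Device

/-! ### The logical register: the system qubits and one signal qubit -/

section Logical

open Matrix Kronecker

variable {n : ℕ}

/-- Labels of the basis states of the system register together with the signal qubit. -/
abbrev LogBasis (n : ℕ) : Type := SysBasis n × Fin 2

/-- The basis state of the device in which the two work qubits are zero. -/
def logLabel (i : LogBasis n) : DevBasis n 3 := Sum.elim i.1 ![i.2, 0, 0]

/-- The state of the device in which the two work qubits are zero. -/
def logEmbed (ψ : LogBasis n → ℂ) : DevState n 3 := fun z =>
  if z (Sum.inr 1) = 0 ∧ z (Sum.inr 2) = 0 then ψ (fun i => z (Sum.inl i), z (Sum.inr 0)) else 0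

theorem logLabel_injective : Function.Injective (logLabel (n := n)) := by
  rintro ⟨x, b⟩ ⟨y, c⟩ h
  have h1 : x = y := funext fun i => congrFun h (Sum.inl i)
  have h2 : b = c := congrFun h (Sum.inr 0)
  rw [h1, h2]

theorem logEmbed_logLabel (ψ : LogBasis n → ℂ) (i : LogBasis n) :
    logEmbed ψ (logLabel i) = ψ i := by
  simp [logEmbed, logLabel]

theorem logEmbed_eq_zero (ψ : LogBasis n → ℂ) {z : DevBasis n 3} (h : z ∉ Set.range logLabel) :
    logEmbed ψ z = 0 := by
  rw [logEmbed, if_neg]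
  rintro ⟨h1, h2⟩
  apply h
  refine ⟨(fun i => z (Sum.inl i), z (Sum.inr 0)), ?_⟩
  ext w
  rcases w with i | j
  · rfl
  · fin_cases j <;> simp [logLabel, h1, h2]

theorem logEmbed_single :
    logEmbed (n := n) (Pi.single (fun _ => 0, 0) 1) = Pi.single (fun _ => 0) 1 := by
  ext z
  by_cases h : z ∈ Set.range (logLabel (n := n))
  · obtain ⟨i, rfl⟩ := h
    rw [logEmbed_logLabel]
    have h0 : (fun _ => 0) = logLabel (n := n) (fun _ => 0, 0) := by
      ext w
      rcases w with i | j
      · rfl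
      · fin_cases j <;> rfl
    rw [h0]
    by_cases hi : i = (fun _ => 0, 0)
    · subst hi; simp
    · rw [Pi.single_eq_of_ne hi, Pi.single_eq_of_ne]
      exact fun h => hi (logLabel_injective h)
  · rw [logEmbed_eq_zero _ h, Pi.single_eq_of_ne]
    rintro rfl
    apply h
    refine ⟨(fun _ => 0, 0), ?_⟩
    ext w
    rcases w with i | j
    · rfl
    · fin_cases j <;> rfl

theorem sum_logEmbed (ψ : LogBasis n → ℂ) (F : DevBasis n 3 → ℝ) :
    ∑ z, ‖logEmbed ψ z‖ ^ 2 * F z = ∑ i, ‖ψ i‖ ^ 2 * F (logLabel i) := by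
  symm
  apply Fintype.sum_of_injective logLabel logLabel_injective
  · intro z hz
    rw [logEmbed_eq_zero _ hz]; simp
  · intro i
    rw [logEmbed_logLabel]

/-- The circuit acts on the logical register as the given unitary. -/
def Implements (U UI : SysMatrix n) (c : QCircuit n 3) (A : unitaryGroup (LogBasis n) ℂ) : Prop :=
  ∀ ψ, QCircuit.act U UI c (logEmbed ψ) = logEmbed (A.1 *ᵥ ψ)

theorem Implements.append {U UI : SysMatrix n} {c d : QCircuit n 3}
    {A B : unitaryGroup (LogBasis n) ℂ} (hc : Implements U UI c A) (hd : Implements U UI d B) :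
    Implements U UI (c ++ d) (B * A) := by
  intro ψ
  rw [QCircuit.act_append, hc, hd, mulVec_mulVec]
  rfl

theorem Implements.run {U UI : SysMatrix n} {c : QCircuit n 3}
    {A : unitaryGroup (LogBasis n) ℂ} (hc : Implements U UI c A) :
    c.run U UI = logEmbed (A.1 *ᵥ Pi.single (fun _ => 0, 0) 1) := by
  rw [← hc, logEmbed_single]
  rfl

/-- A unitary on the signal qubit. -/
def signalGate (G : unitaryGroup (Fin 2) ℂ) : unitaryGroup (LogBasis n) ℂ :=
  ⟨(1 : SysMatrix n) ⊗ₖ G.1, kronecker_mem_unitary (one_mem _) G.2⟩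

theorem signalGate_mulVec (G : unitaryGroup (Fin 2) ℂ) (ψ : LogBasis n → ℂ) (x : SysBasis n)
    (b : Fin 2) : ((signalGate G).1 *ᵥ ψ) (x, b) = ∑ b', G.1 b b' * ψ (x, b') := by
  simp only [signalGate, mulVec, dotProduct, Fintype.sum_prod_type, kroneckerMap_apply, one_apply]
  rw [Finset.sum_eq_single x]
  · simp
  · intro y _ hy
    simp [Ne.symm hy]
  · simp

theorem signalGate_inv (G : unitaryGroup (Fin 2) ℂ) :
    signalGate (n := n) G⁻¹ = (signalGate G)⁻¹ := by
  rw [eq_inv_iff_mul_eq_one]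
  apply Subtype.ext
  change ((1 : SysMatrix n) ⊗ₖ (G⁻¹).1) * ((1 : SysMatrix n) ⊗ₖ G.1) = 1
  rw [← mul_kronecker_mul, one_mul]
  have : (G⁻¹).1 * G.1 = 1 := by
    rw [← Submonoid.coe_mul, inv_mul_cancel, Submonoid.coe_one]
  rw [this, one_kronecker_one]

theorem implements_signalGate (U UI : SysMatrix n) (G : unitaryGroup (Fin 2) ℂ) :
    Implements U UI [.oneQubit (Sum.inr 0) G] (signalGate G) := by
  intro ψ
  ext z
  simp only [QCircuit.act, List.foldl_cons, List.foldl_nil, QOp.apply, logEmbed,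
    signalGate_mulVec]
  simp

theorem blockDiagonal_mem (V : Fin 2 → SysMatrix n)
    (hV : ∀ b, V b ∈ unitaryGroup (SysBasis n) ℂ) :
    blockDiagonal V ∈ unitaryGroup (LogBasis n) ℂ := by
  rw [mem_unitaryGroup_iff, star_eq_conjTranspose, blockDiagonal_conjTranspose,
    ← blockDiagonal_mul]
  have : (fun k => V k * (V k)ᴴ) = 1 := by
    ext1 k
    exact mem_unitaryGroup_iff.mp (hV k)
  rw [this, blockDiagonal_one]

theorem blockDiagonal_mulVec (V : Fin 2 → SysMatrix n) (ψ : LogBasis n → ℂ) (x : SysBasis n)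
    (b : Fin 2) : (blockDiagonal V *ᵥ ψ) (x, b) = ∑ y, V b x y * ψ (y, b) := by
  simp only [mulVec, dotProduct, Fintype.sum_prod_type, blockDiagonal_apply]
  refine Finset.sum_congr rfl fun y _ => ?_
  simp

/-- A unitary on the system register. -/
def systemGate (V : unitaryGroup (SysBasis n) ℂ) : unitaryGroup (LogBasis n) ℂ :=
  ⟨blockDiagonal fun _ => V.1, blockDiagonal_mem _ fun _ => V.2⟩

/-- A unitary on the system register, controlled by the signal qubit. -/
def controlledGate (V : unitaryGroup (SysBasis n) ℂ) : unitaryGroup (LogBasis n) ℂ :=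
  ⟨blockDiagonal fun b => if b = 1 then V.1 else 1, blockDiagonal_mem _ fun b => by
    split_ifs
    exacts [V.2, one_mem _]⟩

theorem unitary_inv_val {ι : Type} [Fintype ι] [DecidableEq ι] (V : unitaryGroup ι ℂ) :
    (V⁻¹).1 = V.1ᴴ := rfl

theorem systemGate_inv (V : unitaryGroup (SysBasis n) ℂ) : systemGate V⁻¹ = (systemGate V)⁻¹ := by
  apply Subtype.ext
  rw [unitary_inv_val]
  simp only [systemGate, unitary_inv_val, blockDiagonal_conjTranspose]

theorem controlledGate_inv (V : unitaryGroup (SysBasis n) ℂ) :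
    controlledGate V⁻¹ = (controlledGate V)⁻¹ := by
  apply Subtype.ext
  rw [unitary_inv_val]
  simp only [controlledGate, unitary_inv_val, blockDiagonal_conjTranspose]
  congr 1
  ext1 b
  split_ifs <;> simp

theorem applySys_logEmbed (V : SysMatrix n) (ψ : LogBasis n → ℂ) (z : DevBasis n 3) :
    QOp.applySys V (logEmbed ψ) z = if z (Sum.inr 1) = 0 ∧ z (Sum.inr 2) = 0 then
      ∑ y, V (fun i => z (Sum.inl i)) y * ψ (y, z (Sum.inr 0)) else 0 := by
  have h1 : ∀ x : SysBasis n, logEmbed ψ (Sum.elim x fun j => z (Sum.inr j)) =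
      if z (Sum.inr 1) = 0 ∧ z (Sum.inr 2) = 0 then ψ (x, z (Sum.inr 0)) else 0 := fun _ => rfl
  rw [QOp.applySys]
  by_cases h : z (Sum.inr 1) = 0 ∧ z (Sum.inr 2) = 0
  · rw [if_pos h]
    exact Finset.sum_congr rfl fun x _ => by rw [h1, if_pos h]
  · rw [if_neg h]
    exact Finset.sum_eq_zero fun x _ => by rw [h1, if_neg h, mul_zero]

theorem implements_systemGate (U : SysMatrix n) (UI : unitaryGroup (SysBasis n) ℂ) (inv : Bool) :
    Implements U UI.1 [.queryUI inv] (systemGate (if inv then UI⁻¹ else UI)) := by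
  intro ψ
  ext z
  simp only [QCircuit.act, List.foldl_cons, List.foldl_nil, QOp.apply, applySys_logEmbed]
  rw [logEmbed]
  congr 1
  rw [systemGate, blockDiagonal_mulVec]
  cases inv <;> rfl

theorem implements_controlledGate (U : unitaryGroup (SysBasis n) ℂ) (UI : SysMatrix n)
    (inv : Bool) : Implements U.1 UI [.queryU (some 0) inv]
      (controlledGate (if inv then U⁻¹ else U)) := by
  intro ψ
  ext z
  change (if z (Sum.inr 0) = 1 then
    QOp.applySys (if inv then U.1ᴴ else U.1) (logEmbed ψ) z else logEmbed ψ z) = _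
  rw [applySys_logEmbed]
  simp only [logEmbed]
  rw [controlledGate, blockDiagonal_mulVec]
  by_cases h : z (Sum.inr 1) = 0 ∧ z (Sum.inr 2) = 0
  · rw [if_pos h, if_pos h, if_pos h]
    by_cases h1 : z (Sum.inr 0) = 1
    · rw [if_pos h1, if_pos h1]
      cases inv <;> rfl
    · rw [if_neg h1, if_neg h1]
      simp [one_apply]
  · rw [if_neg h, if_neg h, if_neg h, ite_self]

/-! ### Reflections of the logical register and their circuits -/

theorem diagonal_sign_mem (p : LogBasis n → Prop) [DecidablePred p] :
    diagonal (fun i => if p i then (-1 : ℂ) else 1) ∈ unitaryGroup (LogBasis n) ℂ := by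
  rw [mem_unitaryGroup_iff, star_eq_conjTranspose, diagonal_conjTranspose, diagonal_mul_diagonal,
    ← diagonal_one]
  congr 1
  ext i
  by_cases h : p i <;> simp [h]

/-- The reflection that changes the sign of the basis states satisfying `p`. -/
def signReflection (p : LogBasis n → Prop) [DecidablePred p] : unitaryGroup (LogBasis n) ℂ :=
  ⟨_, diagonal_sign_mem p⟩

theorem signReflection_mulVec (p : LogBasis n → Prop) [DecidablePred p] (ψ : LogBasis n → ℂ)
    (i : LogBasis n) : ((signReflection p).1 *ᵥ ψ) i = (if p i then -1 else 1) * ψ i := by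
  rw [signReflection, mulVec_diagonal]

theorem signReflection_inv (p : LogBasis n → Prop) [DecidablePred p] :
    (signReflection p)⁻¹ = signReflection p := by
  apply Subtype.ext
  rw [unitary_inv_val]
  simp only [signReflection, diagonal_conjTranspose]
  congr 1
  ext i
  by_cases h : p i <;> simp [h]

/-- Change the sign if the signal qubit is zero. -/
noncomputable def signalSignCircuit (n : ℕ) : QCircuit n 3 :=
  [.oneQubit (Sum.inr 0) ⟨phasedPerm (Equiv.refl _) fun b => if b = 0 then -1 else 1,
    phasedPerm_mem _ fun b => by split_ifs <;> simp⟩]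

theorem implements_signalSign (U UI : SysMatrix n) :
    Implements U UI (signalSignCircuit n) (signReflection fun i => i.2 = 0) := by
  intro ψ
  ext z
  simp only [QCircuit.act, signalSignCircuit, List.foldl_cons, List.foldl_nil, QOp.apply,
    phasedPerm_sum]
  simp only [logEmbed, signReflection_mulVec]
  simp

/-- The first half of the system qubits. -/
def firstHalf (n : ℕ) : List (Wire n 3) := ((List.finRange n).take (n / 2)).map Sum.inl

/-- The second half of the system qubits. -/
def secondHalf (n : ℕ) : List (Wire n 3) := ((List.finRange n).drop (n / 2)).map Sum.inl

theorem halves_append (n : ℕ) : firstHalf n ++ secondHalf n = (List.finRange n).map Sum.inl := by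
  rw [firstHalf, secondHalf, ← List.map_append, List.take_append_drop]

theorem halves_nodup (n : ℕ) : (firstHalf n ++ secondHalf n).Nodup := by
  rw [halves_append]
  exact (List.nodup_finRange n).map Sum.inl_injective

theorem length_firstHalf (n : ℕ) : (firstHalf n).length = n / 2 := by
  simp [firstHalf]; omega

theorem length_secondHalf (n : ℕ) : (secondHalf n).length = n - n / 2 := by
  simp [secondHalf]

theorem inr_notMem_firstHalf (j : Fin 3) : Sum.inr j ∉ firstHalf n := by
  intro h
  obtain ⟨i, -, hi⟩ := List.mem_map.mp h
  simp at hi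

theorem inr_notMem_secondHalf (j : Fin 3) : Sum.inr j ∉ secondHalf n := by
  intro h
  obtain ⟨i, -, hi⟩ := List.mem_map.mp h
  simp at hi

/-- Change the sign of the all-zero state of the logical register. -/
noncomputable def zeroReflectionCircuit (n : ℕ) : QCircuit n 3 :=
  multiToggle (firstHalf n) (Sum.inr 1 :: (secondHalf n).take (n / 2)) ++
  multiToggle (secondHalf n) (Sum.inr 2 :: (firstHalf n ++ [Sum.inr 0]).take (n - n / 2)) ++
  doublyControlledSign (Sum.inr 0) (Sum.inr 1) (Sum.inr 2) (by simp) (by simp) (by simp) ++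
  multiToggle (secondHalf n) (Sum.inr 2 :: (firstHalf n ++ [Sum.inr 0]).take (n - n / 2)) ++
  multiToggle (firstHalf n) (Sum.inr 1 :: (secondHalf n).take (n / 2))

theorem toggle_first_act (U UI : SysMatrix n) (ψ : DevState n 3) (z : DevBasis n 3) :
    QCircuit.act U UI (multiToggle (firstHalf n) (Sum.inr 1 :: (secondHalf n).take (n / 2))) ψ z =
      ψ (Function.update z (Sum.inr 1) (z (Sum.inr 1) + allZero (firstHalf n) z)) := by
  apply multiToggle_act
  · simp only [List.length_take, length_firstHalf, length_secondHalf]; omega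
  · have h := List.nodup_append.mp (halves_nodup n)
    rw [List.nodup_append]
    refine ⟨h.1, List.nodup_cons.mpr ⟨fun h' => inr_notMem_secondHalf _ (List.mem_of_mem_take h'),
      h.2.1.sublist (List.take_sublist _ _)⟩, fun x hx y hy => ?_⟩
    rcases List.mem_cons.mp hy with rfl | hy
    · rintro rfl; exact inr_notMem_firstHalf _ hx
    · exact h.2.2 x hx y (List.mem_of_mem_take hy)

theorem toggle_second_act (U UI : SysMatrix n) (ψ : DevState n 3) (z : DevBasis n 3) :
    QCircuit.act U UI (multiToggle (secondHalf n)
      (Sum.inr 2 :: (firstHalf n ++ [Sum.inr 0]).take (n - n / 2))) ψ z =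
      ψ (Function.update z (Sum.inr 2) (z (Sum.inr 2) + allZero (secondHalf n) z)) := by
  apply multiToggle_act
  · simp only [List.length_take, length_firstHalf, length_secondHalf, List.length_append,
      List.length_singleton]; omega
  · have h := List.nodup_append.mp (halves_nodup n)
    have hmem : ∀ y ∈ (firstHalf n ++ [Sum.inr 0]).take (n - n / 2), y ∈ firstHalf n ∨ y = Sum.inr 0 := by
      intro y hy
      simpa using List.mem_of_mem_take hy
    rw [List.nodup_append]
    refine ⟨h.2.1, List.nodup_cons.mpr ⟨fun h' => ?_, ?_⟩, fun x hx y hy => ?_⟩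
    · rcases hmem _ h' with h' | h'
      · exact inr_notMem_firstHalf _ h'
      · simp at h'
    · refine List.Nodup.sublist (List.take_sublist _ _) ?_
      rw [List.nodup_append]
      refine ⟨h.1, by simp, fun x hx y hy => ?_⟩
      rw [List.mem_singleton] at hy
      subst hy
      rintro rfl
      exact inr_notMem_firstHalf _ hx
    · rcases List.mem_cons.mp hy with rfl | hy
      · rintro rfl; exact inr_notMem_secondHalf _ hx
      · rcases hmem _ hy with h' | h'
        · exact (h.2.2 y h' x hx).symm
        · subst h'; rintro rfl; exact inr_notMem_secondHalf _ hx

theorem allZero_update_inr {cs : List (Wire n 3)} {j : Fin 3} (h : Sum.inr j ∉ cs)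
    (z : DevBasis n 3) (v : Fin 2) : allZero cs (Function.update z (Sum.inr j) v) = allZero cs z :=
  allZero_congr fun c hc => by
    rw [Function.update_of_ne]; rintro rfl; exact h hc

/-- The work qubits collect whether each half of the system register is zero, a three-qubit sign
combines them with the signal qubit, and the toggles are undone. For odd `n` the second half is
larger by one, so it borrows the signal qubit too. -/
theorem implements_zeroReflection (U UI : SysMatrix n) :
    Implements U UI (zeroReflectionCircuit n) (signReflection fun i => i = (fun _ => 0, 0)) := by
  intro ψ
  ext z
  have h2 : ∀ x y : Fin 2, x + y + y = x := by decide
  have h10 : (Sum.inr 0 : Wire n 3) ≠ Sum.inr 1 := by simp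
  have h20 : (Sum.inr 0 : Wire n 3) ≠ Sum.inr 2 := by simp
  have h12 : (Sum.inr 1 : Wire n 3) ≠ Sum.inr 2 := by simp
  rw [zeroReflectionCircuit]
  simp only [QCircuit.act_append, toggle_first_act, toggle_second_act, doublyControlledSign_act,
    allZero_update_inr (inr_notMem_firstHalf _), allZero_update_inr (inr_notMem_secondHalf _),
    Function.update_self, Function.update_of_ne h10, Function.update_of_ne h20,
    Function.update_of_ne h12.symm, Function.update_idem, h2,
    Function.update_eq_self, Function.update_comm h12]
  by_cases hr : z ∈ Set.range (logLabel (n := n))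
  · obtain ⟨i, rfl⟩ := hr
    rw [logEmbed_logLabel, logEmbed_logLabel, signReflection_mulVec]
    congr 1
    refine if_congr ?_ rfl rfl
    have hz0 : logLabel i (Sum.inr 0) = i.2 := rfl
    have hz1 : logLabel i (Sum.inr 1) = 0 := rfl
    have hz2 : logLabel i (Sum.inr 2) = 0 := rfl
    have hone : ∀ cs : List (Wire n 3), 0 + allZero cs (logLabel i) = 1 ↔
        ∀ c ∈ cs, logLabel i c = 0 := by
      intro cs
      rw [zero_add, allZero]
      by_cases h : ∀ c ∈ cs, logLabel i c = 0
      · rw [if_pos h]; exact iff_of_true rfl h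
      · rw [if_neg h]; exact iff_of_false (by simp) h
    rw [hz0, hz1, hz2, hone, hone, ← List.forall_mem_append, halves_append, Prod.ext_iff]
    constructor
    · rintro ⟨h0, h⟩
      refine ⟨?_, h0⟩
      ext1 j
      exact h (Sum.inl j) (List.mem_map_of_mem (List.mem_finRange j))
    · rintro ⟨h, h0⟩
      refine ⟨h0, fun c hc => ?_⟩
      obtain ⟨j, -, rfl⟩ := List.mem_map.mp hc
      exact congrFun h j
  · rw [logEmbed_eq_zero _ hr, logEmbed_eq_zero _ hr, mul_zero]

theorem zeroReflectionCircuit_countP (n : ℕ) :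
    (zeroReflectionCircuit n).countP QOp.isGate ≤ 56 * n + 13 ∧
    (zeroReflectionCircuit n).countP QOp.isQueryU = 0 ∧
    (zeroReflectionCircuit n).countP QOp.isQueryUI = 0 := by
  obtain ⟨a1, a2, a3⟩ := multiToggle_countP (firstHalf n) (Sum.inr 1 :: (secondHalf n).take (n / 2))
  obtain ⟨b1, b2, b3⟩ := multiToggle_countP (secondHalf n)
    (Sum.inr 2 :: (firstHalf n ++ [Sum.inr 0]).take (n - n / 2))
  rw [length_firstHalf] at a1
  rw [length_secondHalf] at b1
  rw [zeroReflectionCircuit]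
  simp only [List.countP_append, a2, a3, b2, b3, (doublyControlledSign_countP _ _ _).1,
    (doublyControlledSign_countP _ _ _).2.1, (doublyControlledSign_countP _ _ _).2.2]
  refine ⟨by omega, trivial, trivial⟩

end Logical

/-! ### Eigenvalue filtering and amplitude amplification -/

section Amplification

open Matrix

variable {n : ℕ}

/-- The unitary that applies the signal processing sequence with controlled queries to `U`. -/
def filterUnitary (U : unitaryGroup (SysBasis n) ℂ) (R₀ : unitaryGroup (Fin 2) ℂ) :
    List (unitaryGroup (Fin 2) ℂ) → unitaryGroup (LogBasis n) ℂ
  | [] => signalGate R₀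
  | R :: l => signalGate R * controlledGate U * filterUnitary U R₀ l

/-- The circuit of `filterUnitary`. -/
def filterCircuit (n : ℕ) (R₀ : unitaryGroup (Fin 2) ℂ) :
    List (unitaryGroup (Fin 2) ℂ) → QCircuit n 3
  | [] => [.oneQubit (Sum.inr 0) R₀]
  | R :: l => filterCircuit n R₀ l ++ ([.queryU (some 0) false] ++ [.oneQubit (Sum.inr 0) R])

/-- The circuit of the inverse of `filterUnitary`. -/
def filterInvCircuit (n : ℕ) (R₀ : unitaryGroup (Fin 2) ℂ) :
    List (unitaryGroup (Fin 2) ℂ) → QCircuit n 3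
  | [] => [.oneQubit (Sum.inr 0) R₀⁻¹]
  | R :: l => ([.oneQubit (Sum.inr 0) R⁻¹] ++ [.queryU (some 0) true]) ++ filterInvCircuit n R₀ l

theorem implements_filter (U : unitaryGroup (SysBasis n) ℂ) (UI : SysMatrix n)
    (R₀ : unitaryGroup (Fin 2) ℂ) : ∀ l : List (unitaryGroup (Fin 2) ℂ),
      Implements U.1 UI (filterCircuit n R₀ l) (filterUnitary U R₀ l)
  | [] => implements_signalGate _ _ _
  | R :: l => (implements_filter U UI R₀ l).append
      ((implements_controlledGate U UI false).append (implements_signalGate _ _ R))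

theorem implements_filterInv (U : unitaryGroup (SysBasis n) ℂ) (UI : SysMatrix n)
    (R₀ : unitaryGroup (Fin 2) ℂ) : ∀ l : List (unitaryGroup (Fin 2) ℂ),
      Implements U.1 UI (filterInvCircuit n R₀ l) (filterUnitary U R₀ l)⁻¹
  | [] => by
    rw [filterUnitary, ← signalGate_inv]
    exact implements_signalGate _ _ _
  | R :: l => by
    rw [filterUnitary, _root_.mul_inv_rev, _root_.mul_inv_rev, ← signalGate_inv, ← controlledGate_inv]
    exact ((implements_signalGate _ _ R⁻¹).append (implements_controlledGate U UI true)).append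
      (implements_filterInv U UI R₀ l)

/-- The circuits of the amplified unitary and of its inverse, after `j` rounds of threefold
amplification of the signal. -/
noncomputable def ampCircuits (n : ℕ) (R₀ : unitaryGroup (Fin 2) ℂ)
    (l : List (unitaryGroup (Fin 2) ℂ)) : ℕ → QCircuit n 3 × QCircuit n 3
  | 0 => ([.queryUI false] ++ filterCircuit n R₀ l, filterInvCircuit n R₀ l ++ [.queryUI true])
  | j + 1 =>
    let c := (ampCircuits n R₀ l j).1
    let c' := (ampCircuits n R₀ l j).2
    (c ++ (signalSignCircuit n ++ (c' ++ (zeroReflectionCircuit n ++ c))),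
      c' ++ (zeroReflectionCircuit n ++ (c ++ (signalSignCircuit n ++ c'))))

/-- One round of amplification. -/
def amplify (A : unitaryGroup (LogBasis n) ℂ) : unitaryGroup (LogBasis n) ℂ :=
  A * signReflection (fun i => i = (fun _ => 0, 0)) * A⁻¹ * signReflection (fun i => i.2 = 0) * A

/-- The unitary of `ampCircuits`. -/
def ampUnitary (U UI : unitaryGroup (SysBasis n) ℂ) (R₀ : unitaryGroup (Fin 2) ℂ)
    (l : List (unitaryGroup (Fin 2) ℂ)) (j : ℕ) : unitaryGroup (LogBasis n) ℂ :=
  amplify^[j] (filterUnitary U R₀ l * systemGate UI)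

/-- The next round needs the inverse as well, so both circuits are built together. The reflections
are involutions, hence reversing the order inverts a round. -/
theorem implements_ampCircuits (U UI : unitaryGroup (SysBasis n) ℂ) (R₀ : unitaryGroup (Fin 2) ℂ)
    (l : List (unitaryGroup (Fin 2) ℂ)) (j : ℕ) :
    Implements U.1 UI.1 (ampCircuits n R₀ l j).1 (ampUnitary U UI R₀ l j) ∧
    Implements U.1 UI.1 (ampCircuits n R₀ l j).2 (ampUnitary U UI R₀ l j)⁻¹ := by
  induction j with
  | zero =>
    constructor
    · exact (implements_systemGate U.1 UI false).append (implements_filter U UI.1 R₀ l)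
    · rw [ampUnitary, Function.iterate_zero, id, _root_.mul_inv_rev, ← systemGate_inv]
      exact (implements_filterInv U UI.1 R₀ l).append (implements_systemGate U.1 UI true)
  | succ j ih =>
    have hstep : ampUnitary U UI R₀ l (j + 1) = amplify (ampUnitary U UI R₀ l j) :=
      Function.iterate_succ_apply' _ _ _
    obtain ⟨h, h'⟩ := ih
    have hχ := implements_signalSign U.1 UI.1
    have h0 := implements_zeroReflection U.1 UI.1
    rw [hstep, amplify]
    constructor
    · exact h.append (hχ.append (h'.append (h0.append h)))
    · simp only [_root_.mul_inv_rev, inv_inv, signReflection_inv]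
      have := h'.append (h0.append (h.append (hχ.append h')))
      simp only [mul_assoc] at this ⊢
      exact this

/-! ### Amplitude amplification -/

/-- The probability that the signal qubit is zero. -/
noncomputable def goodProb (A : unitaryGroup (LogBasis n) ℂ) : ℝ :=
  ∑ x : SysBasis n, ‖A.1 (x, 0) (fun _ => 0, 0)‖ ^ 2

theorem sum_column_norm_sq (A : unitaryGroup (LogBasis n) ℂ) (j : LogBasis n) :
    ∑ i, ‖A.1 i j‖ ^ 2 = 1 := by
  have h := congrFun (congrFun (mem_unitaryGroup_iff'.mp A.2) j) j
  rw [mul_apply, one_apply_eq] at h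
  have h2 : ((∑ i, ‖A.1 i j‖ ^ 2 : ℝ) : ℂ) = 1 := by
    rw [← h, Complex.ofReal_sum]
    refine Finset.sum_congr rfl fun i _ => ?_
    rw [star_apply, mul_comm, ← mul_conj_eq_norm_sq]
    rfl
  exact_mod_cast h2

theorem sum_logBasis (f : LogBasis n → ℝ) :
    ∑ i, f i = ∑ x : SysBasis n, f (x, 0) + ∑ x : SysBasis n, f (x, 1) := by
  rw [Fintype.sum_prod_type_right, Fin.sum_univ_two]

/-- With `X` the initial column after the first reflection, the round yields `X - 2 (Y o) A e_o`,
where `Y o` is the expectation `1 - 2 p` of the sign. On the good part `X = -A e_o`, whence the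
factor `-(1 + 2 (1 - 2 p))`. -/
theorem amplify_apply (A : unitaryGroup (LogBasis n) ℂ) (x : SysBasis n) :
    (amplify A).1 (x, 0) (fun _ => 0, 0) =
      -((3 - 4 * goodProb A : ℝ) : ℂ) * A.1 (x, 0) (fun _ => 0, 0) := by
  set o : LogBasis n := (fun _ => 0, 0) with ho
  set X : LogBasis n → ℂ :=
    (signReflection fun i : LogBasis n => i.2 = 0).1 *ᵥ (A.1 *ᵥ Pi.single o 1) with hX
  have hXi : ∀ i, X i = (if i.2 = 0 then -1 else 1) * A.1 i o := by
    intro i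
    rw [hX, signReflection_mulVec, mulVec_single_one]
    rfl
  set Y := (A⁻¹).1 *ᵥ X with hY
  have hAY : A.1 *ᵥ Y = X := by
    rw [hY, mulVec_mulVec, ← Submonoid.coe_mul, mul_inv_cancel, Submonoid.coe_one, one_mulVec]
  have hYo : Y o = ((1 - 2 * goodProb A : ℝ) : ℂ) := by
    have h1 : Y o = ((∑ i : LogBasis n, (if i.2 = 0 then -1 else 1) * ‖A.1 i o‖ ^ 2 : ℝ) : ℂ) := by
      rw [hY, mulVec, dotProduct, Complex.ofReal_sum]
      refine Finset.sum_congr rfl fun i _ => ?_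
      rw [hXi, unitary_inv_val, conjTranspose_apply, Complex.ofReal_mul, ← mul_conj_eq_norm_sq,
        Complex.star_def]
      split_ifs <;> push_cast <;> ring
    have h2 := sum_column_norm_sq A o
    rw [sum_logBasis] at h2
    rw [h1, sum_logBasis]
    congr 1
    have h3 : ∑ x : SysBasis n, (if ((x, (0 : Fin 2)) : LogBasis n).2 = 0 then (-1 : ℝ) else 1) *
        ‖A.1 (x, 0) o‖ ^ 2 = - goodProb A := by
      simp [goodProb, ho]
    have h4 : ∑ x : SysBasis n, (if ((x, (1 : Fin 2)) : LogBasis n).2 = 0 then (-1 : ℝ) else 1) *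
        ‖A.1 (x, 1) o‖ ^ 2 = ∑ x : SysBasis n, ‖A.1 (x, 1) o‖ ^ 2 := by
      simp
    rw [h3, h4]
    have h5 : ∑ x : SysBasis n, ‖A.1 (x, 0) o‖ ^ 2 = goodProb A := rfl
    linarith
  have hS : (signReflection fun i : LogBasis n => i = o).1 *ᵥ Y = Y - (2 * Y o) • Pi.single o 1 := by
    ext i
    rw [signReflection_mulVec]
    by_cases hi : i = o
    · subst hi; simp; ring
    · simp [hi]
  have hamp : (amplify A).1 *ᵥ Pi.single o 1 = X - (2 * Y o) • (A.1 *ᵥ Pi.single o 1) := by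
    have : (amplify A).1 = A.1 * (signReflection fun i : LogBasis n => i = o).1 * (A⁻¹).1 *
      (signReflection fun i : LogBasis n => i.2 = 0).1 * A.1 := rfl
    rw [this, ← mulVec_mulVec, ← mulVec_mulVec, ← mulVec_mulVec, ← mulVec_mulVec, ← hX, ← hY, hS,
      mulVec_sub, mulVec_smul, hAY]
  have hfin := congrFun hamp (x, 0)
  rw [mulVec_single_one, mulVec_single_one, Pi.sub_apply, Pi.smul_apply, hXi, hYo] at hfin
  have h6 : (amplify A).1 (x, 0) o = _ := hfin
  rw [h6]
  simp only [if_true, smul_eq_mul, col_apply]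
  push_cast
  ring

theorem goodProb_amplify (A : unitaryGroup (LogBasis n) ℂ) :
    goodProb (amplify A) = goodProb A * (3 - 4 * goodProb A) ^ 2 := by
  rw [goodProb]
  simp only [amplify_apply, norm_mul, norm_neg, Complex.norm_real, mul_pow, Real.norm_eq_abs,
    sq_abs]
  rw [← Finset.mul_sum, mul_comm]
  rfl

theorem goodProb_nonneg (A : unitaryGroup (LogBasis n) ℂ) : 0 ≤ goodProb A :=
  Finset.sum_nonneg fun _ _ => by positivity

theorem goodProb_le_one (A : unitaryGroup (LogBasis n) ℂ) : goodProb A ≤ 1 := by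
  have h := sum_column_norm_sq A (fun _ => 0, 0)
  rw [sum_logBasis] at h
  have : 0 ≤ ∑ x : SysBasis n, ‖A.1 (x, 1) (fun _ => 0, 0)‖ ^ 2 :=
    Finset.sum_nonneg fun _ _ => by positivity
  rw [goodProb]
  linarith

/-- The angle of the initial success amplitude. -/
noncomputable def goodAngle (A : unitaryGroup (LogBasis n) ℂ) : ℝ :=
  Real.arcsin (Real.sqrt (goodProb A))

/-- For `p = sin² θ` the new probability `p (3 - 4 p)²` is `sin² (3 θ)`. -/
theorem goodProb_iterate (A : unitaryGroup (LogBasis n) ℂ) (j : ℕ) :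
    goodProb (amplify^[j] A) = Real.sin (3 ^ j * goodAngle A) ^ 2 := by
  induction j with
  | zero =>
    rw [Function.iterate_zero, id, pow_zero, one_mul, goodAngle, Real.sin_arcsin,
      Real.sq_sqrt (goodProb_nonneg A)]
    · linarith [Real.sqrt_nonneg (goodProb A)]
    · exact Real.sqrt_le_one.mpr (goodProb_le_one A)
  | succ j ih =>
    rw [Function.iterate_succ_apply', goodProb_amplify, ih,
      show (3 : ℝ) ^ (j + 1) * goodAngle A = 3 * (3 ^ j * goodAngle A) by ring,
      Real.sin_three_mul]
    ring

/-- At the first level where the angle reaches `π / 6`, tripling cannot have carried it beyond `π /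
2`, so its sine is at least `1 / 2`. Level `J` does reach it, because `θ ≥ γ / 4` and `3 / 4 > π /
6`. -/
theorem exists_amplified {γ : ℝ} (hγ : 0 < γ) (A : unitaryGroup (LogBasis n) ℂ)
    (hA : (γ / 4) ^ 2 ≤ goodProb A) {J : ℕ} (hJ : 3 / γ ≤ 3 ^ J) :
    ∃ j ≤ J, 1 / 4 ≤ goodProb (amplify^[j] A) := by
  have hpi := Real.pi_pos
  set θ := goodAngle A with hθ
  have hsqrt : γ / 4 ≤ Real.sqrt (goodProb A) := Real.le_sqrt_of_sq_le hA
  have hsin : Real.sin θ = Real.sqrt (goodProb A) := by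
    rw [hθ, goodAngle, Real.sin_arcsin]
    · linarith [Real.sqrt_nonneg (goodProb A)]
    · exact Real.sqrt_le_one.mpr (goodProb_le_one A)
  have hθ0 : 0 ≤ θ := Real.arcsin_nonneg.mpr (Real.sqrt_nonneg _)
  have hθ1 : γ / 4 ≤ θ := by
    have := Real.sin_le hθ0
    linarith
  have hθ2 : θ ≤ Real.pi / 2 := Real.arcsin_le_pi_div_two _
  have hJθ : Real.pi / 6 ≤ 3 ^ J * θ := by
    have h1 : 3 / γ * (γ / 4) ≤ 3 ^ J * θ := by gcongr
    have h2 : 3 / γ * (γ / 4) = 3 / 4 := by field_simp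
    have := Real.pi_lt_d2
    linarith
  have hex : ∃ j, Real.pi / 6 ≤ 3 ^ j * θ := ⟨J, hJθ⟩
  classical
  refine ⟨Nat.find hex, Nat.find_le hJθ, ?_⟩
  have hspec := Nat.find_spec hex
  have hub : 3 ^ Nat.find hex * θ ≤ Real.pi / 2 := by
    rcases Nat.eq_zero_or_pos (Nat.find hex) with h0 | h0
    · rw [h0, pow_zero, one_mul]; exact hθ2
    · have h1 := Nat.find_min hex (Nat.sub_lt h0 one_pos)
      rw [not_le] at h1
      have h2 : (3 : ℝ) ^ Nat.find hex = 3 * 3 ^ (Nat.find hex - 1) := by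
        rw [← pow_succ', Nat.sub_add_cancel h0]
      rw [h2, mul_assoc]
      linarith
  rw [goodProb_iterate]
  have h3 : Real.sin (Real.pi / 6) ≤ Real.sin (3 ^ Nat.find hex * θ) :=
    Real.sin_le_sin_of_le_of_le_pi_div_two (by linarith) hub hspec
  rw [Real.sin_pi_div_six] at h3
  nlinarith

/-- A round at most triples the amplitude, since `|3 - 4 p| ≤ 3` on `[0, 1]`. This keeps a tiny
amplitude small at every level. -/
theorem goodProb_iterate_le (A : unitaryGroup (LogBasis n) ℂ) (j : ℕ) :
    goodProb (amplify^[j] A) ≤ 9 ^ j * goodProb A := by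
  induction j with
  | zero => simp
  | succ j ih =>
    rw [Function.iterate_succ_apply', goodProb_amplify, pow_succ]
    set p := goodProb (amplify^[j] A)
    have h0 : 0 ≤ p := goodProb_nonneg _
    have h1 : p ≤ 1 := goodProb_le_one _
    have h2 : (3 - 4 * p) ^ 2 ≤ 9 := by nlinarith
    calc p * (3 - 4 * p) ^ 2 ≤ p * 9 := by gcongr
      _ ≤ 9 ^ j * goodProb A * 9 := by gcongr
      _ = _ := by ring

/-- A product state of the system register and the signal qubit. -/
def tensorState (v : SysBasis n → ℂ) (χ : Fin 2 → ℂ) : LogBasis n → ℂ := fun i => v i.1 * χ i.2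

theorem signalGate_tensorState (G : unitaryGroup (Fin 2) ℂ) (v : SysBasis n → ℂ) (χ : Fin 2 → ℂ) :
    (signalGate G).1 *ᵥ tensorState v χ = tensorState v (G.1 *ᵥ χ) := by
  ext ⟨x, b⟩
  rw [signalGate_mulVec]
  simp only [tensorState, mulVec, dotProduct, Finset.mul_sum]
  exact Finset.sum_congr rfl fun _ _ => by ring

theorem controlledGate_tensorState (V : unitaryGroup (SysBasis n) ℂ) {v : SysBasis n → ℂ} {z : ℂ}
    (hv : V.1 *ᵥ v = z • v) (χ : Fin 2 → ℂ) :
    (controlledGate V).1 *ᵥ tensorState v χ = tensorState v ![χ 0, z * χ 1] := by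
  ext ⟨x, b⟩
  rw [controlledGate, blockDiagonal_mulVec]
  simp only [tensorState]
  simp only [← mul_assoc, ← Finset.sum_mul]
  have h := congrFun hv x
  simp only [mulVec, dotProduct, Pi.smul_apply, smul_eq_mul] at h
  fin_cases b
  · simp [one_apply]
  · simp [h]; ring

/-- Phase kickback: on an eigenvector of `U` a controlled query is the gate `diag (1, z)` on the
signal qubit. -/
theorem filterUnitary_tensorState (U : unitaryGroup (SysBasis n) ℂ) (R₀ : unitaryGroup (Fin 2) ℂ)
    {v : SysBasis n → ℂ} {z : ℂ} (hv : U.1 *ᵥ v = z • v) :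
    ∀ l : List (unitaryGroup (Fin 2) ℂ),
      (filterUnitary U R₀ l).1 *ᵥ tensorState v (Pi.single 0 1) =
        tensorState v (signalState z R₀ l)
  | [] => signalGate_tensorState _ _ _
  | R :: l => by
    have : (filterUnitary U R₀ (R :: l)).1 =
      (signalGate R).1 * (controlledGate U).1 * (filterUnitary U R₀ l).1 := rfl
    rw [this, ← mulVec_mulVec, ← mulVec_mulVec, filterUnitary_tensorState U R₀ hv l,
      controlledGate_tensorState U hv, signalGate_tensorState]
    rfl

end Amplification

/-! ### The success probability of the filtered initial state -/

section Spectral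

open Matrix

theorem exp_mulVec_of_eigenvector {ι : Type} [Fintype ι] [DecidableEq ι] {A : Matrix ι ι ℂ}
    {v : ι → ℂ} {z : ℂ} (h : A *ᵥ v = z • v) :
    NormedSpace.exp A *ᵥ v = Complex.exp z • v := by
  have hpow : ∀ k : ℕ, (A ^ k) *ᵥ v = z ^ k • v := by
    intro k
    induction k with
    | zero => simp
    | succ k ih => rw [pow_succ, ← mulVec_mulVec, h, mulVec_smul, ih, smul_smul, pow_succ']
  -- Any submultiplicative norm will do; it only gives convergence of the exponential series.
  let _ : NormedRing (Matrix ι ι ℂ) := Matrix.linftyOpNormedRing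
  let _ : NormedAlgebra ℂ (Matrix ι ι ℂ) := Matrix.linftyOpNormedAlgebra
  have h1 := NormedSpace.exp_series_hasSum_exp' (𝕂 := ℂ) A
  have h2 := h1.map (mulVecBilin ℂ ℂ |>.flip v).toAddMonoidHom (by
    exact (LinearMap.continuous_of_finiteDimensional (((mulVecBilin ℂ ℂ).flip v))))
  have h3 := (NormedSpace.exp_series_hasSum_exp' (𝕂 := ℂ) z).smul_const v
  rw [← Complex.exp_eq_exp_ℂ] at h3
  refine HasSum.unique ?_ h3
  convert h2 using 1
  · ext1 k
    simp [hpow, smul_smul]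
  · rfl

theorem timeEvolution_mem {n : ℕ} {H : SysMatrix n} (hH : H.IsHermitian) :
    timeEvolution H ∈ unitaryGroup (SysBasis n) ℂ := by
  rw [mem_unitaryGroup_iff', star_eq_conjTranspose, timeEvolution, ← exp_conjTranspose,
    conjTranspose_smul, hH.eq]
  have : star (-Complex.I) • H = -((-Complex.I) • H) := by
    simp
  rw [this, exp_neg]
  exact nonsing_inv_mul _ ((isUnit_iff_isUnit_det _).mp (isUnit_exp _))

theorem timeEvolution_mulVec {n : ℕ} {H : SysMatrix n} {v : SysBasis n → ℂ} {lam : ℝ}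
    (h : H *ᵥ v = (lam : ℂ) • v) :
    timeEvolution H *ᵥ v = Complex.exp (-(Complex.I * lam)) • v := by
  apply exp_mulVec_of_eigenvector
  rw [smul_mulVec, h, smul_smul, neg_mul]

variable {n : ℕ}

/-- The filtered initial state, in the eigenbasis of the Hamiltonian. -/
noncomputable def filteredState {H : SysMatrix n} (hH : H.IsHermitian) (UI : SysMatrix n)
    (f : ℝ → ℂ) : EuclideanSpace ℂ (SysBasis n) :=
  ∑ i, (f (hH.eigenvalues i) * inner ℂ (hH.eigenvectorBasis i) (preparedState UI)) •
    hH.eigenvectorBasis i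

/-- Each eigencomponent of the prepared state runs through its own signal sequence, so projecting on
signal zero applies a function of `H`. -/
theorem goodProb_filter {H : SysMatrix n} (hH : H.IsHermitian) (UI : unitaryGroup (SysBasis n) ℂ)
    (R₀ : unitaryGroup (Fin 2) ℂ) (l : List (unitaryGroup (Fin 2) ℂ)) :
    goodProb (filterUnitary ⟨timeEvolution H, timeEvolution_mem hH⟩ R₀ l * systemGate UI) =
      ‖filteredState hH UI.1 fun lam => signalState (Complex.exp (-(Complex.I * lam))) R₀ l 0‖ ^ 2 := by
  set U : unitaryGroup (SysBasis n) ℂ := ⟨timeEvolution H, timeEvolution_mem hH⟩ with hU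
  set b := hH.eigenvectorBasis with hb
  set c : SysBasis n → ℂ := fun i => inner ℂ (b i) (preparedState UI.1) with hc
  have hprep : (systemGate UI).1 *ᵥ Pi.single ((fun _ => 0, 0) : LogBasis n) 1 =
      ∑ i, c i • tensorState (b i).ofLp (Pi.single 0 1) := by
    have h1 : (systemGate UI).1 *ᵥ Pi.single ((fun _ => 0, 0) : LogBasis n) 1 =
        tensorState (preparedState UI.1).ofLp (Pi.single 0 1) := by
      ext ⟨x, b⟩
      rw [systemGate, blockDiagonal_mulVec]
      simp only [tensorState, preparedState, mulVec, dotProduct, Finset.sum_mul]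
      refine Finset.sum_congr rfl fun y _ => ?_
      by_cases hy : y = fun _ => 0
      · subst hy
        by_cases hb : b = 0
        · subst hb; simp
        · have : ((fun _ => 0, b) : LogBasis n) ≠ (fun _ => 0, 0) := by simpa using hb
          simp [hb, this]
      · have : ((y, b) : LogBasis n) ≠ (fun _ => 0, 0) := fun h => hy (Prod.ext_iff.mp h).1
        simp [hy, this]
    rw [h1]
    ext ⟨x, d⟩
    have h2 := congrArg (fun w : EuclideanSpace ℂ (SysBasis n) => w.ofLp x)
      (b.sum_repr' (preparedState UI.1))
    simp only [WithLp.ofLp_sum, WithLp.ofLp_smul, Finset.sum_apply, Pi.smul_apply] at h2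
    simp only [tensorState, Finset.sum_apply, Pi.smul_apply, smul_eq_mul, ← h2, Finset.sum_mul, hc]
    exact Finset.sum_congr rfl fun i _ => by ring
  have heig : ∀ i, U.1 *ᵥ (b i).ofLp =
      Complex.exp (-(Complex.I * (hH.eigenvalues i : ℂ))) • (b i).ofLp := by
    intro i
    apply timeEvolution_mulVec
    exact hH.mulVec_eigenvectorBasis i
  have hcol : ∀ x : SysBasis n, (filterUnitary U R₀ l * systemGate UI).1 (x, 0) (fun _ => 0, 0) =
      (filteredState hH UI.1 fun lam =>
        signalState (Complex.exp (-(Complex.I * lam))) R₀ l 0).ofLp x := by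
    intro x
    have h1 : (filterUnitary U R₀ l * systemGate UI).1 *ᵥ
        Pi.single ((fun _ => 0, 0) : LogBasis n) 1 =
        ∑ i, c i • tensorState (b i).ofLp
          (signalState (Complex.exp (-(Complex.I * (hH.eigenvalues i : ℂ)))) R₀ l) := by
      rw [Submonoid.coe_mul, ← mulVec_mulVec, hprep, mulVec_sum]
      refine Finset.sum_congr rfl fun i _ => ?_
      rw [mulVec_smul, filterUnitary_tensorState U R₀ (heig i)]
    rw [mulVec_single_one] at h1
    have h2 := congrFun h1 (x, 0)
    rw [col_apply] at h2
    rw [h2, filteredState]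
    simp only [WithLp.ofLp_sum, WithLp.ofLp_smul, Finset.sum_apply, Pi.smul_apply, tensorState,
      smul_eq_mul]
    exact Finset.sum_congr rfl fun i _ => by ring
  rw [goodProb, EuclideanSpace.norm_sq_eq]
  exact Finset.sum_congr rfl fun x _ => by rw [hcol]

theorem norm_preparedState (UI : unitaryGroup (SysBasis n) ℂ) : ‖preparedState UI.1‖ = 1 := by
  have h : ‖preparedState UI.1‖ ^ 2 = 1 := by
    rw [EuclideanSpace.norm_sq_eq]
    have h := congrFun (congrFun (mem_unitaryGroup_iff'.mp UI.2) fun _ => 0) fun _ => 0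
    rw [mul_apply, one_apply_eq] at h
    have h2 : ((∑ i, ‖UI.1 i fun _ => 0‖ ^ 2 : ℝ) : ℂ) = 1 := by
      rw [← h, Complex.ofReal_sum]
      refine Finset.sum_congr rfl fun i _ => ?_
      rw [star_apply, mul_comm, ← mul_conj_eq_norm_sq]
      rfl
    rw [preparedState, mulVec_single_one]
    exact_mod_cast h2
  nlinarith [norm_nonneg (preparedState UI.1)]

theorem norm_filteredState_le {H : SysMatrix n} (hH : H.IsHermitian)
    (UI : unitaryGroup (SysBasis n) ℂ) {f : ℝ → ℂ} {τ : ℝ}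
    (hf : ∀ i, ‖f (hH.eigenvalues i)‖ ≤ τ) : ‖filteredState hH UI.1 f‖ ^ 2 ≤ τ ^ 2 := by
  set b := hH.eigenvectorBasis with hb
  have h1 : ∀ i, inner ℂ (b i) (filteredState hH UI.1 f) =
      f (hH.eigenvalues i) * inner ℂ (b i) (preparedState UI.1) := by
    intro i
    rw [filteredState, b.orthonormal.inner_right_fintype]
  rw [← b.sum_sq_norm_inner_right, ← mul_one (τ ^ 2), ← one_pow 2, ← norm_preparedState UI,
    ← b.sum_sq_norm_inner_right, Finset.mul_sum]
  refine Finset.sum_le_sum fun i _ => ?_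
  rw [h1, norm_mul, mul_pow]
  have := hf i
  gcongr

/-- The ground space may be degenerate, so `ψ` need not be a basis vector. It is orthogonal to all
eigenvectors of other eigenvalues, hence its overlap is just multiplied by `f lam`, and
Cauchy–Schwarz concludes. -/
theorem le_norm_filteredState {H : SysMatrix n} (hH : H.IsHermitian)
    (UI : SysMatrix n) (f : ℝ → ℂ) {lam : ℝ} {ψ : EuclideanSpace ℂ (SysBasis n)} (hψ : ‖ψ‖ = 1)
    (hHψ : H *ᵥ ψ.ofLp = (lam : ℂ) • ψ.ofLp) :
    ‖f lam‖ * ‖inner ℂ (preparedState UI) ψ‖ ≤ ‖filteredState hH UI f‖ := by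
  set b := hH.eigenvectorBasis with hb
  have horth : ∀ i, hH.eigenvalues i ≠ lam → inner ℂ ψ (b i) = 0 := by
    intro i hi
    have h1 : (hH.eigenvalues i : ℂ) * inner ℂ ψ (b i) = lam * inner ℂ ψ (b i) := by
      rw [EuclideanSpace.inner_eq_star_dotProduct]
      have e1 : H *ᵥ (b i).ofLp = (hH.eigenvalues i : ℂ) • (b i).ofLp :=
        hH.mulVec_eigenvectorBasis i
      have h2 : (hH.eigenvalues i : ℂ) * ((b i).ofLp ⬝ᵥ star ψ.ofLp) =
          (H *ᵥ (b i).ofLp) ⬝ᵥ star ψ.ofLp := by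
        rw [e1, smul_dotProduct, smul_eq_mul]
      have h3 : (lam : ℂ) * ((b i).ofLp ⬝ᵥ star ψ.ofLp) =
          (b i).ofLp ⬝ᵥ star (H *ᵥ ψ.ofLp) := by
        rw [hHψ, star_smul, dotProduct_smul, smul_eq_mul, Complex.star_def, Complex.conj_ofReal]
      rw [h2, h3, star_mulVec, hH.eq, dotProduct_comm, dotProduct_mulVec, dotProduct_comm]
    by_contra hne
    exact hi (by exact_mod_cast mul_right_cancel₀ hne h1)
  have hinner : inner ℂ ψ (filteredState hH UI f) = f lam * inner ℂ ψ (preparedState UI) := by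
    conv_rhs => rw [← b.sum_repr' (preparedState UI)]
    rw [filteredState, inner_sum, inner_sum, Finset.mul_sum]
    refine Finset.sum_congr rfl fun i _ => ?_
    rw [inner_smul_right, inner_smul_right]
    by_cases hi : hH.eigenvalues i = lam
    · rw [hi]; ring
    · rw [horth i hi]; simp
  have h := norm_inner_le_norm (𝕜 := ℂ) ψ (filteredState hH UI f)
  rw [hψ, one_mul, hinner, norm_mul, norm_inner_symm] at h
  exact h

end Spectral

/-! ### Classical control: repetition, majority vote and bisection -/

section Control

open Matrix

variable {n : ℕ}

/-- The probability that a run of the circuit leaves the signal qubit in the state zero. -/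
noncomputable def acceptProb (U UI : SysMatrix n) (c : QCircuit n 3) : ℝ :=
  ∑ z, ‖c.run U UI z‖ ^ 2 * (if z (Sum.inr 0) = 0 then 1 else 0)

theorem Implements.acceptProb_eq {U UI : SysMatrix n} {c : QCircuit n 3}
    {A : unitaryGroup (LogBasis n) ℂ} (hc : Implements U UI c A) :
    acceptProb U UI c = goodProb A := by
  rw [acceptProb, hc.run, sum_logEmbed, sum_logBasis, mulVec_single_one]
  have h0 : ∀ x : SysBasis n, logLabel ((x, 0) : LogBasis n) (Sum.inr 0) = 0 := fun _ => rfl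
  have h1 : ∀ x : SysBasis n, logLabel ((x, 1) : LogBasis n) (Sum.inr 0) = 1 := fun _ => rfl
  simp [h0, h1, goodProb]

theorem Implements.sum_run {U UI : SysMatrix n} {c : QCircuit n 3}
    {A : unitaryGroup (LogBasis n) ℂ} (hc : Implements U UI c A) :
    ∑ z, ‖c.run U UI z‖ ^ 2 = 1 := by
  have h := sum_logEmbed (A.1 *ᵥ Pi.single (fun _ => 0, 0) 1) fun _ => 1
  simp only [mul_one] at h
  rw [hc.run, h, mulVec_single_one]
  exact sum_column_norm_sq A _

theorem prob_nonneg (U UI : SysMatrix n) (S : Set ℝ) {a : ℕ} :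
    ∀ A : QAlg n a, 0 ≤ A.prob U UI S
  | .output e => Set.indicator_nonneg (fun _ _ => zero_le_one) _
  | .coherentRun c next => Finset.sum_nonneg fun z _ =>
      mul_nonneg (by positivity) (prob_nonneg U UI S (next z))

/-- A procedure with a Boolean result, in continuation passing style, that gives `true` with
probability `q`. -/
def Decides (U UI : SysMatrix n) (T : (Bool → QAlg n 3) → QAlg n 3) (q : ℝ) : Prop :=
  ∀ (S : Set ℝ) (k : Bool → QAlg n 3),
    (T k).prob U UI S = q * (k true).prob U UI S + (1 - q) * (k false).prob U UI S

/-- Run the circuits one after the other until the signal qubit is found in the state zero. -/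
noncomputable def anyAccept : List (QCircuit n 3) → (Bool → QAlg n 3) → QAlg n 3
  | [], k => k false
  | c :: cs, k => .coherentRun c fun z => if z (Sum.inr 0) = 0 then k true else anyAccept cs k

/-- The probability that all the circuits are rejected. -/
noncomputable def rejectProb (U UI : SysMatrix n) (cs : List (QCircuit n 3)) : ℝ :=
  (cs.map fun c => 1 - acceptProb U UI c).prod

theorem decides_anyAccept (U UI : SysMatrix n) : ∀ cs : List (QCircuit n 3),
    (∀ c ∈ cs, ∑ z, ‖c.run U UI z‖ ^ 2 = 1) →
      Decides U UI (anyAccept cs) (1 - rejectProb U UI cs)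
  | [], _, S, k => by simp [anyAccept, rejectProb]
  | c :: cs, h, S, k => by
    have ih := decides_anyAccept U UI cs (fun c hc => h c (List.mem_cons_of_mem _ hc)) S k
    have hc := h c List.mem_cons_self
    set a := (k true).prob U UI S
    set b := (anyAccept cs k).prob U UI S with hb
    have h1 : (anyAccept (c :: cs) k).prob U UI S =
        acceptProb U UI c * a + (1 - acceptProb U UI c) * b := by
      have h2 : (anyAccept (c :: cs) k).prob U UI S = ∑ z, ‖c.run U UI z‖ ^ 2 *
          (if z (Sum.inr 0) = 0 then k true else anyAccept cs k).prob U UI S := rfl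
      have h3 : ∀ z : DevBasis n 3,
          ‖c.run U UI z‖ ^ 2 * (if z (Sum.inr 0) = 0 then k true else anyAccept cs k).prob U UI S =
          ‖c.run U UI z‖ ^ 2 * (if z (Sum.inr 0) = 0 then 1 else 0) * (a - b) +
            ‖c.run U UI z‖ ^ 2 * b := by
        intro z
        split_ifs <;> ring
      rw [h2, Finset.sum_congr rfl fun z _ => h3 z, Finset.sum_add_distrib, ← Finset.sum_mul,
        ← Finset.sum_mul, hc, ← acceptProb]
      ring
    have h4 : rejectProb U UI (c :: cs) = (1 - acceptProb U UI c) * rejectProb U UI cs := rfl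
    rw [h1, ih, h4]
    ring

/-- Repeat a decision procedure `M` times and take the majority, given the initial score `s`. -/
def vote (T : (Bool → QAlg n 3) → QAlg n 3) : ℕ → ℤ → (Bool → QAlg n 3) → QAlg n 3
  | 0, s, k => k (decide (0 < s))
  | M + 1, s, k => T fun b => vote T M (if b then s + 1 else s - 1) k

/-- The probability that the final score of `vote` is positive. -/
noncomputable def voteProb (q : ℝ) : ℕ → ℤ → ℝ
  | 0, s => if 0 < s then 1 else 0
  | M + 1, s => q * voteProb q M (s + 1) + (1 - q) * voteProb q M (s - 1)

theorem decides_vote {U UI : SysMatrix n} {T : (Bool → QAlg n 3) → QAlg n 3} {q : ℝ}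
    (hT : Decides U UI T q) : ∀ (M : ℕ) (s : ℤ), Decides U UI (vote T M s) (voteProb q M s)
  | 0, s, S, k => by
    by_cases h : 0 < s <;> simp [vote, voteProb, h]
  | M + 1, s, S, k => by
    rw [vote, hT, decides_vote hT M _ S k, decides_vote hT M _ S k, voteProb]
    simp only [if_true]
    rw [if_neg Bool.false_ne_true]
    ring

theorem voteProb_mem {q : ℝ} (h0 : 0 ≤ q) (h1 : q ≤ 1) : ∀ (M : ℕ) (s : ℤ),
    0 ≤ voteProb q M s ∧ voteProb q M s ≤ 1
  | 0, s => by rw [voteProb]; split_ifs <;> simp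
  | M + 1, s => by
    obtain ⟨a0, a1⟩ := voteProb_mem h0 h1 M (s + 1)
    obtain ⟨b0, b1⟩ := voteProb_mem h0 h1 M (s - 1)
    rw [voteProb]
    constructor
    · have := mul_nonneg h0 a0
      have := mul_nonneg (sub_nonneg.mpr h1) b0
      linarith
    · have := mul_le_mul_of_nonneg_left a1 h0
      have := mul_le_mul_of_nonneg_left b1 (sub_nonneg.mpr h1)
      linarith

/-- Exponential potential: a vote multiplies the expectation of `(1 / 4) ^ s` by `q / 4 + 4 (1 - q)
≤ 31 / 64 < 1 / 2`, and the potential is at least one when the final score is not positive. -/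
theorem voteProb_of_high {q : ℝ} (h : 15 / 16 ≤ q) (h1 : q ≤ 1) : ∀ (M : ℕ) (s : ℤ),
    1 - voteProb q M s ≤ (1 / 4 : ℝ) ^ s * (1 / 2) ^ M
  | 0, s => by
    rw [voteProb]
    split_ifs with hs
    · have : (0 : ℝ) < (1 / 4) ^ s := by positivity
      simpa using this.le
    · have : (1 : ℝ) ≤ (1 / 4) ^ s := by
        rw [one_div, _root_.inv_zpow', ← zpow_zero (4 : ℝ)]
        exact zpow_le_zpow_right₀ (by norm_num) (by omega)
      simpa using this
  | M + 1, s => by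
    have a := voteProb_of_high h h1 M (s + 1)
    have b := voteProb_of_high h h1 M (s - 1)
    rw [zpow_add_one₀ (by norm_num)] at a
    rw [zpow_sub_one₀ (by norm_num)] at b
    rw [voteProb, pow_succ]
    have hP : (0 : ℝ) < (1 / 4 : ℝ) ^ s * (1 / 2) ^ M := by positivity
    set P := (1 / 4 : ℝ) ^ s with hPdef
    have a' := mul_le_mul_of_nonneg_left a (by linarith : (0 : ℝ) ≤ q)
    have b' := mul_le_mul_of_nonneg_left b (by linarith : (0 : ℝ) ≤ 1 - q)
    norm_num at a' b' ⊢
    nlinarith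

/-- The mirror image, with the potential `4 ^ s`. -/
theorem voteProb_of_low {q : ℝ} (h : q ≤ 1 / 16) (h0 : 0 ≤ q) : ∀ (M : ℕ) (s : ℤ),
    voteProb q M s ≤ (4 : ℝ) ^ s * (1 / 2) ^ M
  | 0, s => by
    rw [voteProb]
    split_ifs with hs
    · have : (1 : ℝ) ≤ 4 ^ s := by
        rw [← zpow_zero (4 : ℝ)]
        exact zpow_le_zpow_right₀ (by norm_num) (by omega)
      simpa using this
    · positivity
  | M + 1, s => by
    have a := voteProb_of_low h h0 M (s + 1)
    have b := voteProb_of_low h h0 M (s - 1)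
    rw [zpow_add_one₀ (by norm_num)] at a
    rw [zpow_sub_one₀ (by norm_num)] at b
    rw [voteProb, pow_succ]
    have hP : (0 : ℝ) < (4 : ℝ) ^ s * (1 / 2) ^ M := by positivity
    set P := (4 : ℝ) ^ s with hPdef
    have a' := mul_le_mul_of_nonneg_left a h0
    have b' := mul_le_mul_of_nonneg_left b (by linarith : (0 : ℝ) ≤ 1 - q)
    norm_num at a' b' ⊢
    nlinarith

/-- Fuzzy bisection of the interval `[a, b]` with tests of resolution `δ`. -/
noncomputable def bisect (T : ℝ → (Bool → QAlg n 3) → QAlg n 3) (δ : ℝ) : ℕ → ℝ → ℝ → QAlg n 3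
  | 0, a, b => .output ((a + b) / 2)
  | N + 1, a, b => T ((a + b) / 2) fun acc =>
      if acc then bisect T δ N a ((a + b) / 2 + δ) else bisect T δ N ((a + b) / 2 - δ) b

/-- The excess of the length over `2 δ` halves exactly at each step, so after `N` steps the length
is at most `4 δ` and the midpoint is accurate to `2 δ`. Only an answer outside the gap can lose
`lam`, at a cost `κ` per step. -/
theorem prob_bisect {U UI : SysMatrix n} {T : ℝ → (Bool → QAlg n 3) → QAlg n 3} {δ κ lam : ℝ}
    (hδ : 0 < δ) (hκ : 0 ≤ κ)
    (hT : ∀ μ, δ ≤ μ → μ ≤ Real.pi - δ → ∃ q, Decides U UI (T μ) q ∧ 0 ≤ q ∧ q ≤ 1 ∧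
      (lam ≤ μ - δ → 1 - κ ≤ q) ∧ (μ + δ ≤ lam → q ≤ κ)) :
    ∀ (N : ℕ) (a b : ℝ), 0 ≤ a → b ≤ Real.pi → a ≤ lam → lam ≤ b → 2 * δ ≤ b - a →
      b - a - 2 * δ ≤ 2 * δ * 2 ^ N →
      1 - N * κ ≤ (bisect T δ N a b).prob U UI {e : ℝ | |e - lam| ≤ 2 * δ}
  | 0, a, b, _, _, hal, hlb, _, hN => by
    have : (a + b) / 2 ∈ {e : ℝ | |e - lam| ≤ 2 * δ} := by
      rw [Set.mem_ofPred_eq, abs_le]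
      constructor <;> linarith
    simp only [bisect, QAlg.prob, Set.indicator_of_mem this]
    simp
  | N + 1, a, b, ha, hb, hal, hlb, hab, hN => by
    set μ := (a + b) / 2 with hμ
    obtain ⟨q, hq, h0, h1, hlow, hhigh⟩ := hT μ (by linarith) (by linarith)
    rw [pow_succ] at hN
    have hX1 : 1 - N * κ ≤ 1 := by
      have : (0 : ℝ) ≤ N * κ := by positivity
      linarith
    rw [bisect, hq]
    simp only [if_true]
    rw [if_neg Bool.false_ne_true, ← hμ]
    set P := (bisect T δ N a (μ + δ)).prob U UI {e : ℝ | |e - lam| ≤ 2 * δ} with hP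
    set Q := (bisect T δ N (μ - δ) b).prob U UI {e : ℝ | |e - lam| ≤ 2 * δ} with hQ
    have hP0 : 0 ≤ P := prob_nonneg _ _ _ _
    have hQ0 : 0 ≤ Q := prob_nonneg _ _ _ _
    have hP1 : lam ≤ μ + δ → 1 - N * κ ≤ P := fun h =>
      prob_bisect hδ hκ hT N a (μ + δ) ha (by linarith) hal h (by linarith) (by linarith)
    have hQ1 : μ - δ ≤ lam → 1 - N * κ ≤ Q := fun h =>
      prob_bisect hδ hκ hT N (μ - δ) b (by linarith) hb h hlb (by linarith) (by linarith)
    push_cast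
    have hqP := mul_nonneg h0 hP0
    have hqQ := mul_nonneg (sub_nonneg.mpr h1) hQ0
    -- A negative bound is trivial; otherwise the bounds may be multiplied by probabilities.
    rcases lt_or_ge (1 - N * κ) 0 with hneg | hX0
    · linarith
    by_cases hl : lam ≤ μ - δ
    · have hp := hP1 (by linarith)
      have := hlow hl
      have h2 := mul_le_mul_of_nonneg_left hp h0
      nlinarith
    · by_cases hh : μ + δ ≤ lam
      · have hp := hQ1 (by linarith)
        have := hhigh hh
        have h2 := mul_le_mul_of_nonneg_left hp (sub_nonneg.mpr h1)
        nlinarith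
      -- Inside the gap both subintervals contain `lam`, so nothing is lost whatever the answer.
      · have h2 := mul_le_mul_of_nonneg_left (hP1 (by linarith)) h0
        have h3 := mul_le_mul_of_nonneg_left (hQ1 (by linarith)) (sub_nonneg.mpr h1)
        nlinarith

/-! ### Worst-case costs of the control procedures -/

/-- The procedure performs at most `x` operations of kind `p`. -/
def TotalCost (p : QOp n 3 → Bool) (T : (Bool → QAlg n 3) → QAlg n 3) (x : ℕ) : Prop :=
  ∀ (k : Bool → QAlg n 3) (B : ℕ), (∀ b, (k b).totalCount p ≤ B) → (T k).totalCount p ≤ x + B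

/-- The procedure performs at most `x` operations of kind `p` in each coherent run. -/
def RunCost (p : QOp n 3 → Bool) (T : (Bool → QAlg n 3) → QAlg n 3) (x : ℕ) : Prop :=
  ∀ k : Bool → QAlg n 3, (∀ b, (k b).maxCountPerRun p ≤ x) → (T k).maxCountPerRun p ≤ x

variable {p : QOp n 3 → Bool}

theorem totalCost_anyAccept : ∀ cs : List (QCircuit n 3),
    TotalCost p (anyAccept cs) (cs.map (List.countP p)).sum
  | [], k, B, h => by simpa [anyAccept] using h false
  | c :: cs, k, B, h => by
    have ih := totalCost_anyAccept cs k B h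
    rw [anyAccept, QAlg.totalCount, List.map_cons, List.sum_cons, add_assoc]
    refine Nat.add_le_add_left (Finset.sup_le fun z _ => ?_) _
    split_ifs
    · exact (h true).trans (Nat.le_add_left _ _)
    · exact ih

theorem runCost_anyAccept {x : ℕ} : ∀ cs : List (QCircuit n 3), (∀ c ∈ cs, List.countP p c ≤ x) →
    RunCost p (anyAccept cs) x
  | [], _, k, h => h false
  | c :: cs, hcs, k, h => by
    have ih := runCost_anyAccept cs (fun c hc => hcs c (List.mem_cons_of_mem _ hc)) k h
    rw [anyAccept, QAlg.maxCountPerRun]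
    refine max_le (hcs c List.mem_cons_self) (Finset.sup_le fun z _ => ?_)
    split_ifs
    · exact h true
    · exact ih

theorem totalCost_vote {T : (Bool → QAlg n 3) → QAlg n 3} {x : ℕ} (hT : TotalCost p T x) :
    ∀ (M : ℕ) (s : ℤ), TotalCost p (vote T M s) (M * x)
  | 0, s, k, B, h => by rw [vote, zero_mul, zero_add]; exact h _
  | M + 1, s, k, B, h => by
    rw [vote, add_mul, one_mul, add_comm (M * x), add_assoc]
    exact hT _ _ fun b => totalCost_vote hT M _ k B h

theorem runCost_vote {T : (Bool → QAlg n 3) → QAlg n 3} {x : ℕ} (hT : RunCost p T x) :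
    ∀ (M : ℕ) (s : ℤ), RunCost p (vote T M s) x
  | 0, _, _, h => h _
  | M + 1, _, k, h => hT _ fun _ => runCost_vote hT M _ k h

theorem totalCost_bisect {T : ℝ → (Bool → QAlg n 3) → QAlg n 3} {x : ℕ}
    (hT : ∀ μ, TotalCost p (T μ) x) (δ : ℝ) :
    ∀ (N : ℕ) (a b : ℝ), (bisect T δ N a b).totalCount p ≤ N * x
  | 0, a, b => by simp [bisect, QAlg.totalCount]
  | N + 1, a, b => by
    rw [bisect, add_mul, one_mul, add_comm (N * x)]
    refine hT _ _ _ fun acc => ?_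
    split_ifs <;> exact totalCost_bisect hT δ N _ _

theorem runCost_bisect {T : ℝ → (Bool → QAlg n 3) → QAlg n 3} {x : ℕ}
    (hT : ∀ μ, RunCost p (T μ) x) (δ : ℝ) :
    ∀ (N : ℕ) (a b : ℝ), (bisect T δ N a b).maxCountPerRun p ≤ x
  | 0, a, b => by simp [bisect, QAlg.maxCountPerRun]
  | N + 1, a, b => by
    rw [bisect]
    refine hT _ _ fun acc => ?_
    split_ifs <;> exact runCost_bisect hT δ N _ _

end Control

/-! ### The energy test -/

section EnergyTest

open Matrix

variable {n : ℕ}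

/-- Rotations whose signal processing sequence separates low from high energies. -/
theorem exists_filter_rotations {μ δ τ : ℝ} (hδ : 0 < δ) (hμ₁ : δ ≤ μ) (hμ₂ : μ ≤ Real.pi - δ)
    (hτ : τ ≤ 1) {m r : ℕ} (hm : 7 / δ ≤ m) (hr : 2 * m ≤ τ * 2 ^ r) :
    ∃ (R₀ : unitaryGroup (Fin 2) ℂ) (l : List (unitaryGroup (Fin 2) ℂ)),
      l.length = 2 * (r * m) ∧ ∀ lam : ℝ, 0 < lam → lam < Real.pi →
        (lam ≤ μ - δ → 1 / 4 ≤ ‖signalState (Complex.exp (-(Complex.I * lam))) R₀ l 0‖) ∧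
        (μ + δ ≤ lam → ‖signalState (Complex.exp (-(Complex.I * lam))) R₀ l 0‖ ≤ τ / 2) := by
  obtain ⟨P, hP, hlt, hval⟩ := exists_energy_filter hδ hμ₁ hμ₂ hτ hm hr
  obtain ⟨Q, hQ, hPQ⟩ := exists_complementary hP hlt
  obtain ⟨R₀, l, hl, hs⟩ := exists_rotations _ P Q hP hQ hPQ
  refine ⟨R₀, l, hl, fun lam h0 h1 => ?_⟩
  rw [hs _ (by
    rw [← mul_neg, ← Complex.ofReal_neg, mul_comm]; exact Complex.norm_exp_ofReal_mul_I _)]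
  exact hval lam h0 h1

theorem filterCircuit_countP (n : ℕ) (R₀ : unitaryGroup (Fin 2) ℂ) :
    ∀ l : List (unitaryGroup (Fin 2) ℂ),
      (filterCircuit n R₀ l).countP QOp.isQueryU = l.length ∧
      (filterCircuit n R₀ l).countP QOp.isQueryUI = 0 ∧
      (filterCircuit n R₀ l).countP QOp.isGate = l.length + 1
  | [] => ⟨rfl, rfl, rfl⟩
  | R :: l => by
    obtain ⟨h1, h2, h3⟩ := filterCircuit_countP n R₀ l
    rw [filterCircuit]
    simp only [List.countP_append, h1, h2, h3]
    exact ⟨rfl, rfl, rfl⟩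

theorem filterInvCircuit_countP (n : ℕ) (R₀ : unitaryGroup (Fin 2) ℂ) :
    ∀ l : List (unitaryGroup (Fin 2) ℂ),
      (filterInvCircuit n R₀ l).countP QOp.isQueryU = l.length ∧
      (filterInvCircuit n R₀ l).countP QOp.isQueryUI = 0 ∧
      (filterInvCircuit n R₀ l).countP QOp.isGate = l.length + 1
  | [] => ⟨rfl, rfl, rfl⟩
  | R :: l => by
    obtain ⟨h1, h2, h3⟩ := filterInvCircuit_countP n R₀ l
    rw [filterInvCircuit]
    simp only [List.countP_append, h1, h2, h3]
    refine ⟨?_, rfl, ?_⟩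
    · change 0 + 1 + l.length = l.length + 1
      omega
    · change 1 + 0 + (l.length + 1) = l.length + 1 + 1
      omega

theorem ampCircuits_countP_queryU (n : ℕ) (R₀ : unitaryGroup (Fin 2) ℂ)
    (l : List (unitaryGroup (Fin 2) ℂ)) (j : ℕ) :
    (ampCircuits n R₀ l j).1.countP QOp.isQueryU = 3 ^ j * l.length ∧
    (ampCircuits n R₀ l j).2.countP QOp.isQueryU = 3 ^ j * l.length := by
  induction j with
  | zero =>
    simp only [ampCircuits, List.countP_append, (filterCircuit_countP n R₀ l).1,
      (filterInvCircuit_countP n R₀ l).1]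
    constructor <;> simp [QOp.isQueryU]
  | succ j ih =>
    simp only [ampCircuits, List.countP_append, ih.1, ih.2, (zeroReflectionCircuit_countP n).2.1]
    have : (signalSignCircuit n).countP QOp.isQueryU = 0 := rfl
    rw [this]
    constructor <;> ring

theorem ampCircuits_countP_queryUI (n : ℕ) (R₀ : unitaryGroup (Fin 2) ℂ)
    (l : List (unitaryGroup (Fin 2) ℂ)) (j : ℕ) :
    (ampCircuits n R₀ l j).1.countP QOp.isQueryUI = 3 ^ j ∧
    (ampCircuits n R₀ l j).2.countP QOp.isQueryUI = 3 ^ j := by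
  induction j with
  | zero =>
    simp only [ampCircuits, List.countP_append, (filterCircuit_countP n R₀ l).2.1,
      (filterInvCircuit_countP n R₀ l).2.1]
    constructor <;> simp [QOp.isQueryUI]
  | succ j ih =>
    simp only [ampCircuits, List.countP_append, ih.1, ih.2, (zeroReflectionCircuit_countP n).2.2]
    have : (signalSignCircuit n).countP QOp.isQueryUI = 0 := rfl
    rw [this]
    constructor <;> ring

/-- A round uses three copies and at most `56 n + 14` further gates; adding this constant to the
count makes the recursion a pure threefold growth. -/
theorem ampCircuits_countP_gate (n : ℕ) (R₀ : unitaryGroup (Fin 2) ℂ)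
    (l : List (unitaryGroup (Fin 2) ℂ)) (j : ℕ) :
    (ampCircuits n R₀ l j).1.countP QOp.isGate + (56 * n + 14) ≤
      3 ^ j * (l.length + 56 * n + 15) ∧
    (ampCircuits n R₀ l j).2.countP QOp.isGate + (56 * n + 14) ≤
      3 ^ j * (l.length + 56 * n + 15) := by
  induction j with
  | zero =>
    simp only [ampCircuits, List.countP_append, (filterCircuit_countP n R₀ l).2.2,
      (filterInvCircuit_countP n R₀ l).2.2]
    constructor <;> simp [QOp.isGate] <;> omega
  | succ j ih =>
    simp only [ampCircuits, List.countP_append]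
    have h1 : (signalSignCircuit n).countP QOp.isGate = 1 := rfl
    have h2 := (zeroReflectionCircuit_countP n).1
    obtain ⟨i1, i2⟩ := ih
    rw [h1, pow_succ]
    constructor <;> nlinarith

/-- The circuits run in one trial: twelve repetitions of all levels of amplification up to `J`. -/
noncomputable def trialCircuits (n : ℕ) (R₀ : unitaryGroup (Fin 2) ℂ)
    (l : List (unitaryGroup (Fin 2) ℂ)) (J : ℕ) : List (QCircuit n 3) :=
  (List.replicate 12 ((List.range (J + 1)).map fun j => (ampCircuits n R₀ l j).1)).flatten

theorem mem_trialCircuits {R₀ : unitaryGroup (Fin 2) ℂ} {l : List (unitaryGroup (Fin 2) ℂ)} {J : ℕ}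
    {c : QCircuit n 3} (h : c ∈ trialCircuits n R₀ l J) :
    ∃ j ≤ J, (ampCircuits n R₀ l j).1 = c := by
  rw [trialCircuits, List.mem_flatten] at h
  obtain ⟨b, hb, hc⟩ := h
  rw [List.eq_of_mem_replicate hb, List.mem_map] at hc
  obtain ⟨j, hj, rfl⟩ := hc
  exact ⟨j, Nat.lt_succ_iff.mp (List.mem_range.mp hj), rfl⟩

/-- The geometric series is dominated by its last term, so trying all levels costs no factor `J`. -/
theorem sum_map_range_le {f : ℕ → ℕ} {x : ℕ} (hf : ∀ j, f j ≤ 3 ^ j * x) (K : ℕ) :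
    ((List.range K).map f).sum ≤ 3 ^ K * x := by
  induction K with
  | zero => simp
  | succ K ih =>
    rw [List.range_succ, List.map_append, List.sum_append, pow_succ]
    have := hf K
    simp only [List.map_cons, List.map_nil, List.sum_cons, List.sum_nil]
    nlinarith

theorem sum_trialCircuits_le {R₀ : unitaryGroup (Fin 2) ℂ} {l : List (unitaryGroup (Fin 2) ℂ)}
    {J x : ℕ} {p : QOp n 3 → Bool}
    (h : ∀ j, (ampCircuits n R₀ l j).1.countP p ≤ 3 ^ j * x) :
    ((trialCircuits n R₀ l J).map (List.countP p)).sum ≤ 12 * (3 ^ (J + 1) * x) := by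
  have h1 := sum_map_range_le h (J + 1)
  rw [trialCircuits, List.map_flatten, List.sum_flatten, List.map_replicate, List.map_replicate,
    List.sum_replicate, smul_eq_mul, List.map_map]
  exact Nat.mul_le_mul_left _ h1

theorem rejectProb_trial (U UI : SysMatrix n) (R₀ : unitaryGroup (Fin 2) ℂ)
    (l : List (unitaryGroup (Fin 2) ℂ)) (J : ℕ) :
    rejectProb U UI (trialCircuits n R₀ l J) =
      rejectProb U UI ((List.range (J + 1)).map fun j => (ampCircuits n R₀ l j).1) ^ 12 := by
  rw [rejectProb, trialCircuits, List.map_flatten, List.prod_flatten, List.map_replicate,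
    List.map_replicate, List.prod_replicate]
  rfl

theorem rejectProb_mem {U UI : SysMatrix n} : ∀ cs : List (QCircuit n 3),
    (∀ c ∈ cs, 0 ≤ acceptProb U UI c ∧ acceptProb U UI c ≤ 1) →
      0 ≤ rejectProb U UI cs ∧ rejectProb U UI cs ≤ 1
  | [], _ => by simp [rejectProb]
  | c :: cs, h => by
    obtain ⟨h0, h1⟩ := rejectProb_mem cs fun c hc => h c (List.mem_cons_of_mem _ hc)
    obtain ⟨a0, a1⟩ := h c List.mem_cons_self
    have h4 : rejectProb U UI (c :: cs) = (1 - acceptProb U UI c) * rejectProb U UI cs := rfl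
    rw [h4]
    exact ⟨mul_nonneg (by linarith) h0, mul_le_one₀ (by linarith) h0 h1⟩

theorem rejectProb_le_of_mem {U UI : SysMatrix n} {x : ℝ} : ∀ cs : List (QCircuit n 3),
    (∀ c ∈ cs, 0 ≤ acceptProb U UI c ∧ acceptProb U UI c ≤ 1) →
      (∃ c ∈ cs, x ≤ acceptProb U UI c) → rejectProb U UI cs ≤ 1 - x
  | [], _, h => by simp at h
  | c :: cs, h, hx => by
    have hcs : ∀ c ∈ cs, 0 ≤ acceptProb U UI c ∧ acceptProb U UI c ≤ 1 :=
      fun c hc => h c (List.mem_cons_of_mem _ hc)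
    obtain ⟨h0, h1⟩ := rejectProb_mem cs hcs
    obtain ⟨a0, a1⟩ := h c List.mem_cons_self
    have h4 : rejectProb U UI (c :: cs) = (1 - acceptProb U UI c) * rejectProb U UI cs := rfl
    rw [h4]
    obtain ⟨d, hd, hxd⟩ := hx
    rcases List.mem_cons.mp hd with rfl | hd
    · nlinarith
    · have := rejectProb_le_of_mem cs hcs ⟨d, hd, hxd⟩
      nlinarith

/-- The union bound. -/
theorem le_rejectProb {U UI : SysMatrix n} : ∀ cs : List (QCircuit n 3),
    (∀ c ∈ cs, 0 ≤ acceptProb U UI c ∧ acceptProb U UI c ≤ 1) →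
      1 - (cs.map (acceptProb U UI)).sum ≤ rejectProb U UI cs
  | [], _ => by simp [rejectProb]
  | c :: cs, h => by
    have hcs : ∀ c ∈ cs, 0 ≤ acceptProb U UI c ∧ acceptProb U UI c ≤ 1 :=
      fun c hc => h c (List.mem_cons_of_mem _ hc)
    obtain ⟨h0, h1⟩ := rejectProb_mem cs hcs
    obtain ⟨a0, a1⟩ := h c List.mem_cons_self
    have h4 : rejectProb U UI (c :: cs) = (1 - acceptProb U UI c) * rejectProb U UI cs := rfl
    have := le_rejectProb cs hcs
    rw [h4, List.map_cons, List.sum_cons]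
    nlinarith

theorem sum_map_range_le_nine {f : ℕ → ℝ} {β : ℝ} (hf : ∀ j, f j ≤ 9 ^ j * β) (hβ : 0 ≤ β) (K : ℕ) :
    ((List.range K).map f).sum ≤ 9 ^ K * β / 8 := by
  induction K with
  | zero => simp; positivity
  | succ K ih =>
    rw [List.range_succ, List.map_append, List.sum_append, pow_succ]
    have := hf K
    simp only [List.map_cons, List.map_nil, List.sum_cons, List.sum_nil]
    linarith

theorem spectrum_of_instance {η γ : ℝ} {H UI : SysMatrix n} {lam₀ : ℝ} (hη : 0 < η)
    (h : IsGroundStateInstance η γ H UI lam₀) (i : SysBasis n) :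
    lam₀ ≤ h.isHermitian.eigenvalues i ∧ 0 < h.isHermitian.eigenvalues i ∧
      h.isHermitian.eigenvalues i < Real.pi := by
  have hmem : h.isHermitian.eigenvalues i ∈ spectrum ℝ H := by
    rw [h.isHermitian.spectrum_real_eq_range_eigenvalues]
    exact ⟨i, rfl⟩
  have h1 := h.spectrum_subset hmem
  exact ⟨h.isLeast.2 hmem, by linarith [h1.1], by linarith [h1.2]⟩

/-- One trial decides whether the ground-state energy is below `μ - δ` or above `μ + δ`. -/
theorem decides_trial {μ δ γ η : ℝ} (hη : 0 < η) (hγ : 0 < γ) {J : ℕ} (hJ₁ : 3 / γ ≤ 3 ^ J)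
    (hJ₂ : (3 : ℝ) ^ J ≤ 9 / γ) {R₀ : unitaryGroup (Fin 2) ℂ} {l : List (unitaryGroup (Fin 2) ℂ)}
    (hf : ∀ lam : ℝ, 0 < lam → lam < Real.pi →
        (lam ≤ μ - δ → 1 / 4 ≤ ‖signalState (Complex.exp (-(Complex.I * lam))) R₀ l 0‖) ∧
        (μ + δ ≤ lam → ‖signalState (Complex.exp (-(Complex.I * lam))) R₀ l 0‖ ≤ γ / 100 / 2))
    {H UI : SysMatrix n} {lam₀ : ℝ} (h : IsGroundStateInstance η γ H UI lam₀) :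
    ∃ q, Decides (timeEvolution H) UI (anyAccept (trialCircuits n R₀ l J)) q ∧ 0 ≤ q ∧ q ≤ 1 ∧
      (lam₀ ≤ μ - δ → 15 / 16 ≤ q) ∧ (μ + δ ≤ lam₀ → q ≤ 1 / 16) := by
  set U : unitaryGroup (SysBasis n) ℂ := ⟨timeEvolution H, timeEvolution_mem h.isHermitian⟩ with hU
  set V : unitaryGroup (SysBasis n) ℂ := ⟨UI, h.unitary⟩ with hV
  have himpl := fun j => (implements_ampCircuits U V R₀ l j).1
  set A₀ := filterUnitary U R₀ l * systemGate V with hA₀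
  have hacc : ∀ j, acceptProb (timeEvolution H) UI (ampCircuits n R₀ l j).1 =
      goodProb (amplify^[j] A₀) := fun j => (himpl j).acceptProb_eq
  have hrun : ∀ c ∈ trialCircuits n R₀ l J, ∑ z, ‖c.run (timeEvolution H) UI z‖ ^ 2 = 1 := by
    intro c hc
    obtain ⟨j, -, rfl⟩ := mem_trialCircuits hc
    exact (himpl j).sum_run
  set cs : List (QCircuit n 3) := (List.range (J + 1)).map fun j => (ampCircuits n R₀ l j).1 with hcs
  have hprob : ∀ c ∈ cs, 0 ≤ acceptProb (timeEvolution H) UI c ∧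
      acceptProb (timeEvolution H) UI c ≤ 1 := by
    intro c hc
    obtain ⟨j, -, rfl⟩ := List.mem_map.mp hc
    rw [hacc]
    exact ⟨goodProb_nonneg _, goodProb_le_one _⟩
  obtain ⟨hr0, hr1⟩ := rejectProb_mem cs hprob
  have hgood := goodProb_filter h.isHermitian V R₀ l
  refine ⟨_, decides_anyAccept _ _ _ hrun, ?_, ?_, fun hlow => ?_, fun hhigh => ?_⟩ <;>
    rw [rejectProb_trial, ← hcs]
  · linarith [pow_le_one₀ (n := 12) hr0 hr1]
  · linarith [pow_nonneg hr0 12]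
  · have hmem := h.spectrum_subset h.isLeast.1
    obtain ⟨ψ, hψ, hHψ, hov⟩ := h.overlap
    have hf0 := (hf lam₀ (by linarith [hmem.1]) (by linarith [hmem.2])).1 hlow
    have hle := le_norm_filteredState h.isHermitian UI
      (fun lam => signalState (Complex.exp (-(Complex.I * lam))) R₀ l 0) hψ hHψ
    have hA : (γ / 4) ^ 2 ≤ goodProb A₀ := by
      rw [hA₀, hgood]
      have : γ / 4 ≤ ‖filteredState h.isHermitian V.1
          fun lam => signalState (Complex.exp (-(Complex.I * lam))) R₀ l 0‖ := by
        refine le_trans ?_ hle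
        calc γ / 4 = 1 / 4 * γ := by ring
          _ ≤ _ := by gcongr
      gcongr
    -- The right level depends on the unknown overlap, but it is among those tried.
    obtain ⟨j, hj, hquarter⟩ := exists_amplified hγ A₀ hA hJ₁
    have hrej := rejectProb_le_of_mem (x := 1 / 4) cs hprob ⟨_, List.mem_map.mpr ⟨j, List.mem_range.mpr
      (Nat.lt_succ_of_le hj), rfl⟩, by rw [hacc]; exact hquarter⟩
    -- `(3 / 4) ^ 12 < 1 / 16`.
    have := pow_le_pow_left₀ hr0 hrej 12
    norm_num at this
    linarith
  · have hA : goodProb A₀ ≤ (γ / 100 / 2) ^ 2 := by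
      rw [hA₀, hgood]
      apply norm_filteredState_le
      intro i
      obtain ⟨h1, h2, h3⟩ := spectrum_of_instance hη h i
      exact (hf _ h2 h3).2 (hhigh.trans h1)
    have hsum : (cs.map (acceptProb (timeEvolution H) UI)).sum ≤
        9 ^ (J + 1) * (γ / 100 / 2) ^ 2 / 8 := by
      rw [hcs, List.map_map]
      refine sum_map_range_le_nine (fun j => ?_) (by positivity) _
      rw [Function.comp_apply, hacc]
      refine (goodProb_iterate_le A₀ j).trans ?_
      gcongr
    -- The left-hand side is at most `729 / 320000`. The target `1 / 192` leaves `12 / 192 = 1 / 16`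
    -- for the twelve repetitions, by Bernoulli's inequality.
    have h9 : (9 : ℝ) ^ (J + 1) * (γ / 100 / 2) ^ 2 / 8 ≤ 1 / 192 := by
      have h1 : (3 : ℝ) ^ J * γ ≤ 9 := by rwa [le_div_iff₀ hγ] at hJ₂
      have h2 : (9 : ℝ) ^ (J + 1) = 9 * (3 ^ J) ^ 2 := by
        rw [pow_succ, ← pow_mul, mul_comm J 2, pow_mul]; norm_num [mul_comm]
      have h3 : ((3 : ℝ) ^ J * γ) ^ 2 ≤ 9 ^ 2 := by gcongr
      rw [h2]
      nlinarith
    have hrej := le_rejectProb cs hprob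
    have hbern := one_add_mul_le_pow (a := rejectProb (timeEvolution H) UI cs - 1) (by linarith) 12
    rw [add_sub_cancel] at hbern
    push_cast at hbern
    linarith

end EnergyTest

/-! ### Choice of the parameters and the cost of the algorithm -/

section Cost

theorem exists_pow_two_gt {x : ℝ} (hx : 1 ≤ x) :
    ∃ k : ℕ, x < 2 ^ k * 2 ∧ (k : ℝ) ≤ 2 * Real.log x := by
  obtain ⟨k, hk1, hk2⟩ := exists_nat_pow_near hx one_lt_two
  refine ⟨k, by rwa [pow_succ] at hk2, ?_⟩
  have h1 : Real.log (2 ^ k) ≤ Real.log x := Real.log_le_log (by positivity) hk1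
  rw [Real.log_pow] at h1
  have h2 := Real.log_two_gt_d9
  have h3 : (0 : ℝ) ≤ k := Nat.cast_nonneg k
  nlinarith

theorem log_le_of_le_exp {x y : ℝ} (hx : 0 < x) (h : x ≤ Real.exp y) : Real.log x ≤ y :=
  (Real.log_le_iff_le_exp hx).mpr h

theorem exp_nat_ge (k : ℕ) : (2.718 : ℝ) ^ k ≤ Real.exp k := by
  rw [← mul_one (k : ℝ), Real.exp_nat_mul]
  have := Real.exp_one_gt_d9
  exact pow_le_pow_left₀ (by norm_num) (by linarith) _

/-- The parameters of the algorithm: the kernel width `m`, its power `r`, the number `J` of levels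
of amplification, the number `N` of bisection steps and the number `M` of votes per step. -/
theorem exists_parameters {γ ε ϑ : ℝ} (hγ : 0 < γ) (hγ1 : γ ≤ 1) (hε : 0 < ε) (hε1 : ε < 1)
    (hϑ : 0 < ϑ) (hϑ1 : ϑ ≤ 1 / 2) :
    ∃ m r J N M : ℕ, 7 / (ε / 2) ≤ (m : ℝ) ∧ 2 * (m : ℝ) ≤ γ / 100 * 2 ^ r ∧
      3 / γ ≤ (3 : ℝ) ^ J ∧ (3 : ℝ) ^ J ≤ 9 / γ ∧
      Real.pi - ε ≤ ε * 2 ^ N ∧ (N : ℝ) * (1 / 2) ^ M ≤ ϑ ∧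
      (m : ℝ) ≤ 15 * ε⁻¹ ∧ (r : ℝ) ≤ 18 * (1 + Real.log ε⁻¹ + Real.log γ⁻¹) ∧
      (N : ℝ) ≤ 4 * (1 + Real.log ε⁻¹) ∧
      (M : ℝ) ≤ 14 * (1 + Real.log ε⁻¹) * Real.log ϑ⁻¹ := by
  have hpi := Real.pi_pos
  have hpi3 := Real.pi_gt_three
  have hpi4 := Real.pi_lt_d2
  have hei : 1 < ε⁻¹ := (one_lt_inv₀ hε).mpr hε1
  have hgi : 1 ≤ γ⁻¹ := (one_le_inv₀ hγ).mpr hγ1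
  have hti : 2 ≤ ϑ⁻¹ := by
    rw [le_inv_comm₀ (by norm_num) hϑ]; linarith
  have ha : 0 < Real.log ε⁻¹ := Real.log_pos hei
  have hg : 0 ≤ Real.log γ⁻¹ := Real.log_nonneg hgi
  have ht : 2 / 3 ≤ Real.log ϑ⁻¹ := by
    have h1 := Real.log_le_log (by norm_num) hti
    have := Real.log_two_gt_d9
    linarith
  -- The resolution is `δ = ε / 2`, so `7 / δ = 14 / ε`.
  obtain ⟨m, hm1, hm2⟩ : ∃ m : ℕ, 14 * ε⁻¹ ≤ m ∧ (m : ℝ) ≤ 15 * ε⁻¹ := by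
    refine ⟨⌈14 * ε⁻¹⌉₊, Nat.le_ceil _, ?_⟩
    have := Nat.ceil_lt_add_one (show 0 ≤ 14 * ε⁻¹ by positivity)
    linarith
  have hm0 : (1 : ℝ) ≤ m := by linarith
  obtain ⟨r, hr1, hr2⟩ := exists_pow_two_gt (x := 400 * m * γ⁻¹) (by nlinarith)
  obtain ⟨J, hJ1, hJ2⟩ := exists_nat_pow_near (x := 9 * γ⁻¹) (y := (3 : ℝ)) (by linarith)
    (by norm_num)
  -- Bisection starts from `[0, π]`, so `2 ^ N` has to be of order `π / ε`. Below, `2 ^ M` of order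
  -- `N / ϑ` makes the errors of all steps add up to at most `ϑ`.
  obtain ⟨N, hN1, hN2⟩ := exists_pow_two_gt (x := 2 * Real.pi * ε⁻¹) (by nlinarith)
  have hNpos : (1 : ℝ) ≤ N := by
    rcases Nat.eq_zero_or_pos N with h0 | h0
    · rw [h0, pow_zero] at hN1
      nlinarith
    · exact_mod_cast h0
  obtain ⟨M, hM1, hM2⟩ := exists_pow_two_gt (x := 2 * N * ϑ⁻¹) (by nlinarith)
  have hNbd : (N : ℝ) ≤ 4 + 2 * Real.log ε⁻¹ := by
    rw [Real.log_mul (by positivity) (by positivity)] at hN2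
    have h1 : Real.log (2 * Real.pi) ≤ 2 := by
      apply log_le_of_le_exp (by positivity)
      have := exp_nat_ge 2
      norm_num at this
      linarith
    linarith
  refine ⟨m, r, J, N, M, ?_, ?_, ?_, ?_, ?_, ?_, hm2, ?_, by linarith, ?_⟩
  · calc 7 / (ε / 2) = 14 * ε⁻¹ := by field_simp; norm_num
      _ ≤ m := hm1
  · have h1 : 400 * m ≤ 2 ^ r * 2 * γ := by
      have := mul_le_mul_of_nonneg_right hr1.le hγ.le
      rwa [mul_assoc, inv_mul_cancel₀ hγ.ne', mul_one] at this
    linarith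
  · rw [pow_succ] at hJ2
    rw [div_eq_mul_inv]
    linarith
  · rwa [div_eq_mul_inv]
  · have := mul_le_mul_of_nonneg_right hN1.le hε.le
    rw [mul_assoc, inv_mul_cancel₀ hε.ne', mul_one] at this
    linarith
  · have := mul_le_mul_of_nonneg_right hM1.le hϑ.le
    rw [mul_assoc, inv_mul_cancel₀ hϑ.ne', mul_one] at this
    rw [one_div, inv_pow, ← div_eq_mul_inv, div_le_iff₀ (by positivity)]
    linarith
  · have h1 : Real.log (400 * m * γ⁻¹) ≤ 9 + Real.log ε⁻¹ + Real.log γ⁻¹ := by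
      rw [Real.log_mul (by positivity) (by positivity)]
      have h2 : Real.log (400 * m) ≤ Real.log (6000 * ε⁻¹) :=
        Real.log_le_log (by positivity) (by linarith)
      rw [Real.log_mul (x := 6000) (by norm_num) (by positivity)] at h2
      have h3 : Real.log 6000 ≤ 9 := by
        apply log_le_of_le_exp (by norm_num)
        have := exp_nat_ge 9
        norm_num at this
        linarith
      linarith
    linarith
  · rw [Real.log_mul (by positivity) (by positivity), Real.log_mul (by norm_num) (by positivity)]
      at hM2
    have h1 := Real.log_le_sub_one_of_pos (show (0 : ℝ) < N by linarith)
    have h2 := Real.log_two_lt_d9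
    nlinarith

/-- In these bounds `a`, `t` stand for `log ε⁻¹`, `log ϑ⁻¹`, further `u = γ⁻¹`, `v = ε⁻¹`, and `X`
is the logarithmic factor of `softBound`. The constant `18144 = 4 · 14 · 12 · 27` collects bisection
steps, votes, repetitions and `3 ^ (J + 1) ≤ 27 / γ`. Two powers of `X` absorb `(1 + a) ^ 2`, the
third the logarithm in `L`. -/
theorem queriesU_bound {a t u v X L : ℝ} (ha : 0 ≤ a) (ht : 0 ≤ t) (hu : 0 ≤ u) (hv : 0 ≤ v)
    (hL0 : 0 ≤ L) (hX : 1 + a ≤ 2 * X) (hL : L ≤ 540 * (2 * X) * v) :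
    18144 * (1 + a) ^ 2 * t * u * L ≤ 100000000 * (v * u * t) * X ^ 3 := by
  have hX0 : 0 ≤ X := by linarith
  calc 18144 * (1 + a) ^ 2 * t * u * L
      ≤ 18144 * (2 * X) ^ 2 * t * u * (540 * (2 * X) * v) := by gcongr
    _ = 78382080 * ((v * u * t) * X ^ 3) := by ring
    _ ≤ 100000000 * ((v * u * t) * X ^ 3) := by gcongr; norm_num
    _ = _ := by ring

theorem queriesUI_bound {a t u : ℝ} (ha : 0 ≤ a) (ht : 2 / 3 ≤ t) (hu : 0 ≤ u) :
    18144 * (1 + a) ^ 2 * t * u ≤ 100000000 * u * (a + t) ^ 3 := by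
  have h3 : 1 + a ≤ 2 * (a + t) := by linarith
  have h4 : t ≤ a + t := by linarith
  calc 18144 * (1 + a) ^ 2 * t * u
      ≤ 18144 * (2 * (a + t)) ^ 2 * (a + t) * u := by gcongr
    _ = 72576 * (u * (a + t) ^ 3) := by ring
    _ ≤ 100000000 * (u * (a + t) ^ 3) := by
      have : 0 ≤ u * (a + t) ^ 3 := by positivity
      linarith
    _ = _ := by ring

theorem gates_bound {a t u v X L n : ℝ} (ha : 0 ≤ a) (ht : 0 ≤ t) (hu : 0 ≤ u) (hv : 0 ≤ v)
    (hn : 0 ≤ n) (hL0 : 0 ≤ L) (hX1 : 1 ≤ X) (hX : 1 + a ≤ 2 * X) (hL : L + 15 ≤ 555 * (2 * X) * v) :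
    18144 * (1 + a) ^ 2 * t * u * (L + 56 * n + 15) ≤
      100000000 * (n * u * (a + t) + v * u * t) * X ^ 3 := by
  have h5 : t ≤ a + t := by linarith
  have hX0 : 0 ≤ X := by linarith
  have h6 : 0 ≤ v * u * t * X ^ 3 := by positivity
  have h7 : 0 ≤ n * u * (a + t) * X ^ 2 := by positivity
  have h8 : n * u * (a + t) * X ^ 2 ≤ n * u * (a + t) * X ^ 3 := by
    gcongr
    norm_num
  calc 18144 * (1 + a) ^ 2 * t * u * (L + 56 * n + 15)
      = 18144 * (1 + a) ^ 2 * t * u * (L + 15) + 1016064 * (1 + a) ^ 2 * t * (u * n) := by ring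
    _ ≤ 18144 * (2 * X) ^ 2 * t * u * (555 * (2 * X) * v) +
        1016064 * (2 * X) ^ 2 * (a + t) * (u * n) := by gcongr
    _ = 80559360 * (v * u * t * X ^ 3) + 4064256 * (n * u * (a + t) * X ^ 2) := by ring
    _ ≤ 100000000 * (v * u * t * X ^ 3) + 100000000 * (n * u * (a + t) * X ^ 3) := by linarith
    _ = _ := by ring

theorem depth_bound {p b u v X L : ℝ} (hp0 : 0 ≤ p) (hb0 : 0 ≤ b) (hu : 0 ≤ u) (hv : 0 ≤ v)
    (hp : p ≤ 9 * u) (hL : L ≤ 540 * b * v) (hb : b ≤ X) (hX : 1 ≤ X) :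
    p * L ≤ 100000000 * (v * u) * X ^ 3 := by
  have hX0 : 0 ≤ X := by linarith
  have h1 : X ≤ X ^ 3 := le_self_pow₀ hX (by norm_num)
  have h2 : 0 ≤ v * u * X ^ 3 := by positivity
  calc p * L ≤ p * (540 * b * v) := by gcongr
    _ ≤ (9 * u) * (540 * X ^ 3 * v) := by
        have := hb.trans h1
        gcongr
    _ ≤ _ := by linarith

end Cost

/-! ### Assembly of the algorithm -/

theorem theorem3 :
    ∃ (C : ℝ) (k : ℕ), 0 < C ∧
      ∀ (n : ℕ) (η γ ε ϑ : ℝ), 0 < η → 0 < γ → γ ≤ 1 → 0 < ε → ε < 1 → 0 < ϑ → ϑ ≤ 1 / 2 →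
        ∃ A : QAlg n 3,
          (∀ (H UI : SysMatrix n) (lam₀ : ℝ), IsGroundStateInstance η γ H UI lam₀ →
            1 - ϑ ≤ A.prob (timeEvolution H) UI {e : ℝ | |e - lam₀| ≤ ε}) ∧
          (A.queriesU : ℝ) ≤ softBound C k (ε⁻¹ * γ⁻¹ * Real.log ϑ⁻¹) ∧
          (A.queriesUI : ℝ) ≤ C * γ⁻¹ * (Real.log (ε⁻¹ * ϑ⁻¹)) ^ k ∧
          (A.gates : ℝ) ≤
            softBound C k (n * γ⁻¹ * Real.log (ε⁻¹ * ϑ⁻¹) + ε⁻¹ * γ⁻¹ * Real.log ϑ⁻¹) ∧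
          (A.queryDepthU : ℝ) ≤ softBound C k (ε⁻¹ * γ⁻¹) := by
  refine ⟨100000000, 3, by norm_num, ?_⟩
  intro n η γ ε ϑ hη hγ hγ1 hε hε1 hϑ hϑ1
  obtain ⟨m, r, J, N, M, hm, hr, hJ₁, hJ₂, hN, hM, hmb, hrb, hNb, hMb⟩ :=
    exists_parameters hγ hγ1 hε hε1 hϑ hϑ1
  have hpi3 := Real.pi_gt_three
  have hδ : 0 < ε / 2 := by linarith
  have hrot : ∀ μ : ℝ, ∃ (R₀ : Matrix.unitaryGroup (Fin 2) ℂ)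
      (l : List (Matrix.unitaryGroup (Fin 2) ℂ)), l.length = 2 * (r * m) ∧
      (ε / 2 ≤ μ → μ ≤ Real.pi - ε / 2 → ∀ lam : ℝ, 0 < lam → lam < Real.pi →
        (lam ≤ μ - ε / 2 → 1 / 4 ≤ ‖signalState (Complex.exp (-(Complex.I * lam))) R₀ l 0‖) ∧
        (μ + ε / 2 ≤ lam →
          ‖signalState (Complex.exp (-(Complex.I * lam))) R₀ l 0‖ ≤ γ / 100 / 2)) := by
    intro μ
    by_cases h : ε / 2 ≤ μ ∧ μ ≤ Real.pi - ε / 2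
    · obtain ⟨R₀, l, hl, hf⟩ := exists_filter_rotations (τ := γ / 100) hδ h.1 h.2 (by linarith) hm hr
      exact ⟨R₀, l, hl, fun _ _ => hf⟩
    -- Outside this range the test needs no correctness, but a default sequence of the same length
    -- makes the cost bounds uniform in `μ`.
    · exact ⟨1, List.replicate (2 * (r * m)) 1, by simp, fun h1 h2 => absurd ⟨h1, h2⟩ h⟩
  choose R₀ l hl hf using hrot
  set T : ℝ → (Bool → QAlg n 3) → QAlg n 3 :=
    fun μ => vote (anyAccept (trialCircuits n (R₀ μ) (l μ) J)) M 0 with hT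
  set L := 2 * (r * m) with hL
  have hU : ∀ μ, TotalCost QOp.isQueryU (T μ) (M * (12 * (3 ^ (J + 1) * L))) := fun μ k B h =>
    (totalCost_vote (totalCost_anyAccept _) M 0 k B h).trans (by
      gcongr
      refine sum_trialCircuits_le fun j => ?_
      rw [(ampCircuits_countP_queryU n _ _ j).1, hl])
  have hUI : ∀ μ, TotalCost QOp.isQueryUI (T μ) (M * (12 * (3 ^ (J + 1) * 1))) := fun μ k B h =>
    (totalCost_vote (totalCost_anyAccept _) M 0 k B h).trans (by
      gcongr
      refine sum_trialCircuits_le fun j => ?_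
      rw [(ampCircuits_countP_queryUI n _ _ j).1, mul_one])
  have hG : ∀ μ, TotalCost QOp.isGate (T μ) (M * (12 * (3 ^ (J + 1) * (L + 56 * n + 15)))) :=
    fun μ k B h => (totalCost_vote (totalCost_anyAccept _) M 0 k B h).trans (by
      gcongr
      refine sum_trialCircuits_le fun j => ?_
      have := (ampCircuits_countP_gate n (R₀ μ) (l μ) j).1
      rw [hl] at this
      omega)
  -- Repetitions and votes are separate runs, so only the deepest level of amplification counts.
  have hD : ∀ μ, RunCost QOp.isQueryU (T μ) (3 ^ J * L) := fun μ =>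
    runCost_vote (runCost_anyAccept _ fun c hc => by
      obtain ⟨j, hj, rfl⟩ := mem_trialCircuits hc
      rw [(ampCircuits_countP_queryU n _ _ j).1, hl]
      exact Nat.mul_le_mul_right _ (Nat.pow_le_pow_right (by norm_num) hj)) M 0
  have hei : 1 < ε⁻¹ := (one_lt_inv₀ hε).mpr hε1
  have hgi : 1 ≤ γ⁻¹ := (one_le_inv₀ hγ).mpr hγ1
  have hti : 2 ≤ ϑ⁻¹ := by
    rw [le_inv_comm₀ (by norm_num) hϑ]; linarith
  set a := Real.log ε⁻¹ with hadef
  set g := Real.log γ⁻¹ with hgdef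
  set t := Real.log ϑ⁻¹ with htdef
  have ha : 0 < a := Real.log_pos hei
  have hg : 0 ≤ g := Real.log_nonneg hgi
  have ht : 2 / 3 ≤ t := by
    have h1 := Real.log_le_log (by norm_num) hti
    have := Real.log_two_gt_d9
    linarith
  have hℓ : Real.log (ε⁻¹ * ϑ⁻¹) = a + t := Real.log_mul (by positivity) (by positivity)
  have hag : a + g = Real.log (ε⁻¹ * γ⁻¹) := (Real.log_mul (by positivity) (by positivity)).symm
  have hLb : (L : ℝ) ≤ 540 * (1 + a + g) * ε⁻¹ := by
    rw [hL]
    push_cast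
    calc 2 * ((r : ℝ) * m) ≤ 2 * (18 * (1 + a + g) * (15 * ε⁻¹)) := by gcongr
      _ = _ := by ring
  have hJb : (3 : ℝ) ^ J ≤ 9 * γ⁻¹ := by rwa [← div_eq_mul_inv]
  -- Since `t ≥ 2 / 3`, any `G` above `ε⁻¹ γ⁻¹ t` also controls `ε⁻¹ γ⁻¹` up to a constant, and
  -- hence its logarithm `a + g`.
  have hlog : ∀ {G : ℝ}, ε⁻¹ * γ⁻¹ * t ≤ G → 1 + a + g ≤ 2 * (1 + Real.log (1 + G)) := by
    intro G hGle
    have h0 : 0 < ε⁻¹ * γ⁻¹ * t := by positivity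
    have h1 : ε⁻¹ * γ⁻¹ ≤ 2 * (1 + G) := by
      have : ε⁻¹ * γ⁻¹ * (2 / 3) ≤ ε⁻¹ * γ⁻¹ * t := by gcongr
      linarith
    have h2 := Real.log_le_log (by positivity) h1
    rw [Real.log_mul (x := 2) (by norm_num) (by linarith), ← hag] at h2
    have h3 := Real.log_two_lt_d9
    have h4 : 0 ≤ Real.log (1 + G) := Real.log_nonneg (by linarith)
    linarith
  have hNM : ∀ x : ℕ, ((N * (M * (12 * (3 ^ (J + 1) * x))) : ℕ) : ℝ) ≤
      18144 * (1 + a) ^ 2 * t * γ⁻¹ * x := by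
    intro x
    push_cast
    rw [pow_succ]
    calc (N : ℝ) * (M * (12 * (3 ^ J * 3 * x)))
        ≤ (4 * (1 + a)) * ((14 * (1 + a) * t) * (12 * ((9 * γ⁻¹) * 3 * x))) := by gcongr
      _ = _ := by ring
  refine ⟨bisect T (ε / 2) N 0 Real.pi, ?_, ?_, ?_, ?_, ?_⟩
  · intro H UI lam₀ hinst
    have hmem := hinst.spectrum_subset hinst.isLeast.1
    have hb := prob_bisect (U := timeEvolution H) (UI := UI) (T := T) (lam := lam₀)
      (κ := (1 / 2) ^ M) hδ (by positivity) (fun μ h1 h2 => by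
        obtain ⟨q, hq, h0, h1', hlow, hhigh⟩ := decides_trial hη hγ hJ₁ hJ₂ (hf μ h1 h2) hinst
        obtain ⟨v0, v1⟩ := voteProb_mem h0 h1' M 0
        refine ⟨_, decides_vote hq M 0, v0, v1, fun h => ?_, fun h => ?_⟩
        · have := voteProb_of_high (hlow h) h1' M 0
          rw [zpow_zero, one_mul] at this
          linarith
        · have := voteProb_of_low (hhigh h) h0 M 0
          rwa [zpow_zero, one_mul] at this)
      N 0 Real.pi le_rfl le_rfl (by linarith [hmem.1]) (by linarith [hmem.2]) (by linarith)
      (by linarith)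
    rw [mul_div_cancel₀ ε two_ne_zero] at hb
    linarith
  · have h1 := totalCost_bisect hU (ε / 2) N 0 Real.pi
    have h2 : ((bisect T (ε / 2) N 0 Real.pi).queriesU : ℝ) ≤ _ :=
      (Nat.cast_le.mpr h1).trans (hNM L)
    refine h2.trans ?_
    have hX := hlog (le_refl (ε⁻¹ * γ⁻¹ * t))
    rw [softBound]
    set X := 1 + Real.log (1 + ε⁻¹ * γ⁻¹ * t)
    exact queriesU_bound ha.le (by linarith) (by linarith) (by linarith) (Nat.cast_nonneg L) (by linarith)
      (hLb.trans (by gcongr))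
  · have h1 := totalCost_bisect hUI (ε / 2) N 0 Real.pi
    have h2 : ((bisect T (ε / 2) N 0 Real.pi).queriesUI : ℝ) ≤ _ :=
      (Nat.cast_le.mpr h1).trans (hNM 1)
    refine h2.trans ?_
    rw [hℓ]
    rw [Nat.cast_one, mul_one]
    exact queriesUI_bound ha.le ht (by linarith)
  · have h1 := totalCost_bisect hG (ε / 2) N 0 Real.pi
    have h2 : ((bisect T (ε / 2) N 0 Real.pi).gates : ℝ) ≤ _ :=
      (Nat.cast_le.mpr h1).trans (hNM _)
    refine h2.trans ?_
    rw [hℓ, softBound]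
    have hn0 : 0 ≤ n * γ⁻¹ * (a + t) := by positivity
    have hX := hlog (G := n * γ⁻¹ * (a + t) + ε⁻¹ * γ⁻¹ * t) (by linarith)
    set X := 1 + Real.log (1 + (n * γ⁻¹ * (a + t) + ε⁻¹ * γ⁻¹ * t)) with hXdef
    have hX1 : 1 ≤ X := by
      have : 0 ≤ Real.log (1 + (n * γ⁻¹ * (a + t) + ε⁻¹ * γ⁻¹ * t)) :=
        Real.log_nonneg (by
          have : 0 ≤ ε⁻¹ * γ⁻¹ * t := by positivity
          linarith)
      linarith
    have h4 : (L : ℝ) + 15 ≤ 555 * (2 * X) * ε⁻¹ := by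
      have h5 : 540 * (1 + a + g) * ε⁻¹ ≤ 540 * (2 * X) * ε⁻¹ := by gcongr
      have h6 : 1 ≤ (2 * X) * ε⁻¹ := by nlinarith
      linarith
    push_cast
    exact gates_bound ha.le (by linarith) (by linarith) (by linarith) (Nat.cast_nonneg n)
      (Nat.cast_nonneg L) hX1 (by linarith) h4
  · have h1 := runCost_bisect hD (ε / 2) N 0 Real.pi
    have h2 : ((bisect T (ε / 2) N 0 Real.pi).queryDepthU : ℝ) ≤ ((3 ^ J * L : ℕ) : ℝ) :=
      Nat.cast_le.mpr h1
    refine h2.trans ?_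
    have h3 : a + g ≤ Real.log (1 + ε⁻¹ * γ⁻¹) := by
      rw [hag]
      exact Real.log_le_log (by positivity) (by linarith)
    rw [softBound]
    set X := 1 + Real.log (1 + ε⁻¹ * γ⁻¹)
    have hX1 : 1 ≤ X := by linarith
    push_cast
    exact depth_bound (by positivity) (by linarith) (by linarith) (by linarith) hJb hLb (by linarith) hX1
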